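/- **Setting.** Let $k$ be a field, let $F$ and $G$ be abelian groups, let $\tau_0 : F\times G\to k^\times$ be a bimultiplicative map, and let $(f_i)_{i\in I}$ in $F$ and $(g_i)_{i\in I}$ in $G$ be families indexed by the same set $I$. Let $V=\bigoplus_{i\in I} k v_i$ be the Yetter–Drinfeld module of diagonal type over $F$ in which $f\in F$ acts on $v_i$ by the scalar $\tau_0(f,g_i)$ and $v_i$ has degree $f_i$. Let $W=\bigoplus_{i\in I} k w_i$ be the Yetter–Drinfeld module of diagonal type over $G$ in which $g\in G$ acts on $w_i$ by the scalar $\tau_0(f_i,g)^{-1}$ and $w_i$ has degree $g_i$. Let $R=T(V)/\mathfrak a$ and $S=T(W)/\mathfrak b$ be pre-Nichols algebras of $V$ and $W$, i.e. $\mathfrak a,\mathfrak b$ are homogeneous braided Hopf ideals with $\mathfrak a\cap V=0$, $\mathfrak b\cap W=0$. Let $B=R\rtimes F$ and $H=S\rtimes G$ be the bosonizations; thus $\Delta(v_i)=v_i\otimes 1+f_i\otimes v_i$ and $\Delta(w_i)=w_i\otimes 1+g_i\otimes w_i$. Let $\tau:B\otimes H\to k$ be the unique skew pairing, that is, a bilinear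 form with $$\tau(bc,h)=\tau(b,h_1)\tau(c,h_2),\quad \tau(b,hl)=\tau(b_1,l)\tau(b_2,h),\quad \tau(b,1)=\varepsilon(b),\quad \tau(1,h)=\varepsilon(h),$$ which extends $\tau_0$ and satisfies $\tau(v_i,w_j)=\delta_{ij}$, $\tau(f,w_j)=0=\tau(v_i,g)$ for all $i,j\in I$, $f\in F$, $g\in G$. Let $\mathcal D$ be the Hopf algebra obtained from $B\otimes H$ by deforming the product with the 2-cocycle $\sigma(b\otimes h,c\otimes l)=\varepsilon(b)\,\tau(c,h)\,\varepsilon(l)$; so $x\cdot y=\sigma(x_1,y_1)\,x_2y_2\,\sigma^{-1}(x_3,y_3)$. Regard $F\times G$ as a group of grouplike elements of $\mathcal D$ through $(f,g)\mapsto f\otimes g$, and write $fg$ for $(f,g)$. Put $$C=\{fg\in F\times G \mid \tau_0(f,g_i)\,\tau_0(f_i,g)=1 \text{ for all } i\in I\},\qquad P=\langle f_ig_i\mid i\in I\rangle\subseteq F\times G,$$ and let $\mathcal D_c=\mathcal D/(c-1\mid c\in C)$ be the quotient of $\mathcal D$ by the two-sided ideal generated by all $c-1$ with $c\in C$. **Theorem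 4.2 (Krop).** Assume that $F$ or $G$ is finite, and that $\tau_0$ is non-degenerate, i.e. $\tau_0(f,G)=\{1\}$ implies $f=1$, and $\tau_0(F,g)=\{1\}$ implies $g=1$. Then $F$ and $G$ are both finite, $|F|=|G|$, and the following hold. (1) $|C|\,|P|=|F|\,|G|$, and the following seven conditions are equivalent: * (a) the natural group map $C\to (F\times G)/P$ is a split monomorphism; * (a$'$) the map $C\to (F\times G)/P$ is a monomorphism / an epimorphism / an isomorphism (three conditions); * (a$''$) the product map $C\times P\to F\times G$ is a monomorphism / an epimorphism / an isomorphism (three conditions). (2) Assume moreover that for each $i\in I$ we have $f_i\neq 1$ or $g_i\neq 1$. Then the seven conditions in (1) and the following two are all equivalent to each other: * (b) the inclusion $kC\hookrightarrow\mathcal D$ splits as a Hopf algebra map, i.e. there is a Hopf algebra map $\pi:\mathcal D\to kC$ which restricts to the identity on $kC$; * (c) there is an isomorphism of $k$-algebras $\mathcal D\simeq kC\otimes\mathcal D_c$. -/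

import Mathlib

open scoped TensorProduct

noncomputable section

/-- A Yetter-Drinfeld module of diagonal type over the abelian group `F`: the direct sum over
`i : I` of the one-dimensional objects `(k v_i; char i, deg i)`, that is, `h ∈ F` acts on `v_i` by
the scalar `char i h`, and the coaction is `v_i ↦ deg i ⊗ v_i`. -/
structure DiagYD (k F I : Type*) [Field k] [CommGroup F] where
  char : I → F →* kˣ
  deg : I → F

namespace DiagYD

variable {k F I : Type*} [Field k] [CommGroup F] (V : DiagYD k F I)

/-- The action of `h ∈ F` on the tensor algebra `T(V)`, which is the free algebra on the `v_i`. -/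
def act (h : F) : FreeAlgebra k I →ₐ[k] FreeAlgebra k I :=
  FreeAlgebra.lift k fun i => (V.char i h : k) • FreeAlgebra.ι k i

/-- The coaction `T(V) → kF ⊗ T(V)`. -/
def coact : FreeAlgebra k I →ₐ[k] MonoidAlgebra k F ⊗[k] FreeAlgebra k I :=
  FreeAlgebra.lift k fun i => MonoidAlgebra.of k F (V.deg i) ⊗ₜ[k] FreeAlgebra.ι k i

/-- Left multiplication by `v_i ⊗ 1 + 1 ⊗ v_i` in the braided tensor product algebra
`T(V) ⊗ T(V)`, whose product is `(a ⊗ b)(c ⊗ d) = a (b_{-1} ⇀ c) ⊗ b_0 d`. -/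
def comulOp (i : I) :
    FreeAlgebra k I ⊗[k] FreeAlgebra k I →ₗ[k] FreeAlgebra k I ⊗[k] FreeAlgebra k I :=
  TensorProduct.map (LinearMap.mulLeft k (FreeAlgebra.ι k i)) LinearMap.id +
    TensorProduct.map (V.act (V.deg i)).toLinearMap (LinearMap.mulLeft k (FreeAlgebra.ι k i))

/-- The braided coproduct of `T(V)`: the algebra map into the braided tensor product
`T(V) ⊗ T(V)` with `v_i ↦ v_i ⊗ 1 + 1 ⊗ v_i`. -/
def comul : FreeAlgebra k I →ₗ[k] FreeAlgebra k I ⊗[k] FreeAlgebra k I :=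
  (LinearMap.applyₗ (1 ⊗ₜ[k] 1)).comp
    (FreeAlgebra.lift k (A := Module.End k (FreeAlgebra k I ⊗[k] FreeAlgebra k I))
      V.comulOp).toLinearMap

/-- The operator `x ↦ - (deg i ⇀ x) v_i` on `T(V)`. -/
def antipodeOp (i : I) : FreeAlgebra k I →ₗ[k] FreeAlgebra k I :=
  - (LinearMap.mulRight k (FreeAlgebra.ι k i)).comp (V.act (V.deg i)).toLinearMap

/-- The braided antipode of `T(V)`, determined by `S 1 = 1` and by
`S (v_i x) = (deg i ⇀ S x) S v_i = - (deg i ⇀ S x) v_i`. -/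
def antipode : FreeAlgebra k I →ₗ[k] FreeAlgebra k I :=
  (LinearMap.applyₗ 1).comp
    (FreeAlgebra.lift k (A := Module.End k (FreeAlgebra k I)) V.antipodeOp).toLinearMap

end DiagYD

/-- The algebra map `T(V) → T(V)[X]`, `v_i ↦ v_i X`; the coefficient of `X ^ n` in the image of
`x` is the homogeneous component of degree `n` of `x`. -/
def FreeAlgebra.grade (k I : Type*) [Field k] :
    FreeAlgebra k I →ₐ[k] Polynomial (FreeAlgebra k I) :=
  FreeAlgebra.lift k fun i => Polynomial.C (FreeAlgebra.ι k i) * Polynomial.X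

/-- A pre-Nichols algebra `T(V)/a` of `V`, given by its ideal of relations `a`: a homogeneous
braided Hopf ideal of `T(V)` such that `a ∩ V = 0`. -/
structure PreNichols {k F I : Type*} [Field k] [CommGroup F] (V : DiagYD k F I) where
  ideal : Ideal (FreeAlgebra k I)
  isTwoSided : ideal.IsTwoSided
  homogeneous : ∀ x ∈ ideal, ∀ n, (FreeAlgebra.grade k I x).coeff n ∈ ideal
  /-- `a` is a submodule and a subcomodule. -/
  act_mem : ∀ h, ∀ x ∈ ideal, V.act h x ∈ ideal
  coact_mem : ∀ x ∈ ideal, V.coact x ∈ LinearMap.range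
    (TensorProduct.map (LinearMap.id (R := k) (M := MonoidAlgebra k F))
      (ideal.restrictScalars k).subtype)
  /-- `a` is a coideal, `Δ(a) ⊆ a ⊗ T(V) + T(V) ⊗ a` and `ε(a) = 0`, stable under the antipode. -/
  comul_mem : ∀ x ∈ ideal, V.comul x ∈
    LinearMap.range (TensorProduct.map (ideal.restrictScalars k).subtype
      (LinearMap.id (R := k) (M := FreeAlgebra k I))) ⊔
    LinearMap.range (TensorProduct.map (LinearMap.id (R := k) (M := FreeAlgebra k I))
      (ideal.restrictScalars k).subtype)
  counit_eq_zero : ∀ x ∈ ideal, FreeAlgebra.algebraMapInv x = (0 : k)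
  antipode_mem : ∀ x ∈ ideal, V.antipode x ∈ ideal
  eq_zero_of_mem_span : ∀ x ∈ ideal,
    x ∈ Submodule.span k (Set.range (FreeAlgebra.ι k (X := I))) → x = 0

namespace DiagYD

variable {k F I : Type*} [Field k] [CommGroup F] (V : DiagYD k F I)

theorem linear_ext_left {M : Type*} [AddCommGroup M] [Module k M]
    {f g : FreeAlgebra k I →ₗ[k] M} (L : I → M →ₗ[k] M) (h1 : f 1 = g 1)
    (hf : ∀ i x, f (FreeAlgebra.ι k i * x) = L i (f x))
    (hg : ∀ i x, g (FreeAlgebra.ι k i * x) = L i (g x)) : f = g := by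
  have key : ∀ y x, f x = g x → f (y * x) = g (y * x) := by
    intro y
    induction y with
    | grade0 r => intro x hx; simp [← Algebra.smul_def, hx]
    | grade1 i => intro x hx; rw [hf, hg, hx]
    | mul a b ha hb => intro x hx; rw [mul_assoc]; exact ha _ (hb _ hx)
    | add a b ha hb => intro x hx; rw [add_mul, map_add, map_add, ha _ hx, hb _ hx]
  ext x
  simpa using key x 1 h1

@[simp] theorem act_ι (h : F) (i : I) :
    V.act h (FreeAlgebra.ι k i) = (V.char i h : k) • FreeAlgebra.ι k i := by simp [act]

theorem act_one : V.act 1 = AlgHom.id k _ := by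
  ext i; simp

theorem act_mul (g h : F) (x : FreeAlgebra k I) : V.act (g * h) x = V.act g (V.act h x) := by
  have : V.act (g * h) = (V.act g).comp (V.act h) := by
    ext i; simp [smul_smul, mul_comm]
  rw [this]; rfl

@[simp] theorem comul_one : V.comul 1 = 1 ⊗ₜ 1 := by simp [comul]

theorem comul_ι_mul (i : I) (x : FreeAlgebra k I) :
    V.comul (FreeAlgebra.ι k i * x) = V.comulOp i (V.comul x) := by simp [comul]

@[simp] theorem antipode_one : V.antipode 1 = 1 := by simp [antipode]

theorem antipode_ι_mul (i : I) (x : FreeAlgebra k I) :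
    V.antipode (FreeAlgebra.ι k i * x) = - (V.act (V.deg i) (V.antipode x) * FreeAlgebra.ι k i) := by
  simp [antipode, antipodeOp]

end DiagYD

namespace PreNichols

variable {k F I : Type*} [Field k] [CommGroup F] {V : DiagYD k F I} (N : PreNichols V)

instance : N.ideal.IsTwoSided := N.isTwoSided

/-- The pre-Nichols algebra `R = T(V)/a`. -/
def Alg : Type _ := FreeAlgebra k I ⧸ N.ideal

instance : Ring N.Alg := inferInstanceAs (Ring (FreeAlgebra k I ⧸ N.ideal))
instance : Algebra k N.Alg := inferInstanceAs (Algebra k (FreeAlgebra k I ⧸ N.ideal))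

/-- The projection `T(V) → R`. -/
def proj : FreeAlgebra k I →ₐ[k] N.Alg := Ideal.Quotient.mkₐ k N.ideal

theorem proj_surjective : Function.Surjective N.proj := Ideal.Quotient.mk_surjective

theorem proj_eq_zero {x : FreeAlgebra k I} : N.proj x = 0 ↔ x ∈ N.ideal :=
  Ideal.Quotient.eq_zero_iff_mem

/-- The action of `h ∈ F` on `R`. -/
def actHom (h : F) : N.Alg →ₐ[k] N.Alg :=
  Ideal.Quotient.liftₐ N.ideal (N.proj.comp (V.act h))
    fun x hx => N.proj_eq_zero.2 (N.act_mem h x hx)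

@[simp] theorem actHom_proj (h : F) (x : FreeAlgebra k I) : N.actHom h (N.proj x) = N.proj (V.act h x) :=
  rfl

instance : MulSemiringAction F N.Alg where
  smul h x := N.actHom h x
  one_smul x := by
    obtain ⟨x, rfl⟩ := N.proj_surjective x
    change N.actHom 1 (N.proj x) = _
    rw [actHom_proj, V.act_one]; rfl
  mul_smul g h x := by
    obtain ⟨x, rfl⟩ := N.proj_surjective x
    change N.actHom (g * h) (N.proj x) = N.actHom g (N.actHom h (N.proj x))
    simp [V.act_mul]
  smul_zero h := map_zero (N.actHom h)
  smul_add h := map_add (N.actHom h)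
  smul_one h := map_one (N.actHom h)
  smul_mul h := map_mul (N.actHom h)

theorem smul_proj (h : F) (x : FreeAlgebra k I) : h • N.proj x = N.proj (V.act h x) := rfl

instance : SMulCommClass F k N.Alg where
  smul_comm h c x := map_smul (N.actHom h) c x

/-- The underlying algebra of the bosonization `R ⋊ F`: the smash product of `R` and `kF`, that is,
the free left `R`-module on `F`, with product `(r h)(r' h') = r (h ⇀ r') h h'`. -/
def Boson : Type _ := SkewMonoidAlgebra N.Alg F

instance : Ring N.Boson := inferInstanceAs (Ring (SkewMonoidAlgebra N.Alg F))
instance : Algebra k N.Boson := inferInstanceAs (Algebra k (SkewMonoidAlgebra N.Alg F))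

/-- The inclusion of `R` in the bosonization. -/
def inclAlg : N.Alg →ₐ[k] N.Boson where
  toFun r := SkewMonoidAlgebra.single 1 r
  map_one' := rfl
  map_mul' r s := by
    refine Eq.trans ?_ (SkewMonoidAlgebra.single_mul_single (k := N.Alg) (G := F)).symm
    simp
    rfl
  map_zero' := SkewMonoidAlgebra.single_zero _
  map_add' := SkewMonoidAlgebra.single_add _
  commutes' _ := rfl

/-- The inclusion of `F` in the bosonization. -/
def grp : F →* N.Boson where
  toFun h := SkewMonoidAlgebra.single h 1
  map_one' := rfl
  map_mul' g h := by
    refine Eq.trans ?_ (SkewMonoidAlgebra.single_mul_single (k := N.Alg) (G := F)).symm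
    simp
    rfl

/-- The generator `v_i` of the bosonization. -/
def gen (i : I) : N.Boson := N.inclAlg (N.proj (FreeAlgebra.ι k i))

theorem single_eq (h : F) (r : N.Alg) :
    (SkewMonoidAlgebra.single h r : SkewMonoidAlgebra N.Alg F) = (N.inclAlg r * N.grp h : N.Boson) := by
  refine Eq.trans ?_ (SkewMonoidAlgebra.single_mul_single (k := N.Alg) (G := F)).symm
  simp

theorem grp_mul_inclAlg (h : F) (r : N.Alg) : N.grp h * N.inclAlg r = N.inclAlg (h • r) * N.grp h := by
  rw [← single_eq]
  refine (SkewMonoidAlgebra.single_mul_single (k := N.Alg) (G := F)).trans ?_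
  simp

theorem grp_mul_gen (h : F) (i : I) :
    N.grp h * N.gen i = (V.char i h : k) • (N.gen i * N.grp h) := by
  simp [gen, grp_mul_inclAlg, smul_proj]

/-- Algebra maps out of the bosonization. -/
def lift {A : Type*} [Ring A] [Algebra k A] (φ : FreeAlgebra k I →ₐ[k] A) (ψ : F →* A)
    (hφ : ∀ x ∈ N.ideal, φ x = 0)
    (hψ : ∀ h i, ψ h * φ (FreeAlgebra.ι k i) =
      (V.char i h : k) • (φ (FreeAlgebra.ι k i) * ψ h)) : N.Boson →ₐ[k] A :=
  SkewMonoidAlgebra.liftNCAlgHom (Ideal.Quotient.liftₐ N.ideal φ hφ) ψ (by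
    intro r h
    obtain ⟨x, rfl⟩ := N.proj_surjective r
    change φ (V.act h x) * ψ h = ψ h * φ x
    induction x with
    | grade0 r => simp [Algebra.commutes]
    | grade1 i => simp [hψ]
    | mul a b ha hb => rw [map_mul, map_mul, mul_assoc, hb, ← mul_assoc, ha, map_mul, mul_assoc]
    | add a b ha hb => simp [add_mul, mul_add, ha, hb])

section lift

variable {A : Type*} [Ring A] [Algebra k A] (φ : FreeAlgebra k I →ₐ[k] A) (ψ : F →* A)
    (hφ : ∀ x ∈ N.ideal, φ x = 0)
    (hψ : ∀ h i, ψ h * φ (FreeAlgebra.ι k i) =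
      (V.char i h : k) • (φ (FreeAlgebra.ι k i) * ψ h))

@[simp] theorem lift_inclAlg (x : FreeAlgebra k I) :
    N.lift φ ψ hφ hψ (N.inclAlg (N.proj x)) = φ x :=
  (SkewMonoidAlgebra.liftNC_single _ _ _ _).trans (by simp; rfl)

@[simp] theorem lift_gen (i : I) : N.lift φ ψ hφ hψ (N.gen i) = φ (FreeAlgebra.ι k i) :=
  N.lift_inclAlg φ ψ hφ hψ _

@[simp] theorem lift_grp (h : F) : N.lift φ ψ hφ hψ (N.grp h) = ψ h :=
  (SkewMonoidAlgebra.liftNC_single _ _ _ _).trans (by simp)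

end lift

theorem adjoin_eq_top : Algebra.adjoin k (Set.range N.gen ∪ Set.range N.grp) = ⊤ := by
  rw [eq_top_iff]
  intro b _
  have hR : ∀ x, N.inclAlg (N.proj x) ∈ Algebra.adjoin k (Set.range N.gen ∪ Set.range N.grp) := by
    intro x
    induction x with
    | grade0 r => simp
    | grade1 i => exact Algebra.subset_adjoin (Or.inl ⟨i, rfl⟩)
    | mul a b ha hb => simpa using mul_mem ha hb
    | add a b ha hb => simpa using add_mem ha hb
  refine SkewMonoidAlgebra.induction_on
    (p := fun b : N.Boson => b ∈ Algebra.adjoin k (Set.range N.gen ∪ Set.range N.grp)) b (zero_mem _) ?_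
    fun f g hf hg => add_mem hf hg
  intro h r
  obtain ⟨x, rfl⟩ := N.proj_surjective r
  rw [single_eq]
  exact mul_mem (hR x) (Algebra.subset_adjoin (Or.inr ⟨h, rfl⟩))

/-- An induction principle. -/
theorem subalgebra_eq_top {S : Subalgebra k N.Boson} (h1 : ∀ i, N.gen i ∈ S)
    (h2 : ∀ h, N.grp h ∈ S) (b : N.Boson) : b ∈ S := by
  have : Algebra.adjoin k (Set.range N.gen ∪ Set.range N.grp) ≤ S := by
    rw [Algebra.adjoin_le_iff]
    rintro _ (⟨i, rfl⟩ | ⟨h, rfl⟩)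
    exacts [h1 i, h2 h]
  exact this (N.adjoin_eq_top ▸ Algebra.mem_top)

theorem algHom_ext {A : Type*} [Ring A] [Algebra k A] {φ ψ : N.Boson →ₐ[k] A}
    (h1 : ∀ i, φ (N.gen i) = ψ (N.gen i)) (h2 : ∀ h, φ (N.grp h) = ψ (N.grp h)) : φ = ψ :=
  AlgHom.ext fun b => N.subalgebra_eq_top (S := AlgHom.equalizer φ ψ) h1 h2 b

/-- The counit of the bosonization, with `v_i ↦ 0` and `h ↦ 1` for `h ∈ F`. -/
def counitHom : N.Boson →ₐ[k] k :=
  N.lift FreeAlgebra.algebraMapInv 1 N.counit_eq_zero (by simp [FreeAlgebra.algebraMapInv])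

/-- The coproduct of the bosonization on the elements of `T(V)`. -/
def comulFree : FreeAlgebra k I →ₐ[k] N.Boson ⊗[k] N.Boson :=
  FreeAlgebra.lift k fun i => N.gen i ⊗ₜ 1 + N.grp (V.deg i) ⊗ₜ N.gen i

/-- The map `x ↦ x_{-1} ⊗ x_0` on `T(V)`, with values in the tensor square of the bosonization. -/
def coactBoson : FreeAlgebra k I →ₐ[k] N.Boson ⊗[k] N.Boson :=
  (Algebra.TensorProduct.map (MonoidAlgebra.lift k N.Boson F N.grp)
    (N.inclAlg.comp N.proj)).comp V.coact

theorem coactBoson_eq_zero (x : FreeAlgebra k I) (hx : x ∈ N.ideal) : N.coactBoson x = 0 := by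
  obtain ⟨y, hy⟩ := N.coact_mem x hx
  have : (Algebra.TensorProduct.map (MonoidAlgebra.lift k N.Boson F N.grp)
      (N.inclAlg.comp N.proj)).toLinearMap ∘ₗ
      TensorProduct.map LinearMap.id (N.ideal.restrictScalars k).subtype = 0 := by
    refine TensorProduct.ext' fun a b => ?_
    have : N.proj b = 0 := N.proj_eq_zero.2 b.2
    simp [this]
  rw [coactBoson, AlgHom.comp_apply, ← hy]
  exact DFunLike.congr_fun this y

/-- The map `a ⊗ b ↦ a b_{-1} ⊗ b_0`. -/
def bosonTensor : FreeAlgebra k I ⊗[k] FreeAlgebra k I →ₗ[k] N.Boson ⊗[k] N.Boson :=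
  LinearMap.mul' k (N.Boson ⊗[k] N.Boson) ∘ₗ TensorProduct.map
    (Algebra.TensorProduct.includeLeft.comp (N.inclAlg.comp N.proj)).toLinearMap
    N.coactBoson.toLinearMap

theorem comulFree_eq (x : FreeAlgebra k I) : N.comulFree x = N.bosonTensor (V.comul x) := by
  suffices h : N.comulFree.toLinearMap = N.bosonTensor ∘ₗ V.comul from DFunLike.congr_fun h x
  refine DiagYD.linear_ext_left (fun i => LinearMap.mulLeft k
    (N.gen i ⊗ₜ 1 + N.grp (V.deg i) ⊗ₜ N.gen i)) ?_ ?_ ?_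
  · simp [bosonTensor, Algebra.TensorProduct.one_def]
  · intro i x
    simp [comulFree]
  · intro i x
    simp only [LinearMap.comp_apply, V.comul_ι_mul]
    generalize V.comul x = y
    induction y with
    | zero => simp
    | add a b ha hb => simp only [map_add, ha, hb]
    | tmul a b =>
      have h1 : N.coactBoson (FreeAlgebra.ι k i) = N.grp (V.deg i) ⊗ₜ N.gen i := by
        simp [coactBoson, DiagYD.coact, gen]
      have h2 : N.inclAlg (N.proj (V.act (V.deg i) a)) * N.grp (V.deg i) =
          N.grp (V.deg i) * N.inclAlg (N.proj a) := by
        rw [grp_mul_inclAlg, smul_proj]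
      simp only [DiagYD.comulOp, bosonTensor, LinearMap.comp_apply, LinearMap.add_apply, map_add,
        TensorProduct.map_tmul, LinearMap.mulLeft_apply, LinearMap.mul'_apply, add_mul,
        AlgHom.toLinearMap_apply, AlgHom.comp_apply, Algebra.TensorProduct.includeLeft_apply,
        map_mul, LinearMap.id_apply, h1, gen, ← mul_assoc, Algebra.TensorProduct.tmul_mul_tmul,
        one_mul, h2, mul_one]

theorem comulFree_eq_zero (x : FreeAlgebra k I) (hx : x ∈ N.ideal) : N.comulFree x = 0 := by
  rw [comulFree_eq]
  obtain ⟨_, ⟨y, rfl⟩, _, ⟨z, rfl⟩, h⟩ := Submodule.mem_sup.1 (N.comul_mem x hx)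
  have h1 : N.bosonTensor ∘ₗ
      TensorProduct.map (N.ideal.restrictScalars k).subtype LinearMap.id = 0 := by
    refine TensorProduct.ext' fun a b => ?_
    have : N.proj a = 0 := N.proj_eq_zero.2 a.2
    simp [bosonTensor, this]
  have h2 : N.bosonTensor ∘ₗ
      TensorProduct.map LinearMap.id (N.ideal.restrictScalars k).subtype = 0 := by
    refine TensorProduct.ext' fun a b => ?_
    simp [bosonTensor, N.coactBoson_eq_zero b b.2]
  rw [← h, map_add]
  have e1 := DFunLike.congr_fun h1 y
  have e2 := DFunLike.congr_fun h2 z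
  simp only [LinearMap.comp_apply, LinearMap.zero_apply] at e1 e2
  rw [e1, e2, add_zero]

/-- The map `h ↦ h ⊗ h`. -/
def grpSq : F →* N.Boson ⊗[k] N.Boson where
  toFun h := N.grp h ⊗ₜ N.grp h
  map_one' := by simp [Algebra.TensorProduct.one_def]
  map_mul' g h := by simp

theorem grpSq_apply (h : F) : N.grpSq h = N.grp h ⊗ₜ N.grp h := rfl

/-- The coproduct of the bosonization, with `Δ(v_i) = v_i ⊗ 1 + deg i ⊗ v_i` and
`Δ(h) = h ⊗ h` for `h ∈ F`. -/
def comulHom : N.Boson →ₐ[k] N.Boson ⊗[k] N.Boson :=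
  N.lift N.comulFree N.grpSq N.comulFree_eq_zero (by
    intro h i
    simp [comulFree, grpSq_apply, mul_add, add_mul, grp_mul_gen, ← map_mul, mul_comm h,
      TensorProduct.smul_tmul'])

@[simp] theorem comulHom_gen (i : I) :
    N.comulHom (N.gen i) = N.gen i ⊗ₜ 1 + N.grp (V.deg i) ⊗ₜ N.gen i := by
  simp [comulHom, comulFree]

@[simp] theorem comulHom_grp (h : F) : N.comulHom (N.grp h) = N.grp h ⊗ₜ N.grp h :=
  N.lift_grp _ _ _ _ h

@[simp] theorem counitHom_gen (i : I) : N.counitHom (N.gen i) = 0 := by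
  simp [counitHom, FreeAlgebra.algebraMapInv]

@[simp] theorem counitHom_grp (h : F) : N.counitHom (N.grp h) = 1 := by
  simp [counitHom]

instance : Bialgebra k N.Boson :=
  Bialgebra.ofAlgHom N.comulHom N.counitHom
    (N.algHom_ext (fun i => by
      simp [TensorProduct.add_tmul, TensorProduct.tmul_add, Algebra.TensorProduct.one_def,
        add_assoc]) (fun h => by simp))
    (N.algHom_ext (fun i => by simp) (fun h => by simp))
    (N.algHom_ext (fun i => by simp) (fun h => by simp))

@[simp] theorem comul_gen (i : I) : Coalgebra.comul (R := k) (N.gen i) =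
    N.gen i ⊗ₜ[k] 1 + N.grp (V.deg i) ⊗ₜ[k] N.gen i := N.comulHom_gen i

@[simp] theorem comul_grp (h : F) : Coalgebra.comul (R := k) (N.grp h) =
    N.grp h ⊗ₜ[k] N.grp h := N.comulHom_grp h

@[simp] theorem counit_gen (i : I) : Coalgebra.counit (R := k) (N.gen i) = 0 := N.counitHom_gen i

@[simp] theorem counit_grp (h : F) : Coalgebra.counit (R := k) (N.grp h) = 1 := N.counitHom_grp h

/-- The antipode of the bosonization on the elements of `T(V)`. -/
def antipodeFree : FreeAlgebra k I →ₐ[k] N.Bosonᵐᵒᵖ :=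
  FreeAlgebra.lift k fun i => MulOpposite.op (- (N.grp (V.deg i)⁻¹ * N.gen i))

theorem antipodeFree_eq_zero (x : FreeAlgebra k I) (hx : x ∈ N.ideal) : N.antipodeFree x = 0 := by
  let θ : MonoidAlgebra k F ⊗[k] FreeAlgebra k I →ₗ[k] N.Boson :=
    LinearMap.mul' k N.Boson ∘ₗ TensorProduct.map
      (MonoidAlgebra.lift k N.Boson F (N.grp.comp invMonoidHom)).toLinearMap
      ((N.inclAlg.comp N.proj).toLinearMap ∘ₗ V.antipode)
  have key : (MulOpposite.opLinearEquiv k).symm.toLinearMap ∘ₗ N.antipodeFree.toLinearMap =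
      θ ∘ₗ V.coact.toLinearMap := by
    refine DiagYD.linear_ext_left (fun i => LinearMap.mulRight k
      (- (N.grp (V.deg i)⁻¹ * N.gen i))) ?_ ?_ ?_
    · simp [θ, Algebra.TensorProduct.one_def]
    · intro i x
      simp [antipodeFree]
    · intro i x
      simp only [LinearMap.comp_apply, AlgHom.toLinearMap_apply, map_mul]
      generalize V.coact x = y
      induction y with
      | zero => simp
      | add a b ha hb => simp only [mul_add, map_add, ha, hb]
      | tmul a b =>
        have h1 : V.coact (FreeAlgebra.ι k i) =
          MonoidAlgebra.of k F (V.deg i) ⊗ₜ[k] FreeAlgebra.ι k i := by simp [DiagYD.coact]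
        have h2 : N.inclAlg (N.proj (V.antipode b)) * N.grp (V.deg i)⁻¹ =
            N.grp (V.deg i)⁻¹ * N.inclAlg (N.proj (V.act (V.deg i) (V.antipode b))) := by
          rw [grp_mul_inclAlg, smul_proj, ← V.act_mul, inv_mul_cancel, V.act_one]; rfl
        have h3 : ∀ z, N.grp (V.deg i)⁻¹ *
            MonoidAlgebra.lift k N.Boson F (N.grp.comp invMonoidHom) z =
            MonoidAlgebra.lift k N.Boson F (N.grp.comp invMonoidHom) z * N.grp (V.deg i)⁻¹ := by
          intro z
          induction z using MonoidAlgebra.induction_linear with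
          | zero => simp
          | add f g hf hg => simp [mul_add, add_mul, hf, hg]
          | single h r => simp [← map_mul, mul_comm]
        simp [θ, h1, V.antipode_ι_mul, gen, mul_assoc, h3]
        rw [← mul_assoc (N.inclAlg _), h2]
        simp [mul_assoc]
  obtain ⟨y, hy⟩ := N.coact_mem x hx
  have h0 : θ ∘ₗ TensorProduct.map LinearMap.id (N.ideal.restrictScalars k).subtype = 0 := by
    refine TensorProduct.ext' fun a b => ?_
    have : N.proj (V.antipode b) = 0 := N.proj_eq_zero.2 (N.antipode_mem _ b.2)
    simp [θ, this]
  have h1 := DFunLike.congr_fun key x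
  have h2 := DFunLike.congr_fun h0 y
  simp only [LinearMap.comp_apply, AlgHom.toLinearMap_apply, ← hy, LinearMap.zero_apply] at h1 h2
  rw [h2] at h1
  exact MulOpposite.unop_injective h1

/-- The antipode of the bosonization, with `S(v_i) = - (deg i)⁻¹ v_i` and `S(h) = h⁻¹` for
`h ∈ F`. -/
def antipodeHom : N.Boson →ₐ[k] N.Bosonᵐᵒᵖ :=
  N.lift N.antipodeFree
    { toFun h := MulOpposite.op (N.grp h⁻¹)
      map_one' := by simp
      map_mul' g h := by simp [← MulOpposite.op_mul, ← map_mul, mul_comm] }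
    N.antipodeFree_eq_zero (by
      intro h i
      simp only [antipodeFree, FreeAlgebra.lift_ι_apply, MonoidHom.coe_mk, OneHom.coe_mk,
        ← MulOpposite.op_mul, ← MulOpposite.op_smul]
      congr 1
      simp only [neg_mul, mul_neg, mul_assoc, smul_neg]
      rw [← mul_assoc (N.grp h⁻¹), ← map_mul, mul_comm h⁻¹, map_mul, mul_assoc, grp_mul_gen]
      simp [smul_smul])

@[simp] theorem antipodeHom_gen (i : I) :
    N.antipodeHom (N.gen i) = MulOpposite.op (- (N.grp (V.deg i)⁻¹ * N.gen i)) := by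
  simp [antipodeHom, antipodeFree]

@[simp] theorem antipodeHom_grp (h : F) :
    N.antipodeHom (N.grp h) = MulOpposite.op (N.grp h⁻¹) := by
  simp [antipodeHom]

/-- The antipode as a linear map. -/
def antipodeLin : N.Boson →ₗ[k] N.Boson :=
  (MulOpposite.opLinearEquiv k).symm.toLinearMap ∘ₗ N.antipodeHom.toLinearMap

theorem antipodeLin_mul (x y : N.Boson) :
    N.antipodeLin (x * y) = N.antipodeLin y * N.antipodeLin x := by
  simp [antipodeLin]

@[simp] theorem antipodeLin_gen (i : I) :
    N.antipodeLin (N.gen i) = - (N.grp (V.deg i)⁻¹ * N.gen i) := by simp [antipodeLin]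

@[simp] theorem antipodeLin_grp (h : F) : N.antipodeLin (N.grp h) = N.grp h⁻¹ := by
  simp [antipodeLin]

@[simp] theorem antipodeLin_one : N.antipodeLin 1 = 1 := by simp [antipodeLin]

instance : HopfAlgebra k N.Boson where
  antipode := N.antipodeLin
  mul_antipode_rTensor_comul := by
    ext b
    refine N.subalgebra_eq_top (S :=
      { carrier := {b | (LinearMap.mul' k N.Boson ∘ₗ N.antipodeLin.rTensor N.Boson ∘ₗ
          Coalgebra.comul) b = (Algebra.linearMap k N.Boson ∘ₗ Coalgebra.counit) b}
        mul_mem' := ?_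
        add_mem' := fun {a b} ha hb => by
          simp only [Set.mem_ofPred_eq] at ha hb ⊢
          rw [map_add, map_add, ha, hb]
        algebraMap_mem' := fun r => by
          simp [Algebra.TensorProduct.one_def, Algebra.algebraMap_eq_smul_one] }) ?_ ?_ b
    · intro x y hx hy
      simp only [Set.mem_ofPred_eq, LinearMap.comp_apply] at hx hy ⊢
      rw [← (Coalgebra.Repr.arbitrary k x).eq] at hx
      rw [← (Coalgebra.Repr.arbitrary k y).eq] at hy
      rw [Bialgebra.comul_mul, ← (Coalgebra.Repr.arbitrary k x).eq,
        ← (Coalgebra.Repr.arbitrary k y).eq]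
      simp only [map_sum, LinearMap.rTensor_tmul, LinearMap.mul'_apply, Finset.sum_mul_sum,
        Algebra.TensorProduct.tmul_mul_tmul, antipodeLin_mul, Algebra.linearMap_apply] at hx hy ⊢
      rw [Finset.sum_comm]
      simp only [mul_assoc, ← Finset.mul_sum]
      simp only [← mul_assoc (N.antipodeLin ((Coalgebra.Repr.arbitrary k x).left _)),
        ← Finset.sum_mul, hx]
      simp only [← mul_assoc, ← Algebra.commutes (Coalgebra.counit (R := k) x)]
      simp only [mul_assoc, ← Finset.mul_sum, hy]
      simp
    · intro i
      change _ = _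
      simp [LinearMap.comp_apply]
    · intro h
      change _ = _
      simp [← map_mul]
  mul_antipode_lTensor_comul := by
    ext b
    refine N.subalgebra_eq_top (S :=
      { carrier := {b | (LinearMap.mul' k N.Boson ∘ₗ N.antipodeLin.lTensor N.Boson ∘ₗ
          Coalgebra.comul) b = (Algebra.linearMap k N.Boson ∘ₗ Coalgebra.counit) b}
        mul_mem' := ?_
        add_mem' := fun {a b} ha hb => by
          simp only [Set.mem_ofPred_eq] at ha hb ⊢
          rw [map_add, map_add, ha, hb]
        algebraMap_mem' := fun r => by
          simp [Algebra.TensorProduct.one_def, Algebra.algebraMap_eq_smul_one] }) ?_ ?_ b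
    · intro x y hx hy
      simp only [Set.mem_ofPred_eq, LinearMap.comp_apply] at hx hy ⊢
      rw [← (Coalgebra.Repr.arbitrary k x).eq] at hx
      rw [← (Coalgebra.Repr.arbitrary k y).eq] at hy
      rw [Bialgebra.comul_mul, ← (Coalgebra.Repr.arbitrary k x).eq,
        ← (Coalgebra.Repr.arbitrary k y).eq]
      simp only [map_sum, LinearMap.lTensor_tmul, LinearMap.mul'_apply, Finset.sum_mul_sum,
        Algebra.TensorProduct.tmul_mul_tmul, antipodeLin_mul, Algebra.linearMap_apply] at hx hy ⊢
      simp only [mul_assoc, ← Finset.mul_sum]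
      simp only [← mul_assoc ((Coalgebra.Repr.arbitrary k y).left _), 
        ← Finset.sum_mul, hy]
      simp only [fun z => Algebra.commutes (Coalgebra.counit (R := k) y) (N.antipodeLin z),
        ← mul_assoc, ← Finset.sum_mul, hx]
      simp
    · intro i
      change _ = _
      simp [LinearMap.comp_apply, ← mul_assoc, ← map_mul]
    · intro h
      change _ = _
      simp [← map_mul]

end PreNichols

/-- A normalized, convolution invertible 2-cocycle `σ : A ⊗ A → k` on a bialgebra `A`. Products of
linear forms are convolution products on the coalgebra `A ⊗ A`, so that the cocycle condition reads
`σ(x₁, y₁) σ(x₂ y₂, z) = σ(y₁, z₁) σ(x, y₂ z₂)`. -/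
structure TwoCocycle (k A : Type*) [Field k] [Ring A] [Bialgebra k A] where
  form : WithConv (A ⊗[k] A →ₗ[k] k)
  inv : WithConv (A ⊗[k] A →ₗ[k] k)
  form_mul_inv : form * inv = 1
  inv_mul_form : inv * form = 1
  cocycle : ∀ x y z : A,
    (form * WithConv.toConv
      (form.ofConv ∘ₗ (TensorProduct.mk k A A).flip z ∘ₗ LinearMap.mul' k A)) (x ⊗ₜ y) =
    (form * WithConv.toConv
      (form.ofConv ∘ₗ TensorProduct.mk k A A x ∘ₗ LinearMap.mul' k A)) (y ⊗ₜ z)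
  form_one_right : ∀ x, form (x ⊗ₜ 1) = Coalgebra.counit (R := k) x
  form_one_left : ∀ x, form (1 ⊗ₜ x) = Coalgebra.counit (R := k) x

namespace TwoCocycle

open Coalgebra WithConv LinearMap

section aux

variable {k C D A A' : Type*} [Field k] [AddCommGroup C] [Module k C] [Coalgebra k C]
  [AddCommGroup D] [Module k D] [Coalgebra k D] [Ring A] [Algebra k A] [Ring A'] [Algebra k A']

/-- A linear form viewed as a linear map with values in the algebra `A`. -/
def scal (A : Type*) [Ring A] [Algebra k A] (f : WithConv (C →ₗ[k] k)) : WithConv (C →ₗ[k] A) :=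
  toConv (Algebra.linearMap k A ∘ₗ f.ofConv)

theorem scal_mul (f g : WithConv (C →ₗ[k] k)) : scal A (f * g) = scal A f * scal A g :=
  WithConv.ext (algHom_comp_convMul_distrib (Algebra.ofId k A) f g)

theorem scal_one : scal A (1 : WithConv (C →ₗ[k] k)) = 1 := by
  ext c; simp [scal]

theorem comp_scal_mul (Y : A →ₗ[k] A') (f : WithConv (C →ₗ[k] k)) (P : WithConv (C →ₗ[k] A)) :
    toConv (Y ∘ₗ (scal A f * P).ofConv) = scal A' f * toConv (Y ∘ₗ P.ofConv) := by
  ext c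
  simp [(ℛ k c).convMul_apply, scal, ← Algebra.smul_def]

theorem comp_mul_scal (Y : A →ₗ[k] A') (f : WithConv (C →ₗ[k] k)) (P : WithConv (C →ₗ[k] A)) :
    toConv (Y ∘ₗ (P * scal A f).ofConv) = toConv (Y ∘ₗ P.ofConv) * scal A' f := by
  ext c
  simp [(ℛ k c).convMul_apply, scal, ← Algebra.commutes, ← Algebra.smul_def]

/-- Composition with a coalgebra map. -/
def pull (u : D →ₗc[k] C) (f : WithConv (C →ₗ[k] A)) : WithConv (D →ₗ[k] A) :=
  toConv (f.ofConv ∘ₗ u.toLinearMap)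

theorem pull_mul (u : D →ₗc[k] C) (f g : WithConv (C →ₗ[k] A)) :
    pull u (f * g) = pull u f * pull u g :=
  WithConv.ext (convMul_comp_coalgHom_distrib f g u)

theorem pull_one (u : D →ₗc[k] C) : pull u (1 : WithConv (C →ₗ[k] A)) = 1 := by
  ext c; simp [pull]

theorem pull_scal (u : D →ₗc[k] C) (f : WithConv (C →ₗ[k] k)) :
    pull u (scal A f) = scal A (pull u f) := rfl

end aux

variable {k A : Type*} [Field k] [Ring A] [Bialgebra k A] (σ : TwoCocycle k A)

/-- The deformed product `x ⊗ y ↦ σ(x₁, y₁) x₂ y₂ σ⁻¹(x₃, y₃)`. -/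
def mul : A ⊗[k] A →ₗ[k] A :=
  (scal A σ.form * toConv (LinearMap.mul' k A) * scal A σ.inv).ofConv

/-- The map `w ⊗ z ↦ w ε(z)`. -/
def dropR (C Z : Type*) [AddCommGroup C] [Module k C] [Coalgebra k C] [AddCommGroup Z] [Module k Z]
    [Coalgebra k Z] : C ⊗[k] Z →ₗc[k] C :=
  (Coalgebra.TensorProduct.rid k k C).toCoalgHom.comp
    (Coalgebra.TensorProduct.map (CoalgHom.id k C) (counitCoalgHom k Z))

/-- The map `z ⊗ w ↦ ε(z) w`. -/
def dropL (C Z : Type*) [AddCommGroup C] [Module k C] [Coalgebra k C] [AddCommGroup Z] [Module k Z]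
    [Coalgebra k Z] : Z ⊗[k] C →ₗc[k] C :=
  (Coalgebra.TensorProduct.lid k C).toCoalgHom.comp
    (Coalgebra.TensorProduct.map (counitCoalgHom k Z) (CoalgHom.id k C))


section aux

variable {C : Type*} [AddCommGroup C] [Module k C] [Coalgebra k C]

theorem comp_rTensor (Y : A ⊗[k] A →ₗ[k] A) (f g : WithConv (C →ₗ[k] k))
    (p : WithConv (C →ₗ[k] A)) :
    toConv (Y ∘ₗ (scal A f * p * scal A g).ofConv.rTensor A) =
      scal A (pull (dropR C A) f) * toConv (Y ∘ₗ p.ofConv.rTensor A) *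
        scal A (pull (dropR C A) g) := by
  have h : ∀ e : WithConv (C →ₗ[k] k), toConv (TensorProduct.map (scal A e).ofConv
      (1 : WithConv (A →ₗ[k] A)).ofConv) = scal (A ⊗[k] A) (pull (dropR C A) e) := by
    intro e
    ext c z
    simp [scal, pull, dropR, Algebra.algebraMap_eq_smul_one, TensorProduct.smul_tmul',
      TensorProduct.tmul_smul, Algebra.TensorProduct.one_def, smul_smul]
  have h2 : toConv ((scal A f * p * scal A g).ofConv.rTensor A) =
      scal (A ⊗[k] A) (pull (dropR C A) f) * toConv (p.ofConv.rTensor A) *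
        scal (A ⊗[k] A) (pull (dropR C A) g) := by
    rw [← h, ← h, rTensor, rTensor]
    have e1 := TensorProduct.map_convMul_map (f := scal A f) (g := (1 : WithConv (A →ₗ[k] A)))
      (h := p) (k := toConv LinearMap.id)
    have e2 := TensorProduct.map_convMul_map (f := scal A f * p) (g := toConv LinearMap.id)
      (h := scal A g) (k := (1 : WithConv (A →ₗ[k] A)))
    rw [one_mul] at e1
    rw [mul_one] at e2
    rw [← e2, ← e1]
  have h3 := congrArg (fun X => toConv (Y ∘ₗ ofConv X)) h2
  simp only [comp_mul_scal, comp_scal_mul] at h3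
  exact h3

theorem comp_lTensor (Y : A ⊗[k] A →ₗ[k] A) (f g : WithConv (C →ₗ[k] k))
    (p : WithConv (C →ₗ[k] A)) :
    toConv (Y ∘ₗ (scal A f * p * scal A g).ofConv.lTensor A) =
      scal A (pull (dropL C A) f) * toConv (Y ∘ₗ p.ofConv.lTensor A) *
        scal A (pull (dropL C A) g) := by
  have h : ∀ e : WithConv (C →ₗ[k] k), toConv (TensorProduct.map
      (1 : WithConv (A →ₗ[k] A)).ofConv (scal A e).ofConv) =
        scal (A ⊗[k] A) (pull (dropL C A) e) := by
    intro e
    ext z c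
    simp [scal, pull, dropL, Algebra.algebraMap_eq_smul_one, TensorProduct.smul_tmul',
      TensorProduct.tmul_smul, Algebra.TensorProduct.one_def, smul_smul, mul_comm]
  have h2 : toConv ((scal A f * p * scal A g).ofConv.lTensor A) =
      scal (A ⊗[k] A) (pull (dropL C A) f) * toConv (p.ofConv.lTensor A) *
        scal (A ⊗[k] A) (pull (dropL C A) g) := by
    rw [← h, ← h, lTensor, lTensor]
    have e1 := TensorProduct.map_convMul_map (g := scal A f) (f := (1 : WithConv (A →ₗ[k] A)))
      (k := p) (h := toConv LinearMap.id)
    have e2 := TensorProduct.map_convMul_map (g := scal A f * p) (f := toConv LinearMap.id)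
      (k := scal A g) (h := (1 : WithConv (A →ₗ[k] A)))
    rw [one_mul] at e1
    rw [mul_one] at e2
    rw [← e2, ← e1]
  have h3 := congrArg (fun X => toConv (Y ∘ₗ ofConv X)) h2
  simp only [comp_mul_scal, comp_scal_mul] at h3
  exact h3

end aux

/-- The coalgebra map `(x, y, z) ↦ (x, y)`. -/
def p12 (k A : Type*) [Field k] [Ring A] [Bialgebra k A] : (A ⊗[k] A) ⊗[k] A →ₗc[k] A ⊗[k] A :=
  dropR (A ⊗[k] A) A

/-- The coalgebra map `(x, y, z) ↦ (xy, z)`. -/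
def p12m (k A : Type*) [Field k] [Ring A] [Bialgebra k A] : (A ⊗[k] A) ⊗[k] A →ₗc[k] A ⊗[k] A :=
  Coalgebra.TensorProduct.map (Bialgebra.mulCoalgHom k A) (CoalgHom.id k A)

/-- The coalgebra map `(x, y, z) ↦ (y, z)`. -/
def p23 (k A : Type*) [Field k] [Ring A] [Bialgebra k A] : (A ⊗[k] A) ⊗[k] A →ₗc[k] A ⊗[k] A :=
  (dropL (A ⊗[k] A) A).comp (Coalgebra.TensorProduct.assoc k k A A A).toCoalgHom

/-- The coalgebra map `(x, y, z) ↦ (x, yz)`. -/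
def p23m (k A : Type*) [Field k] [Ring A] [Bialgebra k A] : (A ⊗[k] A) ⊗[k] A →ₗc[k] A ⊗[k] A :=
  (Coalgebra.TensorProduct.map (CoalgHom.id k A) (Bialgebra.mulCoalgHom k A)).comp
    (Coalgebra.TensorProduct.assoc k k A A A).toCoalgHom

section aux

variable {C Z : Type*} [Ring C] [Bialgebra k C] [Ring Z] [Bialgebra k Z]

theorem sum_counit_mul (f : Z →ₗ[k] k) (z : Z) : ∑ i ∈ (ℛ k z).index,
    counit (R := k) ((ℛ k z).left i) * f ((ℛ k z).right i) = f z := by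
  conv_rhs => rw [← sum_counit_smul (ℛ k z)]
  simp

theorem dropR_mul (f : WithConv (C →ₗ[k] k)) (g : WithConv (C ⊗[k] Z →ₗ[k] k)) (c : C) (z : Z) :
    (pull (dropR C Z) f * g) (c ⊗ₜ z) =
      (f * toConv (g.ofConv ∘ₗ (TensorProduct.mk k C Z).flip z)) c := by
  rw [((ℛ k c).tmul (ℛ k z)).convMul_apply, (ℛ k c).convMul_apply]
  simp only [Coalgebra.Repr.tmul_index, Coalgebra.Repr.tmul_left, Coalgebra.Repr.tmul_right,
    Finset.sum_product]
  refine Finset.sum_congr rfl fun i _ => ?_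
  have := sum_counit_mul (g.ofConv ∘ₗ TensorProduct.mk k C Z ((ℛ k c).right i)) z
  simp only [LinearMap.comp_apply, TensorProduct.mk_apply] at this
  simp [pull, dropR, ← this, Finset.mul_sum, mul_left_comm, mul_assoc]

theorem dropL_mul (f : WithConv (C →ₗ[k] k)) (g : WithConv (Z ⊗[k] C →ₗ[k] k)) (z : Z) (c : C) :
    (pull (dropL C Z) f * g) (z ⊗ₜ c) =
      (f * toConv (g.ofConv ∘ₗ TensorProduct.mk k Z C z)) c := by
  rw [((ℛ k z).tmul (ℛ k c)).convMul_apply, (ℛ k c).convMul_apply]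
  simp only [Coalgebra.Repr.tmul_index, Coalgebra.Repr.tmul_left, Coalgebra.Repr.tmul_right,
    Finset.sum_product_right]
  refine Finset.sum_congr rfl fun i _ => ?_
  have := sum_counit_mul (g.ofConv ∘ₗ (TensorProduct.mk k Z C).flip ((ℛ k c).right i)) z
  simp only [LinearMap.comp_apply, TensorProduct.mk_apply, LinearMap.flip_apply] at this
  simp [pull, dropL, ← this, Finset.mul_sum, mul_left_comm, mul_assoc]

end aux

theorem cocycle' : pull (p12 k A) σ.form * pull (p12m k A) σ.form =
    pull (p23 k A) σ.form * pull (p23m k A) σ.form := by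
  ext x y z
  have e1 := dropR_mul σ.form (pull (p12m k A) σ.form) (x ⊗ₜ y) z
  have e2 := dropL_mul σ.form (pull (Coalgebra.TensorProduct.map (CoalgHom.id k A)
    (Bialgebra.mulCoalgHom k A)) σ.form) x (y ⊗ₜ z)
  have e3 := congrArg (fun X : WithConv ((A ⊗[k] A) ⊗[k] A →ₗ[k] k) => X ((x ⊗ₜ y) ⊗ₜ z))
    (pull_mul (Coalgebra.TensorProduct.assoc k k A A A).toCoalgHom
      (pull (dropL (A ⊗[k] A) A) σ.form) (pull (Coalgebra.TensorProduct.map (CoalgHom.id k A)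
    (Bialgebra.mulCoalgHom k A)) σ.form))
  refine e1.trans (Eq.trans ?_ (e2.symm.trans e3))
  exact σ.cocycle x y z

theorem pull_inv {D C : Type*} [AddCommGroup C] [Module k C] [Coalgebra k C]
    [AddCommGroup D] [Module k D] [Coalgebra k D] (u : D →ₗc[k] C) {f g : WithConv (C →ₗ[k] k)}
    (h : f * g = 1) : pull u f * pull u g = 1 := by rw [← pull_mul, h, pull_one]

theorem cocycle_inv : pull (p12m k A) σ.inv * pull (p12 k A) σ.inv =
    pull (p23m k A) σ.inv * pull (p23 k A) σ.inv := by
  refine left_inv_eq_right_inv (a := pull (p12 k A) σ.form * pull (p12m k A) σ.form) ?_ ?_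
  · rw [mul_assoc, ← mul_assoc (pull (p12 k A) σ.inv), pull_inv _ σ.inv_mul_form, one_mul,
      pull_inv _ σ.inv_mul_form]
  · rw [cocycle', mul_assoc, ← mul_assoc (pull (p23m k A) σ.form), pull_inv _ σ.form_mul_inv,
      one_mul, pull_inv _ σ.form_mul_inv]

theorem mul_assoc' (x y z : A) : σ.mul (σ.mul (x ⊗ₜ y) ⊗ₜ z) = σ.mul (x ⊗ₜ σ.mul (y ⊗ₜ z)) := by
  have h1 := comp_rTensor σ.mul σ.form σ.inv (toConv (LinearMap.mul' k A))
  have h2 := comp_lTensor σ.mul σ.form σ.inv (toConv (LinearMap.mul' k A))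
  have h1' : toConv (σ.mul ∘ₗ (LinearMap.mul' k A).rTensor A) =
      scal A (pull (p12m k A) σ.form) * pull (p12m k A) (toConv (LinearMap.mul' k A)) *
        scal A (pull (p12m k A) σ.inv) := by
    rw [← pull_scal, ← pull_scal, ← pull_mul, ← pull_mul]; rfl
  have h2' : toConv (σ.mul ∘ₗ (LinearMap.mul' k A).lTensor A ∘ₗ
      (TensorProduct.assoc k A A A).toLinearMap) =
      scal A (pull (p23m k A) σ.form) * pull (p23m k A) (toConv (LinearMap.mul' k A)) *
        scal A (pull (p23m k A) σ.inv) := by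
    rw [← pull_scal, ← pull_scal, ← pull_mul, ← pull_mul]; rfl
  have h3 : toConv (σ.mul ∘ₗ σ.mul.lTensor A ∘ₗ (TensorProduct.assoc k A A A).toLinearMap) =
      scal A (pull (p23 k A) σ.form) * toConv (σ.mul ∘ₗ (LinearMap.mul' k A).lTensor A ∘ₗ
      (TensorProduct.assoc k A A A).toLinearMap) * scal A (pull (p23 k A) σ.inv) := by
    have := congrArg (pull (Coalgebra.TensorProduct.assoc k k A A A).toCoalgHom) h2
    rw [pull_mul, pull_mul] at this
    exact this
  have hm : pull (p12m k A) (toConv (LinearMap.mul' k A)) =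
      pull (p23m k A) (toConv (LinearMap.mul' k A)) := by
    ext x y z
    simp [pull, p12m, p23m, mul_assoc]
  have key : toConv (σ.mul ∘ₗ σ.mul.rTensor A) =
      toConv (σ.mul ∘ₗ σ.mul.lTensor A ∘ₗ (TensorProduct.assoc k A A A).toLinearMap) := by
    rw [h3, h2']
    refine h1.trans ?_
    rw [ofConv_toConv, h1', hm]
    simp only [← mul_assoc]
    change scal A (pull (p12 k A) _) * _ * _ * _ * scal A (pull (p12 k A) _) = _
    rw [← scal_mul, ← scal_mul, cocycle', mul_assoc, mul_assoc _ _ (scal A (pull (p23 k A) σ.inv)),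
      ← scal_mul, ← scal_mul, cocycle_inv]
  exact congrArg (fun X : WithConv ((A ⊗[k] A) ⊗[k] A →ₗ[k] A) => X ((x ⊗ₜ y) ⊗ₜ z)) key

theorem inv_one_right (x : A) : σ.inv (x ⊗ₜ 1) = counit (R := k) x := by
  have h := congrArg (fun X : WithConv (A ⊗[k] A →ₗ[k] k) => X (x ⊗ₜ 1)) σ.form_mul_inv
  simp only [convMul_apply, TensorProduct.comul_tmul, convOne_apply, Bialgebra.comul_one,
    Algebra.TensorProduct.one_def] at h
  rw [← (ℛ k x).eq] at h
  have h1 : ∀ a, σ.form.ofConv (a ⊗ₜ 1) = counit (R := k) a := σ.form_one_right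
  have h2 := sum_counit_mul (σ.inv.ofConv ∘ₗ (TensorProduct.mk k A A).flip 1) x
  simp only [LinearMap.comp_apply, LinearMap.flip_apply, TensorProduct.mk_apply] at h2
  rw [← h2]
  simpa [TensorProduct.sum_tmul, h1] using h

theorem inv_one_left (x : A) : σ.inv (1 ⊗ₜ x) = counit (R := k) x := by
  have h := congrArg (fun X : WithConv (A ⊗[k] A →ₗ[k] k) => X (1 ⊗ₜ x)) σ.form_mul_inv
  simp only [convMul_apply, TensorProduct.comul_tmul, convOne_apply, Bialgebra.comul_one,
    Algebra.TensorProduct.one_def] at h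
  rw [← (ℛ k x).eq] at h
  have h1 : ∀ a, σ.form.ofConv (1 ⊗ₜ a) = counit (R := k) a := σ.form_one_left
  have h2 := sum_counit_mul (σ.inv.ofConv ∘ₗ TensorProduct.mk k A A 1) x
  simp only [LinearMap.comp_apply, TensorProduct.mk_apply] at h2
  rw [← h2]
  simpa [TensorProduct.tmul_sum, h1] using h

/-- The coalgebra map `x ↦ x ⊗ 1`. -/
def inclL (k A : Type*) [Field k] [Ring A] [Bialgebra k A] : A →ₗc[k] A ⊗[k] A where
  __ := (TensorProduct.mk k A A).flip 1
  counit_comp := by ext; simp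
  map_comp_comul := by
    ext x
    simp [Algebra.TensorProduct.one_def, ← (ℛ k x).eq, TensorProduct.sum_tmul]

/-- The coalgebra map `x ↦ 1 ⊗ x`. -/
def inclR (k A : Type*) [Field k] [Ring A] [Bialgebra k A] : A →ₗc[k] A ⊗[k] A where
  __ := TensorProduct.mk k A A 1
  counit_comp := by ext; simp
  map_comp_comul := by
    ext x
    simp [Algebra.TensorProduct.one_def, ← (ℛ k x).eq, TensorProduct.tmul_sum]

theorem mul_one' (x : A) : σ.mul (x ⊗ₜ 1) = x := by
  have h1 : pull (inclL k A) σ.form = 1 := by ext x; exact σ.form_one_right x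
  have h2 : pull (inclL k A) σ.inv = 1 := by ext x; exact σ.inv_one_right x
  have h : pull (inclL k A) (scal A σ.form * toConv (LinearMap.mul' k A) * scal A σ.inv) =
      pull (inclL k A) (toConv (LinearMap.mul' k A)) := by
    rw [pull_mul, pull_mul, pull_scal, pull_scal, h1, h2, scal_one, one_mul, mul_one]
  exact (congrArg (fun X : WithConv (A →ₗ[k] A) => X x) h).trans (mul_one x)

theorem one_mul' (x : A) : σ.mul (1 ⊗ₜ x) = x := by
  have h1 : pull (inclR k A) σ.form = 1 := by ext x; exact σ.form_one_left x
  have h2 : pull (inclR k A) σ.inv = 1 := by ext x; exact σ.inv_one_left x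
  have h : pull (inclR k A) (scal A σ.form * toConv (LinearMap.mul' k A) * scal A σ.inv) =
      pull (inclR k A) (toConv (LinearMap.mul' k A)) := by
    rw [pull_mul, pull_mul, pull_scal, pull_scal, h1, h2, scal_one, one_mul, mul_one]
  exact (congrArg (fun X : WithConv (A →ₗ[k] A) => X x) h).trans (one_mul x)

theorem comul_mul (x y : A) : comul (R := k) (σ.mul (x ⊗ₜ y)) =
    TensorProduct.map σ.mul σ.mul (comul (R := k) (x ⊗ₜ[k] y)) := by
  let i1 : A →ₐ[k] A ⊗[k] A := Algebra.TensorProduct.includeLeft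
  let i2 : A →ₐ[k] A ⊗[k] A := Algebra.TensorProduct.includeRight
  have hm : toConv (comul (R := k) ∘ₗ LinearMap.mul' k A) =
      toConv (i1.toLinearMap ∘ₗ LinearMap.mul' k A) *
        toConv (i2.toLinearMap ∘ₗ LinearMap.mul' k A) := by
    ext x y
    rw [LinearMap.convMul_def]
    simp [i1, i2, ← ((ℛ k x).tmul (ℛ k y)).eq, ← (ℛ k x).eq, ← (ℛ k y).eq, Finset.sum_mul_sum,
      Finset.sum_product]
  have hi : ∀ i : A →ₐ[k] A ⊗[k] A, toConv (i.toLinearMap ∘ₗ σ.mul) =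
      scal _ σ.form * toConv (i.toLinearMap ∘ₗ LinearMap.mul' k A) * scal _ σ.inv := by
    intro i
    have := comp_mul_scal i.toLinearMap σ.inv (scal A σ.form * toConv (LinearMap.mul' k A))
    rw [comp_scal_mul] at this
    exact this
  have hc : toConv (comul (R := k) ∘ₗ σ.mul) =
      toConv (i1.toLinearMap ∘ₗ σ.mul) * toConv (i2.toLinearMap ∘ₗ σ.mul) := by
    have := comp_mul_scal (comul (R := k) (A := A)) σ.inv
      (scal A σ.form * toConv (LinearMap.mul' k A))
    rw [comp_scal_mul] at this
    refine Eq.trans this ?_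
    rw [hi, hi, ofConv_toConv, hm]
    simp only [mul_assoc]
    rw [← mul_assoc (scal _ σ.inv) (scal _ σ.form), ← scal_mul, σ.inv_mul_form, scal_one, one_mul]
  have h := congrArg (fun X : WithConv (A ⊗[k] A →ₗ[k] A ⊗[k] A) => X (x ⊗ₜ y)) hc
  refine Eq.trans h ?_
  rw [convMul_apply]
  generalize comul (R := k) (x ⊗ₜ[k] y) = w
  induction w with
  | zero => simp
  | add a b ha hb => simp only [map_add, ha, hb]
  | tmul a b => simp [i1, i2]

theorem counit_mul (x y : A) : counit (R := k) (σ.mul (x ⊗ₜ y)) =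
    counit (R := k) x * counit (R := k) y := by
  have := comp_mul_scal (counit (R := k) (A := A)) σ.inv
    (scal A σ.form * toConv (LinearMap.mul' k A))
  rw [comp_scal_mul] at this
  have h1 : toConv (counit (R := k) ∘ₗ LinearMap.mul' k A) = 1 := by
    ext x y; simp [mul_comm]
  rw [ofConv_toConv, h1, mul_one, ← scal_mul, σ.form_mul_inv, scal_one] at this
  have h := congrArg (fun X : WithConv (A ⊗[k] A →ₗ[k] k) => X (x ⊗ₜ y)) this
  exact h.trans (by simp [mul_comm])

theorem smul_mul' (r : k) (x y : A) : σ.mul ((r • x) ⊗ₜ y) = r • σ.mul (x ⊗ₜ y) := by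
  rw [← TensorProduct.smul_tmul', map_smul]

theorem mul_smul' (r : k) (x y : A) : σ.mul (x ⊗ₜ (r • y)) = r • σ.mul (x ⊗ₜ y) := by
  rw [TensorProduct.tmul_smul, map_smul]

/-- The cocycle deformation `A^σ`: the coalgebra `A`, with the product
`x · y = σ(x₁, y₁) x₂ y₂ σ⁻¹(x₃, y₃)`. -/
def Deform (_ : TwoCocycle k A) : Type _ := A

namespace Deform

instance : AddCommGroup σ.Deform := inferInstanceAs (AddCommGroup A)
instance : Module k σ.Deform := inferInstanceAs (Module k A)
instance : Coalgebra k σ.Deform := inferInstanceAs (Coalgebra k A)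

/-- The identity map `A → A^σ`. -/
def of : A ≃ₗc[k] σ.Deform := CoalgEquiv.refl k A

instance : Ring σ.Deform :=
  { (inferInstance : AddCommGroup σ.Deform) with
    mul := fun x y => of σ (σ.mul ((of σ).symm x ⊗ₜ (of σ).symm y))
    one := of σ 1
    left_distrib := fun x y z =>
      (congrArg σ.mul (TensorProduct.tmul_add (R := k) (M := A) (N := A) x y z)).trans
        (map_add σ.mul _ _)
    right_distrib := fun x y z =>
      (congrArg σ.mul (TensorProduct.add_tmul (R := k) (M := A) (N := A) x y z)).trans
        (map_add σ.mul _ _)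
    zero_mul := fun x =>
      (congrArg σ.mul (TensorProduct.zero_tmul (R := k) A (n := (x : A)))).trans (map_zero σ.mul)
    mul_zero := fun x =>
      (congrArg σ.mul (TensorProduct.tmul_zero (R := k) A (m := (x : A)))).trans (map_zero σ.mul)
    mul_assoc := fun x y z => σ.mul_assoc' x y z
    one_mul := fun x => σ.one_mul' x
    mul_one := fun x => σ.mul_one' x }

theorem of_mul_of (x y : A) : of σ x * of σ y = of σ (σ.mul (x ⊗ₜ y)) := rfl

theorem one_def : (1 : σ.Deform) = of σ 1 := rfl

instance : Algebra k σ.Deform :=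
  Algebra.ofModule (fun r x y => σ.smul_mul' r x y) (fun r x y => σ.mul_smul' r x y)

theorem comul_of (x : A) : Coalgebra.comul (R := k) (of σ x) =
    TensorProduct.map (of σ).toLinearEquiv.toLinearMap (of σ).toLinearEquiv.toLinearMap
      (Coalgebra.comul (R := k) x) :=
  (CoalgHomClass.map_comp_comul_apply (of σ) x).symm

theorem counit_of (x : A) : Coalgebra.counit (R := k) (of σ x) = Coalgebra.counit (R := k) x := rfl

theorem comul_mul_of (x y : A) : Coalgebra.comul (R := k) (of σ x * of σ y) =
    Coalgebra.comul (R := k) (of σ x) * Coalgebra.comul (R := k) (of σ y) := by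
  rw [of_mul_of, comul_of, comul_of, comul_of, comul_mul, ← ((ℛ k x).tmul (ℛ k y)).eq,
    ← (ℛ k x).eq, ← (ℛ k y).eq]
  simp only [Coalgebra.Repr.tmul_index, Coalgebra.Repr.tmul_left, Coalgebra.Repr.tmul_right,
    map_sum, Finset.sum_product, Finset.sum_mul_sum, TensorProduct.map_tmul,
    Algebra.TensorProduct.tmul_mul_tmul]
  rfl

instance : Bialgebra k σ.Deform :=
  Bialgebra.mk' k σ.Deform (Bialgebra.counit_one (R := k) (A := A))
    (fun {x y} => σ.counit_mul x y) (Bialgebra.comul_one (R := k) (A := A))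
    (fun {x y} => comul_mul_of σ x y)

end Deform

end TwoCocycle

/-- A skew pairing `τ : B ⊗ H → k` of Hopf algebras:
`τ(bc, h) = τ(b, h₁) τ(c, h₂)`, `τ(b, hl) = τ(b₁, l) τ(b₂, h)`, `τ(b, 1) = ε(b)` and
`τ(1, h) = ε(h)`. -/
structure SkewPairing (k B H : Type*) [Field k] [Ring B] [HopfAlgebra k B] [Ring H]
    [HopfAlgebra k H] where
  form : B →ₗ[k] H →ₗ[k] k
  mul_left : ∀ b c h, form (b * c) h =
    LinearMap.mul' k k (TensorProduct.map (form b) (form c) (Coalgebra.comul h))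
  mul_right : ∀ b h l, form b (h * l) =
    LinearMap.mul' k k (TensorProduct.map (form.flip l) (form.flip h) (Coalgebra.comul b))
  one_right : ∀ b, form b 1 = Coalgebra.counit b
  one_left : ∀ h, form 1 h = Coalgebra.counit h

namespace SkewPairing

open Coalgebra WithConv LinearMap TwoCocycle

variable {k B H : Type*} [Field k] [Ring B] [HopfAlgebra k B] [Ring H] [HopfAlgebra k H]
  (τ : SkewPairing k B H)

theorem mul_left_sum (b c : B) (h : H) : τ.form (b * c) h = ∑ i ∈ (ℛ k h).index,
    τ.form b ((ℛ k h).left i) * τ.form c ((ℛ k h).right i) := by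
  rw [τ.mul_left, ← (ℛ k h).eq]; simp

theorem mul_right_sum (b : B) (h l : H) : τ.form b (h * l) = ∑ i ∈ (ℛ k b).index,
    τ.form ((ℛ k b).left i) l * τ.form ((ℛ k b).right i) h := by
  rw [τ.mul_right, ← (ℛ k b).eq]; simp

/-- The coalgebra map `(b ⊗ h) ⊗ (c ⊗ l) ↦ ε(b) c ⊗ h ε(l)`. -/
def middle (k B H : Type*) [Field k] [Ring B] [HopfAlgebra k B] [Ring H] [HopfAlgebra k H] :
    (B ⊗[k] H) ⊗[k] (B ⊗[k] H) →ₗc[k] B ⊗[k] H :=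
  ((Bialgebra.TensorProduct.comm k H B).toCoalgEquiv.toCoalgHom).comp
    (Coalgebra.TensorProduct.map (dropL H B) (dropR B H))

theorem middle_tmul (b c : B) (h l : H) : middle k B H ((b ⊗ₜ h) ⊗ₜ (c ⊗ₜ l)) =
    (counit (R := k) b * counit (R := k) l) • (c ⊗ₜ[k] h) := by
  simp only [middle, dropL, dropR]
  change counit (R := k) l • (c ⊗ₜ[k] (counit (R := k) b • h)) = _
  rw [TensorProduct.tmul_smul, smul_smul, mul_comm]

theorem sum_mul_counit (f : B →ₗ[k] k) (z : B) : ∑ i ∈ (ℛ k z).index,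
    f ((ℛ k z).left i) * counit (R := k) ((ℛ k z).right i) = f z := by
  have h := congrArg (LinearMap.mul' k k ∘ₗ TensorProduct.map f LinearMap.id)
    (sum_tmul_counit_eq (ℛ k z))
  simpa only [map_sum, LinearMap.comp_apply, TensorProduct.map_tmul, LinearMap.mul'_apply,
    LinearMap.id_apply, mul_one] using h

/-- The form `(b ⊗ h, c ⊗ l) ↦ ε(b) τ(c, h) ε(l)` on `B ⊗ H`. -/
def cocycleForm : WithConv ((B ⊗[k] H) ⊗[k] (B ⊗[k] H) →ₗ[k] k) :=
  pull (middle k B H) (toConv (TensorProduct.lift τ.form))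

theorem cocycleForm_tmul (b c : B) (h l : H) : τ.cocycleForm ((b ⊗ₜ h) ⊗ₜ (c ⊗ₜ l)) =
    counit (R := k) b * τ.form c h * counit (R := k) l := by
  change TensorProduct.lift τ.form (middle k B H ((b ⊗ₜ h) ⊗ₜ (c ⊗ₜ l))) = _
  rw [middle_tmul, map_smul, TensorProduct.lift.tmul, smul_eq_mul]
  ring

/-- The convolution inverse `(b, h) ↦ τ(S(b), h)` of `τ`. -/
def invForm : WithConv (B ⊗[k] H →ₗ[k] k) :=
  toConv (TensorProduct.lift (τ.form ∘ₗ HopfAlgebra.antipode k))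

theorem form_mul_inv : toConv (TensorProduct.lift τ.form) * τ.invForm = 1 := by
  refine WithConv.ext (TensorProduct.ext' fun b h => ?_)
  rw [((ℛ k b).tmul (ℛ k h)).convMul_apply]
  have := congrArg (fun x => τ.form x h) (HopfAlgebra.sum_mul_antipode_eq_smul (ℛ k b))
  simp only [map_sum, LinearMap.sum_apply, mul_left_sum, map_smul, LinearMap.smul_apply,
    τ.one_left] at this
  simpa [invForm, Finset.sum_product, mul_comm] using this

theorem inv_mul_form : τ.invForm * toConv (TensorProduct.lift τ.form) = 1 := by
  refine WithConv.ext (TensorProduct.ext' fun b h => ?_)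
  rw [((ℛ k b).tmul (ℛ k h)).convMul_apply]
  have := congrArg (fun x => τ.form x h) (HopfAlgebra.sum_antipode_mul_eq_smul (ℛ k b))
  simp only [map_sum, LinearMap.sum_apply, mul_left_sum, map_smul, LinearMap.smul_apply,
    τ.one_left] at this
  simpa [invForm, Finset.sum_product, mul_comm] using this

theorem cocycle_left (b c d : B) (h l m : H) :
    (τ.cocycleForm * toConv (τ.cocycleForm.ofConv ∘ₗ
      (TensorProduct.mk k (B ⊗[k] H) (B ⊗[k] H)).flip (d ⊗ₜ m) ∘ₗ
      LinearMap.mul' k (B ⊗[k] H))) ((b ⊗ₜ h) ⊗ₜ (c ⊗ₜ l)) =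
    counit (R := k) b * counit (R := k) m * ∑ i ∈ (ℛ k h).index, ∑ j ∈ (ℛ k d).index,
      τ.form c ((ℛ k h).left i) * τ.form ((ℛ k d).left j) l *
        τ.form ((ℛ k d).right j) ((ℛ k h).right i) := by
  rw [(((ℛ k b).tmul (ℛ k h)).tmul ((ℛ k c).tmul (ℛ k l))).convMul_apply]
  have e : ∀ (p r : B) (q s : H), τ.cocycleForm.ofConv ((p ⊗ₜ[k] q) ⊗ₜ[k] (r ⊗ₜ[k] s)) =
    counit (R := k) p * τ.form r q * counit (R := k) s := τ.cocycleForm_tmul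
  simp only [Coalgebra.Repr.tmul_index, Coalgebra.Repr.tmul_left, Coalgebra.Repr.tmul_right,
    Finset.sum_product, LinearMap.comp_apply, LinearMap.mul'_apply, LinearMap.flip_apply,
    TensorProduct.mk_apply, Algebra.TensorProduct.tmul_mul_tmul, e, Bialgebra.counit_mul]
  have e1 : ∀ i₁ i₂ i₃, ∑ i₄ ∈ (ℛ k l).index, counit (R := k) ((ℛ k b).left i₁) *
      τ.form ((ℛ k c).left i₃) ((ℛ k h).left i₂) * counit (R := k) ((ℛ k l).left i₄) *
      (counit (R := k) ((ℛ k b).right i₁) * counit (R := k) ((ℛ k c).right i₃) *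
        τ.form d ((ℛ k h).right i₂ * (ℛ k l).right i₄) * counit (R := k) m) =
      (counit (R := k) ((ℛ k b).left i₁) * counit (R := k) ((ℛ k b).right i₁)) *
      (counit (R := k) m * (τ.form d ((ℛ k h).right i₂ * l) *
      (τ.form ((ℛ k c).left i₃) ((ℛ k h).left i₂) * counit (R := k) ((ℛ k c).right i₃)))) := by
    intro i₁ i₂ i₃
    have := sum_counit_mul (τ.form d ∘ₗ LinearMap.mulLeft k ((ℛ k h).right i₂)) l
    simp only [LinearMap.comp_apply, LinearMap.mulLeft_apply] at this
    rw [← this, Finset.sum_mul, Finset.mul_sum, Finset.mul_sum]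
    exact Finset.sum_congr rfl fun _ _ => by ring
  have e2 : ∀ q, ∑ i ∈ (ℛ k c).index,
      τ.form ((ℛ k c).left i) q * counit (R := k) ((ℛ k c).right i) = τ.form c q :=
    fun q => sum_mul_counit (τ.form.flip q) c
  simp only [e1, ← Finset.mul_sum, e2, ← Finset.sum_mul, sum_counit_mul (counit (R := k)) b]
  simp only [mul_right_sum, Finset.mul_sum, Finset.sum_mul]
  exact Finset.sum_congr rfl fun _ _ => Finset.sum_congr rfl fun _ _ => by ring

theorem cocycle_right (b c d : B) (h l m : H) :
    (τ.cocycleForm * toConv (τ.cocycleForm.ofConv ∘ₗ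
      TensorProduct.mk k (B ⊗[k] H) (B ⊗[k] H) (b ⊗ₜ h) ∘ₗ
      LinearMap.mul' k (B ⊗[k] H))) ((c ⊗ₜ l) ⊗ₜ (d ⊗ₜ m)) =
    counit (R := k) b * counit (R := k) m * ∑ i ∈ (ℛ k h).index, ∑ j ∈ (ℛ k d).index,
      τ.form c ((ℛ k h).left i) * τ.form ((ℛ k d).left j) l *
        τ.form ((ℛ k d).right j) ((ℛ k h).right i) := by
  rw [(((ℛ k c).tmul (ℛ k l)).tmul ((ℛ k d).tmul (ℛ k m))).convMul_apply]
  have e : ∀ (p r : B) (q s : H), τ.cocycleForm.ofConv ((p ⊗ₜ[k] q) ⊗ₜ[k] (r ⊗ₜ[k] s)) =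
    counit (R := k) p * τ.form r q * counit (R := k) s := τ.cocycleForm_tmul
  simp only [Coalgebra.Repr.tmul_index, Coalgebra.Repr.tmul_left, Coalgebra.Repr.tmul_right,
    Finset.sum_product, LinearMap.comp_apply, LinearMap.mul'_apply,
    TensorProduct.mk_apply, Algebra.TensorProduct.tmul_mul_tmul, e, Bialgebra.counit_mul]
  have e0 : ∀ i₁ i₂ i₃ i₄, counit (R := k) ((ℛ k c).left i₁) *
      τ.form ((ℛ k d).left i₃) ((ℛ k l).left i₂) * counit (R := k) ((ℛ k m).left i₄) *
      (counit (R := k) b * τ.form ((ℛ k c).right i₁ * (ℛ k d).right i₃) h *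
        (counit (R := k) ((ℛ k l).right i₂) * counit (R := k) ((ℛ k m).right i₄))) =
      (counit (R := k) b * (counit (R := k) ((ℛ k c).left i₁) *
        τ.form ((ℛ k c).right i₁ * (ℛ k d).right i₃) h)) *
      (τ.form ((ℛ k d).left i₃) ((ℛ k l).left i₂) * counit (R := k) ((ℛ k l).right i₂)) *
      (counit (R := k) ((ℛ k m).left i₄) * counit (R := k) ((ℛ k m).right i₄)) := by
    intros; ring
  have e1 : ∀ r, ∑ i ∈ (ℛ k l).index,
      τ.form r ((ℛ k l).left i) * counit (R := k) ((ℛ k l).right i) = τ.form r l :=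
    fun r => sum_mul_counit (τ.form r) l
  have e2 : ∀ r, ∑ i ∈ (ℛ k c).index,
      counit (R := k) ((ℛ k c).left i) * τ.form ((ℛ k c).right i * r) h = τ.form (c * r) h :=
    fun r => sum_counit_mul (τ.form.flip h ∘ₗ LinearMap.mulRight k r) c
  simp only [e0, ← Finset.mul_sum, sum_counit_mul (counit (R := k)) m]
  rw [Finset.sum_congr rfl fun _ _ => Finset.sum_comm]
  simp only [← Finset.sum_mul, ← Finset.mul_sum, e1]
  rw [Finset.sum_comm]
  simp only [← Finset.sum_mul, ← Finset.mul_sum, e2]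
  simp only [mul_left_sum, Finset.mul_sum, Finset.sum_mul]
  rw [Finset.sum_comm]
  exact Finset.sum_congr rfl fun _ _ => Finset.sum_congr rfl fun _ _ => by ring

/-- The left side of the cocycle condition as a linear map. -/
def leftForm : B ⊗[k] H →ₗ[k] (B ⊗[k] H) ⊗[k] (B ⊗[k] H) →ₗ[k] k where
  toFun z := (τ.cocycleForm * toConv (τ.cocycleForm.ofConv ∘ₗ
      (TensorProduct.mk k (B ⊗[k] H) (B ⊗[k] H)).flip z ∘ₗ
      LinearMap.mul' k (B ⊗[k] H))).ofConv
  map_add' x y := by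
    rw [map_add, LinearMap.add_comp, LinearMap.comp_add, toConv_add, mul_add, ofConv_add]
  map_smul' r x := by
    rw [map_smul, LinearMap.smul_comp, LinearMap.comp_smul, toConv_smul, mul_smul_comm,
      ofConv_smul]; rfl

/-- The right side of the cocycle condition as a linear map. -/
def rightForm : B ⊗[k] H →ₗ[k] (B ⊗[k] H) ⊗[k] (B ⊗[k] H) →ₗ[k] k where
  toFun x := (τ.cocycleForm * toConv (τ.cocycleForm.ofConv ∘ₗ
      TensorProduct.mk k (B ⊗[k] H) (B ⊗[k] H) x ∘ₗ
      LinearMap.mul' k (B ⊗[k] H))).ofConv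
  map_add' x y := by
    rw [map_add, LinearMap.add_comp, LinearMap.comp_add, toConv_add, mul_add, ofConv_add]
  map_smul' r x := by
    rw [map_smul, LinearMap.smul_comp, LinearMap.comp_smul, toConv_smul, mul_smul_comm,
      ofConv_smul]; rfl

/-- The 2-cocycle `(b ⊗ h, c ⊗ l) ↦ ε(b) τ(c, h) ε(l)` on the Hopf algebra `B ⊗ H`. -/
def cocycle : TwoCocycle k (B ⊗[k] H) where
  form := τ.cocycleForm
  inv := pull (middle k B H) τ.invForm
  form_mul_inv := pull_inv _ τ.form_mul_inv
  inv_mul_form := pull_inv _ τ.inv_mul_form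
  cocycle x y z := by
    have eL : ∀ x y z, τ.leftForm z (x ⊗ₜ y) = (τ.cocycleForm * toConv (τ.cocycleForm.ofConv ∘ₗ
      (TensorProduct.mk k (B ⊗[k] H) (B ⊗[k] H)).flip z ∘ₗ
      LinearMap.mul' k (B ⊗[k] H))) (x ⊗ₜ y) := fun _ _ _ => rfl
    rw [← eL]
    change _ = τ.rightForm x (y ⊗ₜ z)
    induction x with
    | zero => simp
    | add a b ha hb =>
      rw [TensorProduct.add_tmul, map_add, map_add, LinearMap.add_apply, ha, hb]
    | tmul b h =>
      induction y with
      | zero => simp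
      | add a b ha hb =>
        rw [TensorProduct.add_tmul, TensorProduct.tmul_add, map_add, map_add, ha, hb]
      | tmul c l =>
        induction z with
        | zero => simp
        | add a b ha hb =>
          rw [TensorProduct.tmul_add, map_add, map_add, LinearMap.add_apply, ha, hb]
        | tmul d m => exact (τ.cocycle_left b c d h l m).trans (τ.cocycle_right b c d h l m).symm
  form_one_right x := by
    induction x with
    | zero => simp
    | add a b ha hb => rw [TensorProduct.add_tmul, map_add, map_add, ha, hb]
    | tmul b h =>
      rw [Algebra.TensorProduct.one_def, cocycleForm_tmul, τ.one_left]
      simp [mul_comm]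
  form_one_left x := by
    induction x with
    | zero => simp
    | add a b ha hb => rw [TensorProduct.tmul_add, map_add, map_add, ha, hb]
    | tmul b h =>
      rw [Algebra.TensorProduct.one_def, cocycleForm_tmul, τ.one_right]
      simp [mul_comm]

/-- The generalized quantum double `B ⋈_τ H`: the deformation of the Hopf algebra `B ⊗ H` by the
2-cocycle associated to `τ`. -/
abbrev Double : Type _ := τ.cocycle.Deform

end SkewPairing

namespace PreNichols

open Coalgebra WithConv LinearMap

section rep

variable {k F I : Type*} [Field k] [CommGroup F] {V : DiagYD k F I} (N : PreNichols V)

/-- The character of the bosonization with `v_i ↦ 0` which extends the character `a` of `F`. -/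
def charHom (a : F →* kˣ) : N.Boson →ₐ[k] k :=
  N.lift FreeAlgebra.algebraMapInv ((Units.coeHom k).comp a) N.counit_eq_zero
    (by simp [FreeAlgebra.algebraMapInv])

@[simp] theorem charHom_gen (a : F →* kˣ) (i : I) : N.charHom a (N.gen i) = 0 := by
  simp [charHom, FreeAlgebra.algebraMapInv]

@[simp] theorem charHom_grp (a : F →* kˣ) (h : F) : N.charHom a (N.grp h) = a h := by
  simp [charHom]

open Classical in
/-- The algebra map from `T(V)` to upper triangular matrices with `v_i ↦ E` and `v_j ↦ 0` for
`j ≠ i`, where `E` is the matrix unit at the upper right corner. -/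
def repFree (k : Type*) [Field k] {I : Type*} (i : I) :
    FreeAlgebra k I →ₐ[k] Matrix (Fin 2) (Fin 2) k :=
  FreeAlgebra.lift k fun j => if j = i then !![0, 1; 0, 0] else 0

theorem repFree_apply (i : I) (x : FreeAlgebra k I) :
    repFree k i x = !![FreeAlgebra.algebraMapInv x, repFree k i x 0 1;
      0, FreeAlgebra.algebraMapInv x] := by
  induction x with
  | grade0 r => ext a b; fin_cases a <;> fin_cases b <;> simp [Matrix.algebraMap_matrix_apply]
  | grade1 j =>
    ext a b
    by_cases h : j = i <;> fin_cases a <;> fin_cases b <;>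
      simp [repFree, FreeAlgebra.algebraMapInv, h]
  | mul x y hx hy =>
    rw [map_mul, map_mul, hx, hy]
    ext a b
    fin_cases a <;> fin_cases b <;> simp [Matrix.mul_apply]
  | add x y hx hy =>
    rw [map_add, map_add, hx, hy]
    ext a b
    fin_cases a <;> fin_cases b <;> simp

theorem grade_coeff (i : I) (x : FreeAlgebra k I) :
    (FreeAlgebra.grade k I x).coeff 0 = algebraMap k _ (FreeAlgebra.algebraMapInv x) ∧
    (FreeAlgebra.grade k I x).coeff 1 ∈
      Submodule.span k (Set.range (FreeAlgebra.ι k (X := I))) ∧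
    repFree k i x 0 1 = repFree k i ((FreeAlgebra.grade k I x).coeff 1) 0 1 := by
  induction x with
  | grade0 r => simp [Polynomial.algebraMap_apply, Polynomial.coeff_C,
      Matrix.algebraMap_matrix_apply]
  | grade1 j =>
    simp only [FreeAlgebra.grade, FreeAlgebra.lift_ι_apply, FreeAlgebra.algebraMapInv]
    refine ⟨by simp, ?_, ?_⟩
    · rw [Polynomial.coeff_C_mul_X, if_pos rfl]
      exact Submodule.subset_span ⟨j, rfl⟩
    · simp
  | mul x y hx hy =>
    have h1 : ((FreeAlgebra.grade k I) (x * y)).coeff 1 =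
        FreeAlgebra.algebraMapInv x • (FreeAlgebra.grade k I y).coeff 1 +
        FreeAlgebra.algebraMapInv y • (FreeAlgebra.grade k I x).coeff 1 := by
      rw [map_mul, Polynomial.mul_coeff_one, hx.1, hy.1, ← Algebra.commutes, ← Algebra.smul_def,
        ← Algebra.smul_def]
    refine ⟨by rw [map_mul, Polynomial.mul_coeff_zero, hx.1, hy.1, map_mul, map_mul], ?_, ?_⟩
    · rw [h1]
      exact add_mem (Submodule.smul_mem _ _ hy.2.1) (Submodule.smul_mem _ _ hx.2.1)
    · rw [h1, map_add, map_smul, map_smul, Matrix.add_apply, Matrix.smul_apply, Matrix.smul_apply,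
        ← hx.2.2, ← hy.2.2, map_mul]
      conv_lhs => rw [repFree_apply i x, repFree_apply i y]
      simp [Matrix.mul_apply, mul_comm]
  | add x y hx hy =>
    simp only [map_add, Polynomial.coeff_add, Matrix.add_apply]
    exact ⟨by rw [hx.1, hy.1], add_mem hx.2.1 hy.2.1, by rw [hx.2.2, hy.2.2]⟩

theorem repFree_eq_zero (i : I) (x : FreeAlgebra k I) (hx : x ∈ N.ideal) : repFree k i x = 0 := by
  obtain ⟨-, h1, h2⟩ := grade_coeff i x
  rw [N.eq_zero_of_mem_span _ (N.homogeneous x hx 1) h1] at h2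
  rw [repFree_apply, h2, N.counit_eq_zero x hx]
  ext a b
  fin_cases a <;> fin_cases b <;> simp

variable (i : I) (a b : F →* kˣ) (hab : ∀ h, a h = V.char i h * b h)

/-- The representation of the bosonization by upper triangular matrices of size two which extends
`repFree` and maps `h ∈ F` to the diagonal matrix with entries `a h` and `b h`. -/
def rep : N.Boson →ₐ[k] Matrix (Fin 2) (Fin 2) k :=
  N.lift (repFree k i)
    { toFun h := !![(a h : k), 0; 0, (b h : k)]
      map_one' := by ext a b; fin_cases a <;> fin_cases b <;> simp
      map_mul' x y := by ext a b; fin_cases a <;> fin_cases b <;> simp }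
    (N.repFree_eq_zero i) (by
      intro h j
      by_cases hj : j = i
      · subst hj
        ext a b
        fin_cases a <;> fin_cases b <;> simp [repFree, hab]
      · simp [repFree, hj])

theorem rep_gen (j : I) [Decidable (j = i)] :
    N.rep i a b hab (N.gen j) = if j = i then !![0, 1; 0, 0] else 0 := by
  by_cases h : j = i <;> simp [rep, repFree, h]

theorem rep_grp (h : F) : N.rep i a b hab (N.grp h) = !![(a h : k), 0; 0, (b h : k)] := by
  simp [rep]

theorem rep_apply (x : N.Boson) : N.rep i a b hab x =
    !![N.charHom a x, N.rep i a b hab x 0 1; 0, N.charHom b x] := by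
  classical
  refine N.subalgebra_eq_top (S :=
    { carrier := {x | N.rep i a b hab x =
        !![N.charHom a x, N.rep i a b hab x 0 1; 0, N.charHom b x]}
      mul_mem' := fun {x y} hx hy => ?_
      add_mem' := fun {x y} hx hy => ?_
      algebraMap_mem' := fun r => ?_ }) (fun j => ?_) (fun h => ?_) x
  · change _ = _ at hx
    change _ = _ at hy
    change _ = _
    rw [map_mul, map_mul, hx, hy]
    ext a b
    fin_cases a <;> fin_cases b <;> simp [Matrix.mul_apply]
  · change _ = _ at hx
    change _ = _ at hy
    change _ = _
    rw [map_add, map_add, hx, hy]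
    ext a b
    fin_cases a <;> fin_cases b <;> simp
  · change _ = _
    ext a b
    fin_cases a <;> fin_cases b <;> simp [Matrix.algebraMap_matrix_apply]
  · change _ = _
    rw [rep_gen]
    ext a b
    by_cases h : j = i <;> fin_cases a <;> fin_cases b <;> simp [h]
  · change _ = _
    rw [rep_grp]
    ext a b
    fin_cases a <;> fin_cases b <;> simp

end rep

/-- The pre-Nichols algebra `T(V)`. -/
def free {k F I : Type*} [Field k] [CommGroup F] (V : DiagYD k F I) : PreNichols V where
  ideal := ⊥
  isTwoSided := inferInstance
  homogeneous x hx n := by simp_all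
  act_mem h x hx := by simp_all
  coact_mem x hx := by simp_all
  comul_mem x hx := by simp_all
  counit_eq_zero x hx := by simp_all
  antipode_mem x hx := by simp_all
  eq_zero_of_mem_span x hx _ := by simpa using hx

section proj

variable {k F I : Type*} [Field k] [CommGroup F] {V : DiagYD k F I} (N : PreNichols V)

/-- The projection from the bosonization of `T(V)`. -/
def bosonProj : (free V).Boson →ₐ[k] N.Boson :=
  (free V).lift (N.inclAlg.comp N.proj) N.grp
    (fun x hx => by rw [show x = 0 from hx]; simp) (fun h i => N.grp_mul_gen h i)

@[simp] theorem bosonProj_gen (i : I) : N.bosonProj ((free V).gen i) = N.gen i :=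
  (free V).lift_gen _ _ _ _ i

@[simp] theorem bosonProj_grp (h : F) : N.bosonProj ((free V).grp h) = N.grp h :=
  (free V).lift_grp _ _ _ _ h

theorem bosonProj_surjective : Function.Surjective N.bosonProj := fun b =>
  N.subalgebra_eq_top (S := N.bosonProj.range) (fun i => ⟨_, N.bosonProj_gen i⟩)
    (fun h => ⟨_, N.bosonProj_grp h⟩) b

theorem comul_bosonProj (x : (free V).Boson) : comul (R := k) (N.bosonProj x) =
    TensorProduct.map N.bosonProj.toLinearMap N.bosonProj.toLinearMap (comul (R := k) x) := by
  have : (Bialgebra.comulAlgHom k N.Boson).comp N.bosonProj =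
      (Algebra.TensorProduct.map N.bosonProj N.bosonProj).comp
        (Bialgebra.comulAlgHom k (free V).Boson) := by
    refine (free V).algHom_ext (fun i => ?_) (fun h => ?_) <;> simp
  exact DFunLike.congr_fun this x

theorem counit_bosonProj (x : (free V).Boson) : counit (R := k) (N.bosonProj x) =
    counit (R := k) x := by
  have : (Bialgebra.counitAlgHom k N.Boson).comp N.bosonProj =
      Bialgebra.counitAlgHom k (free V).Boson := by
    refine (free V).algHom_ext (fun i => ?_) (fun h => ?_) <;> simp
  exact DFunLike.congr_fun this x

end proj

end PreNichols

section pairing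

variable {k F G I : Type*} [Field k] [CommGroup F] [CommGroup G]

/-- The object `V` of diagonal type over `F`: `h ∈ F` acts on `v_i` by `τ₀(h, g_i)`, and `v_i` has
degree `f_i`. -/
def diagV (τ₀ : F →* G →* kˣ) (f : I → F) (g : I → G) : DiagYD k F I where
  char i := τ₀.flip (g i)
  deg := f

/-- The object `W` of diagonal type over `G`: `h ∈ G` acts on `w_i` by `τ₀(f_i, h)⁻¹`, and `w_i` has
degree `g_i`. -/
def diagW (τ₀ : F →* G →* kˣ) (f : I → F) (g : I → G) : DiagYD k G I where
  char i := (τ₀ (f i))⁻¹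
  deg := g

namespace SkewPairing

open Coalgebra WithConv LinearMap

variable {τ₀ : F →* G →* kˣ} {f : I → F} {g : I → G}
  (N : PreNichols (diagV τ₀ f g)) (R : PreNichols (diagV τ₀ f g)) (S : PreNichols (diagW τ₀ f g))

/-- The functional `τ(h, -)` for `h ∈ F`. -/
def phi (h : F) : WithConv (S.Boson →ₗ[k] k) := toConv (S.charHom (τ₀ h)).toLinearMap

/-- The representation whose upper right entry is the functional `τ(v_i, -)`. -/
def repW (i : I) : S.Boson →ₐ[k] Matrix (Fin 2) (Fin 2) k :=
  S.rep i 1 (τ₀ (f i)) (fun h => by simp [diagW])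

/-- The functional `τ(v_i, -)`. -/
def psi (i : I) : WithConv (S.Boson →ₗ[k] k) :=
  toConv (Matrix.entryLinearMap k k 0 1 ∘ₗ (repW S i).toLinearMap)

theorem phi_mul (h h' : F) : phi S (h * h') = phi S h * phi S h' := by
  have : S.charHom (τ₀ (h * h')) = (Algebra.TensorProduct.lift (S.charHom (τ₀ h))
      (S.charHom (τ₀ h')) fun _ _ => Commute.all _ _).comp (Bialgebra.comulAlgHom k S.Boson) := by
    refine S.algHom_ext (fun i => ?_) (fun x => ?_) <;> simp
  refine WithConv.ext (LinearMap.ext fun x => ?_)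
  refine (DFunLike.congr_fun this x).trans ?_
  change _ = (phi S h * phi S h') x
  rw [(ℛ k x).convMul_apply]
  simp [← (ℛ k x).eq, phi]

theorem phi_one : phi S 1 = 1 := by
  have : S.charHom (τ₀ 1) = Bialgebra.counitAlgHom k S.Boson := by
    refine S.algHom_ext (fun i => ?_) (fun x => ?_) <;> simp
  refine WithConv.ext (LinearMap.ext fun x => ?_)
  refine (DFunLike.congr_fun this x).trans ?_
  simp

theorem phi_mul_psi (h : F) (i : I) :
    phi S h * psi S i = (τ₀ h (g i) : k) • (psi S i * phi S h) := by
  classical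
  let c : S.Boson →ₐ[k] Matrix (Fin 2) (Fin 2) k :=
    (Algebra.ofId k _).comp (S.charHom (τ₀ h))
  have hc : ∀ x y, Commute (c x) (repW S i y) := fun x y => Algebra.commutes (S.charHom (τ₀ h) x) _
  let n1 := (Algebra.TensorProduct.lift c (repW S i) hc).comp (Bialgebra.comulAlgHom k S.Boson)
  let n2 := (Algebra.TensorProduct.lift (repW S i) c fun x y => (hc y x).symm).comp
    (Bialgebra.comulAlgHom k S.Boson)
  let D : Matrix (Fin 2) (Fin 2) k := !![(τ₀ h (g i) : k), 0; 0, 1]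
  have key : ∀ x, n1 x * D = D * n2 x := by
    intro x
    refine S.subalgebra_eq_top (S :=
      { carrier := {x | n1 x * D = D * n2 x}
        mul_mem' := fun {x y} hx hy => ?_
        add_mem' := fun {x y} hx hy => ?_
        algebraMap_mem' := fun r => ?_ }) (fun j => ?_) (fun h => ?_) x
    · change _ = _ at hx
      change _ = _ at hy
      change _ = _
      rw [map_mul, map_mul, mul_assoc, hy, ← mul_assoc, hx, mul_assoc]
    · change _ = _ at hx
      change _ = _ at hy
      change _ = _
      rw [map_add, map_add, add_mul, mul_add, hx, hy]
    · change _ = _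
      rw [AlgHom.commutes, AlgHom.commutes, Algebra.commutes]
    · change _ = _
      simp only [n1, n2, AlgHom.comp_apply, Bialgebra.comulAlgHom_apply, PreNichols.comul_gen,
        map_add, Algebra.TensorProduct.lift_tmul, map_one, c, PreNichols.charHom_gen,
        PreNichols.charHom_grp, map_zero, repW, PreNichols.rep_gen, PreNichols.rep_grp]
      by_cases hj : j = i
      · subst hj
        ext a b
        fin_cases a <;> fin_cases b <;> 
          simp [D, diagW, Matrix.mul_apply, Algebra.ofId_apply, Matrix.algebraMap_matrix_apply]
      · simp [hj]
    · change _ = _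
      simp only [n1, n2, AlgHom.comp_apply, Bialgebra.comulAlgHom_apply, PreNichols.comul_grp,
        Algebra.TensorProduct.lift_tmul, c,
        PreNichols.charHom_grp, repW, PreNichols.rep_grp]
      ext a b
      fin_cases a <;> fin_cases b <;> 
        simp [D, Matrix.mul_apply, Matrix.vecMul, dotProduct, Algebra.ofId_apply,
          Matrix.algebraMap_matrix_apply, mul_comm]
  ext x
  have h1 : n1 x = ∑ j ∈ (ℛ k x).index, c ((ℛ k x).left j) * repW S i ((ℛ k x).right j) := by
    simp [n1, ← (ℛ k x).eq]
  have h2 : n2 x = ∑ j ∈ (ℛ k x).index, repW S i ((ℛ k x).left j) * c ((ℛ k x).right j) := by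
    simp [n2, ← (ℛ k x).eq]
  have h3 := congrFun (congrFun (key x) 0) 1
  rw [h1, h2] at h3
  change (phi S h * psi S i) x = (τ₀ h (g i) : k) • (psi S i * phi S h) x
  rw [(ℛ k x).convMul_apply, (ℛ k x).convMul_apply]
  simpa [D, Matrix.mul_apply, Matrix.sum_apply, phi, psi, c, Algebra.ofId_apply,
    Matrix.algebraMap_matrix_apply, Finset.mul_sum] using h3

section general

variable (Θ : N.Boson →ₐ[k] WithConv (S.Boson →ₗ[k] k))

theorem map_mul_eq_sum (b c : N.Boson) (h : S.Boson) : Θ (b * c) h =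
    LinearMap.mul' k k (TensorProduct.map (Θ b).ofConv (Θ c).ofConv (comul h)) := by
  rw [map_mul]; rfl

/-- The form of a pairing. -/
def formOf : N.Boson →ₗ[k] S.Boson →ₗ[k] k :=
  (WithConv.linearEquiv k (S.Boson →ₗ[k] k)).toLinearMap ∘ₗ Θ.toLinearMap

theorem map_mul_right (h1 : ∀ i, Θ (N.gen i) = psi S i) (h2 : ∀ h, Θ (N.grp h) = phi S h)
    (b : N.Boson) (h l : S.Boson) : formOf N S Θ b (h * l) =
    LinearMap.mul' k k (TensorProduct.map ((formOf N S Θ).flip l) ((formOf N S Θ).flip h)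
      (comul b)) := by
  classical
  have hphi : ∀ (x : F) (h : S.Boson), formOf N S Θ (N.grp x) h = S.charHom (τ₀ x) h := by
    intro x h
    change Θ (N.grp x) h = _
    rw [h2]; rfl
  have hpsi : ∀ (i : I) (h : S.Boson), formOf N S Θ (N.gen i) h = repW S i h 0 1 := by
    intro x h
    change Θ (N.gen x) h = _
    rw [h1]; rfl
  have hone : ∀ h : S.Boson, formOf N S Θ 1 h = counit (R := k) h := by
    intro h
    change Θ 1 h = _
    rw [map_one]; simp
  have hchar : ∀ h : S.Boson, S.charHom 1 h = counit (R := k) h := by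
    intro h
    rw [← hone, ← map_one N.grp, hphi, map_one]
  revert h l
  refine N.subalgebra_eq_top (S :=
    { carrier := {b | ∀ h l, formOf N S Θ b (h * l) =
        LinearMap.mul' k k (TensorProduct.map ((formOf N S Θ).flip l) ((formOf N S Θ).flip h)
          (comul b))}
      mul_mem' := fun {x y} hx hy h l => ?_
      add_mem' := fun {x y} hx hy h l => ?_
      algebraMap_mem' := fun r h l => ?_ }) (fun j h l => ?_) (fun x h l => ?_) b
  · have e : ∀ (x y : N.Boson) (h : S.Boson), formOf N S Θ (x * y) h =
        ∑ i ∈ (ℛ k h).index, formOf N S Θ x ((ℛ k h).left i) *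
          formOf N S Θ y ((ℛ k h).right i) := by
      intro x y h
      refine (map_mul_eq_sum N S Θ x y h).trans ?_
      rw [← (ℛ k h).eq]
      simp [formOf]
    have e' : formOf N S Θ (x * y) (h * l) = ∑ i ∈ (ℛ k h).index, ∑ j ∈ (ℛ k l).index,
        formOf N S Θ x ((ℛ k h).left i * (ℛ k l).left j) *
          formOf N S Θ y ((ℛ k h).right i * (ℛ k l).right j) := by
      refine (map_mul_eq_sum N S Θ x y (h * l)).trans ?_
      rw [Bialgebra.comul_mul, ← (ℛ k h).eq, ← (ℛ k l).eq]
      simp [formOf, Finset.sum_mul_sum]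
    have hx' : ∀ h l, formOf N S Θ x (h * l) = ∑ i ∈ (ℛ k x).index,
        formOf N S Θ ((ℛ k x).left i) l * formOf N S Θ ((ℛ k x).right i) h := by
      intro h l
      rw [hx, ← (ℛ k x).eq]; simp
    have hy' : ∀ h l, formOf N S Θ y (h * l) = ∑ i ∈ (ℛ k y).index,
        formOf N S Θ ((ℛ k y).left i) l * formOf N S Θ ((ℛ k y).right i) h := by
      intro h l
      rw [hy, ← (ℛ k y).eq]; simp
    rw [e', Bialgebra.comul_mul, ← (ℛ k x).eq, ← (ℛ k y).eq]
    simp only [hx', hy', Finset.sum_mul_sum, map_sum, Algebra.TensorProduct.tmul_mul_tmul,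
      TensorProduct.map_tmul, LinearMap.mul'_apply, LinearMap.flip_apply, e]
    have swap : ∀ t : (_ → _ → _ → _ → k), ∑ i ∈ (ℛ k h).index, ∑ j ∈ (ℛ k l).index,
        ∑ a ∈ (ℛ k x).index, ∑ b ∈ (ℛ k y).index, t i j a b =
        ∑ a ∈ (ℛ k x).index, ∑ b ∈ (ℛ k y).index, ∑ j ∈ (ℛ k l).index,
          ∑ i ∈ (ℛ k h).index, t i j a b := by
      intro t
      rw [Finset.sum_comm, Finset.sum_congr rfl fun _ _ => Finset.sum_comm, Finset.sum_comm]
      refine Finset.sum_congr rfl fun _ _ => ?_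
      rw [Finset.sum_congr rfl fun _ _ => Finset.sum_comm, Finset.sum_comm]
    rw [swap]
    refine Finset.sum_congr rfl fun _ _ => Finset.sum_congr rfl fun _ _ =>
      Finset.sum_congr rfl fun _ _ => Finset.sum_congr rfl fun _ _ => by ring
  · rw [map_add, map_add, map_add, map_add, LinearMap.add_apply, hx, hy]
  · simp [Algebra.algebraMap_eq_smul_one, hone, Algebra.TensorProduct.one_def]
    exact Or.inl (mul_comm _ _)
  · rw [hpsi, map_mul, Matrix.mul_apply, PreNichols.comul_gen]
    simp [hpsi, hphi, hone]
    have e : ∀ x, repW S j x 0 0 = counit (R := k) x ∧ repW S j x 1 1 = S.charHom (τ₀ (f j)) x := by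
      intro x
      rw [repW, PreNichols.rep_apply, ← hchar]
      simp
    rw [(e h).1, (e l).2]
    simp only [diagV]
    ring
  · simp [hphi, mul_comm]

end general

theorem phi_psi_comm (h : F) (i : I) : phi S h * psi S i =
    ((diagV τ₀ f g).char i h : k) • (psi S i * phi S h) := phi_mul_psi S h i

/-- The algebra map `T(V) → H^*` with `v_i ↦ τ(v_i, -)`. -/
def psiFree : FreeAlgebra k I →ₐ[k] WithConv (S.Boson →ₗ[k] k) := FreeAlgebra.lift k (psi S)

/-- The map `h ↦ τ(h, -)` on `F`. -/
def phiHom : F →* WithConv (S.Boson →ₗ[k] k) where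
  toFun := phi S
  map_one' := phi_one S
  map_mul' := phi_mul S

/-- The map `x ↦ τ(x, -)` on the bosonization of `T(V)`. -/
def freeMap : (PreNichols.free (diagV τ₀ f g)).Boson →ₐ[k] WithConv (S.Boson →ₗ[k] k) :=
  (PreNichols.free (diagV τ₀ f g)).lift (psiFree S) (phiHom S)
    (fun x hx => by rw [show x = 0 from hx, map_zero])
    (fun h i => by simpa [psiFree, phiHom] using phi_psi_comm S h i)

theorem freeMap_gen (i : I) : freeMap S ((PreNichols.free (diagV τ₀ f g)).gen i) = psi S i :=
  ((PreNichols.free (diagV τ₀ f g)).lift_gen _ _ _ _ i).trans (by simp [psiFree])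

theorem freeMap_grp (h : F) : freeMap S ((PreNichols.free (diagV τ₀ f g)).grp h) = phi S h :=
  (PreNichols.free (diagV τ₀ f g)).lift_grp _ _ _ _ h

theorem freeMap_eq_zero (x : (PreNichols.free (diagV τ₀ f g)).Boson) (hx : R.bosonProj x = 0) :
    freeMap S x = 0 := by
  classical
  let A := PreNichols.free (diagV τ₀ f g)
  let t := formOf A S (freeMap S)
  have pgen : ∀ i, R.bosonProj (A.gen i) = R.gen i := R.bosonProj_gen
  have pgrp : ∀ h, R.bosonProj (A.grp h) = R.grp h := R.bosonProj_grp
  have tphi : ∀ (x : F) (h : S.Boson), t (A.grp x) h = S.charHom (τ₀ x) h := by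
    intro x h
    change freeMap S (A.grp x) h = _
    rw [freeMap_grp]; rfl
  have tpsi : ∀ (i : I) (h : S.Boson), t (A.gen i) h = repW S i h 0 1 := by
    intro x h
    change freeMap S (A.gen x) h = _
    rw [freeMap_gen]; rfl
  have tone : ∀ h : S.Boson, t 1 h = counit (R := k) h := by
    intro h
    change freeMap S 1 h = _
    rw [map_one]; simp
  have tmul : ∀ (x y : A.Boson) (h : S.Boson), t (x * y) h =
      LinearMap.mul' k k (TensorProduct.map (t x) (t y) (comul h)) := map_mul_eq_sum A S (freeMap S)
  have tmulr := map_mul_right A S (freeMap S) (freeMap_gen S) (freeMap_grp S)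
  -- pairing with elements of the group
  have tgrp : ∀ (y : G) (x : A.Boson), t x (S.grp y) = R.charHom (τ₀.flip y) (R.bosonProj x) := by
    intro y x
    refine A.subalgebra_eq_top (S :=
      { carrier := {x | t x (S.grp y) = R.charHom (τ₀.flip y) (R.bosonProj x)}
        mul_mem' := fun {x x'} hx hx' => ?_
        add_mem' := fun {x x'} hx hx' => ?_
        algebraMap_mem' := fun r => ?_ }) (fun j => ?_) (fun h => ?_) x
    · change _ = _ at hx
      change _ = _ at hx'
      change _ = _
      rw [tmul, S.comul_grp]
      simp [hx, hx']
    · change _ = _ at hx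
      change _ = _ at hx'
      change _ = _
      simp [hx, hx']
    · change _ = _
      simp [Algebra.algebraMap_eq_smul_one, tone]
    · change _ = _
      simp [tpsi, pgen, repW, PreNichols.rep_grp]
    · change _ = _
      simp [tphi, pgrp]
  have hd : ∀ (j : I) (h : F), τ₀.flip (g j) h = (diagV τ₀ f g).char j h * (1 : F →* kˣ) h := by
    intro j h; simp [diagV]
  -- pairing with the generators
  have tgen : ∀ (j : I) (x : A.Boson),
      t x (S.gen j) = R.rep j (τ₀.flip (g j)) 1 (hd j) (R.bosonProj x) 0 1 := by
    intro j x
    refine A.subalgebra_eq_top (S :=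
      { carrier := {x | t x (S.gen j) = R.rep j (τ₀.flip (g j)) 1 (hd j) (R.bosonProj x) 0 1}
        mul_mem' := fun {x x'} hx hx' => ?_
        add_mem' := fun {x x'} hx hx' => ?_
        algebraMap_mem' := fun r => ?_ }) (fun i => ?_) (fun h => ?_) x
    · change _ = _ at hx
      change _ = _ at hx'
      change _ = _
      have hf : τ₀.flip 1 = 1 := by ext; simp
      have h0 := tgrp 1 x'
      rw [map_one S.grp, hf] at h0
      rw [tmul, S.comul_gen, map_mul, map_mul, Matrix.mul_apply, Fin.sum_univ_two, ← hx, ← hx',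
        R.rep_apply _ _ _ _ (R.bosonProj x), R.rep_apply _ _ _ _ (R.bosonProj x')]
      rw [map_add, map_add, TensorProduct.map_tmul, TensorProduct.map_tmul, LinearMap.mul'_apply,
        LinearMap.mul'_apply, h0, tgrp]
      simp only [diagW, Matrix.of_apply, Matrix.cons_val', Matrix.cons_val_zero,
        Matrix.cons_val_one, Matrix.cons_val_fin_one]
      ring
    · change _ = _ at hx
      change _ = _ at hx'
      change _ = _
      simp [hx, hx']
    · change _ = _
      simp [Algebra.algebraMap_eq_smul_one, tone]
    · change _ = _
      rw [tpsi, repW, PreNichols.rep_gen, pgen, PreNichols.rep_gen]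
      by_cases h : i = j
      · subst h; simp
      · simp [h, Ne.symm h]
    · change _ = _
      simp [tphi, pgrp, PreNichols.rep_grp]
  have key : ∀ h : S.Boson, ∀ x : A.Boson, R.bosonProj x = 0 → t x h = 0 := by
    intro h
    refine S.subalgebra_eq_top (S :=
      { carrier := {h | ∀ x : A.Boson, R.bosonProj x = 0 → t x h = 0}
        mul_mem' := fun {h l} hh hl x hx => ?_
        add_mem' := fun {h l} hh hl x hx => ?_
        algebraMap_mem' := fun r x hx => ?_ }) (fun j x hx => ?_) (fun y x hx => ?_) h
    · have hk : comul (R := k) x ∈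
          LinearMap.ker (TensorProduct.map R.bosonProj.toLinearMap R.bosonProj.toLinearMap) := by
        rw [LinearMap.mem_ker, ← R.comul_bosonProj, hx, map_zero]
      let K : LinearMap.ker R.bosonProj.toLinearMap →ₗ[k] A.Boson := Submodule.subtype _
      have hK : Function.Exact K R.bosonProj.toLinearMap := LinearMap.exact_subtype_ker_map _
      rw [TensorProduct.map_ker hK R.bosonProj_surjective hK R.bosonProj_surjective] at hk
      let T : A.Boson ⊗[k] A.Boson →ₗ[k] k :=
        LinearMap.mul' k k ∘ₗ TensorProduct.map (t.flip l) (t.flip h)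
      have e1 : T ∘ₗ LinearMap.lTensor _ K = 0 := by
        refine TensorProduct.ext' fun a b => ?_
        have : t (K b) h = 0 := hh _ b.2
        simp [T, this]
      have e2 : T ∘ₗ LinearMap.rTensor _ K = 0 := by
        refine TensorProduct.ext' fun a b => ?_
        have : t (K a) l = 0 := hl _ a.2
        simp [T, this]
      have h1 : t x (h * l) = T (comul x) := tmulr x h l
      rw [h1]
      obtain ⟨_, ⟨y, rfl⟩, _, ⟨z, rfl⟩, hyz⟩ := Submodule.mem_sup.1 hk
      rw [← hyz, map_add]
      have h2 := DFunLike.congr_fun e1 y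
      have h3 := DFunLike.congr_fun e2 z
      simp only [LinearMap.comp_apply, LinearMap.zero_apply] at h2 h3
      rw [h2, h3, add_zero]
    · rw [map_add, hh x hx, hl x hx, add_zero]
    · have h0 := tgrp 1 x
      rw [map_one S.grp, hx, map_zero] at h0
      simp [Algebra.algebraMap_eq_smul_one, h0]
    · rw [tgen, hx]; simp
    · rw [tgrp, hx, map_zero]
  exact WithConv.ext (LinearMap.ext fun h => key h x hx)

/-- The map `x ↦ τ(x, -)` on `B`. -/
def map : R.Boson →ₐ[k] WithConv (S.Boson →ₗ[k] k) :=
  R.lift (psiFree S) (phiHom S)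
    (fun x hx => by
      have h1 : (freeMap S) ((PreNichols.free (diagV τ₀ f g)).inclAlg
          ((PreNichols.free (diagV τ₀ f g)).proj x)) = psiFree S x :=
        (PreNichols.free (diagV τ₀ f g)).lift_inclAlg _ _ _ _ x
      rw [← h1]
      refine freeMap_eq_zero R S _ ?_
      refine ((PreNichols.free (diagV τ₀ f g)).lift_inclAlg _ _ _ _ x).trans ?_
      simp [R.proj_eq_zero.2 hx])
    (fun h i => by simpa [psiFree, phiHom] using phi_psi_comm S h i)

theorem map_gen (i : I) : map R S (R.gen i) = psi S i :=
  (R.lift_gen _ _ _ _ i).trans (by simp [psiFree])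

theorem map_grp (h : F) : map R S (R.grp h) = phi S h := R.lift_grp _ _ _ _ h

/-- The unique skew pairing `τ : B ⊗ H → k` with `τ(h, x) = τ₀(h, x)`, `τ(v_i, w_j) = δ_ij` and
`τ(h, w_j) = 0 = τ(v_i, x)` for `h ∈ F` and `x ∈ G`. -/
def tau : SkewPairing k R.Boson S.Boson where
  form := formOf R S (map R S)
  mul_left := map_mul_eq_sum R S (map R S)
  mul_right := map_mul_right R S (map R S) (map_gen R S) (map_grp R S)
  one_right b := by
    change map R S b 1 = counit (R := k) b
    have h := map_mul_eq_sum R S (map R S)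
    refine R.subalgebra_eq_top (S :=
      { carrier := {x | map R S x 1 = counit (R := k) x}
        mul_mem' := fun {x x'} hx hx' => ?_
        add_mem' := fun {x x'} hx hx' => ?_
        algebraMap_mem' := fun r => ?_ }) (fun j => ?_) (fun h => ?_) b
    · change _ = _ at hx
      change _ = _ at hx'
      change _ = _
      rw [h, Bialgebra.comul_one, Bialgebra.counit_mul, ← hx, ← hx', Algebra.TensorProduct.one_def]
      rfl
    · change _ = _ at hx
      change _ = _ at hx'
      change _ = _
      rw [map_add, map_add, ← hx, ← hx']; rfl
    · change _ = _
      rw [AlgHom.commutes]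
      simp [Algebra.algebraMap_eq_smul_one]
    · change _ = _
      rw [map_gen, R.counit_gen]
      simp [psi]
    · change _ = _
      rw [map_grp, R.counit_grp]
      simp [phi]
  one_left h := by
    change map R S 1 h = _
    rw [map_one]; simp

theorem tau_grp_grp (h : F) (x : G) : (tau R S).form (R.grp h) (S.grp x) = τ₀ h x := by
  change map R S (R.grp h) (S.grp x) = _
  rw [map_grp]; simp [phi]

theorem tau_gen_gen [DecidableEq I] (i j : I) :
    (tau R S).form (R.gen i) (S.gen j) = if i = j then 1 else 0 := by
  change map R S (R.gen i) (S.gen j) = _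
  rw [map_gen]
  by_cases h : i = j
  · subst h; simp [psi, repW, PreNichols.rep_gen]
  · simp [psi, repW, PreNichols.rep_gen, h, Ne.symm h]

theorem tau_grp_gen (h : F) (j : I) : (tau R S).form (R.grp h) (S.gen j) = 0 := by
  change map R S (R.grp h) (S.gen j) = _
  rw [map_grp]; simp [phi]

theorem tau_gen_grp (i : I) (x : G) : (tau R S).form (R.gen i) (S.grp x) = 0 := by
  change map R S (R.gen i) (S.grp x) = _
  rw [map_gen]; simp [psi, repW, PreNichols.rep_grp]

end SkewPairing

end pairing

/-- The deformed product of two grouplike elements is the original one. -/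
theorem TwoCocycle.mul_of_isGroupLikeElem {k A : Type*} [Field k] [Ring A] [Bialgebra k A]
    (σ : TwoCocycle k A) {x y : A} (hx : IsGroupLikeElem k x) (hy : IsGroupLikeElem k y) :
    σ.mul (x ⊗ₜ y) = x * y := by
  have hc : Coalgebra.comul (R := k) (x ⊗ₜ[k] y) = (x ⊗ₜ y) ⊗ₜ (x ⊗ₜ y) := by
    rw [TensorProduct.comul_tmul, hx.comul_eq_tmul_self, hy.comul_eq_tmul_self]; rfl
  have h1 := congrArg (fun t : WithConv (A ⊗[k] A →ₗ[k] k) => t (x ⊗ₜ y)) σ.form_mul_inv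
  simp only [LinearMap.convMul_apply, hc] at h1
  simp only [TensorProduct.map_tmul, LinearMap.mul'_apply, LinearMap.convOne_apply,
    TensorProduct.counit_tmul, hx.counit_eq_one, hy.counit_eq_one] at h1
  change (scal A σ.form * WithConv.toConv (LinearMap.mul' k A) * scal A σ.inv) (x ⊗ₜ y) = _
  simp only [LinearMap.convMul_apply, hc, TensorProduct.map_tmul, LinearMap.mul'_apply]
  simp only [scal, LinearMap.comp_apply, Algebra.linearMap_apply]
  rw [← Algebra.commutes, ← mul_assoc, ← map_mul, mul_comm, h1]
  simp

namespace PreNichols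

variable {k F I : Type*} [Field k] [CommGroup F] {V : DiagYD k F I} (N : PreNichols V)

theorem isGroupLikeElem_grp (h : F) : IsGroupLikeElem k (N.grp h) :=
  ⟨N.counit_grp h, N.comul_grp h⟩

end PreNichols

section double

variable {k F G I : Type*} [Field k] [CommGroup F] [CommGroup G]
  (τ₀ : F →* G →* kˣ) (f : I → F) (g : I → G)

/-- The subgroup `C = {(x, y) | τ₀(x, g_i) τ₀(f_i, y) = 1 for all i}` of `F × G`. -/
def centralSubgroup : Subgroup (F × G) where
  carrier := {c | ∀ i, τ₀ c.1 (g i) * τ₀ (f i) c.2 = 1}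
  one_mem' i := by simp
  mul_mem' {c d} hc hd i := by
    simp only [Prod.fst_mul, Prod.snd_mul, map_mul, MonoidHom.mul_apply]
    rw [mul_mul_mul_comm, hc i, hd i, mul_one]
  inv_mem' {c} hc i := by
    simp only [Prod.fst_inv, Prod.snd_inv, map_inv, MonoidHom.inv_apply]
    rw [← mul_inv, hc i, inv_one]

/-- The subgroup `P` of `F × G` generated by the `(f_i, g_i)`. -/
def pairSubgroup : Subgroup (F × G) := Subgroup.closure (Set.range fun i => (f i, g i))

/-- The natural map `C → (F × G)/P`. -/
def natMap : centralSubgroup τ₀ f g →* (F × G) ⧸ pairSubgroup f g :=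
  (QuotientGroup.mk' (pairSubgroup f g)).comp (centralSubgroup τ₀ f g).subtype

/-- The product map `C × P → F × G`. -/
def prodMap : centralSubgroup τ₀ f g × pairSubgroup f g →* F × G :=
  (centralSubgroup τ₀ f g).subtype.coprod (pairSubgroup f g).subtype

variable {τ₀ f g} (R : PreNichols (diagV τ₀ f g)) (S : PreNichols (diagW τ₀ f g))

/-- The Hopf algebra `𝒟 = B ⋈_τ H`, where `B = R ⋊ F` and `H = S ⋊ G`. -/
abbrev GenDouble : Type _ := (SkewPairing.tau R S).Double

namespace GenDouble

/-- The element of `B ⊗ H` defined by an element of `F × G`. -/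
theorem isGroupLikeElem_tmul (c : F × G) :
    IsGroupLikeElem k (R.grp c.1 ⊗ₜ[k] S.grp c.2) where
  counit_eq_one := by simp
  comul_eq_tmul_self := by
    rw [TensorProduct.comul_tmul, R.comul_grp, S.comul_grp]; rfl

/-- The embedding of `F × G` in `𝒟`, with `(x, y) ↦ x ⊗ y`. -/
def grp : F × G →* GenDouble R S where
  toFun c := TwoCocycle.Deform.of _ (R.grp c.1 ⊗ₜ[k] S.grp c.2)
  map_one' := by
    rw [Prod.fst_one, Prod.snd_one, map_one, map_one]; rfl
  map_mul' c d := by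
    rw [TwoCocycle.Deform.of_mul_of, TwoCocycle.mul_of_isGroupLikeElem _
      (isGroupLikeElem_tmul R S c) (isGroupLikeElem_tmul R S d)]
    simp

theorem isGroupLikeElem_grp (c : F × G) : IsGroupLikeElem k (grp R S c) :=
  (isGroupLikeElem_tmul R S c).map (TwoCocycle.Deform.of (SkewPairing.tau R S).cocycle)

/-- The inclusion `kC → 𝒟`, a map of Hopf algebras. -/
def incl : MonoidAlgebra k (centralSubgroup τ₀ f g) →ₐc[k] GenDouble R S :=
  BialgHom.ofAlgHom
    (MonoidAlgebra.lift k (GenDouble R S) _ ((grp R S).comp (centralSubgroup τ₀ f g).subtype))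
    (by
      ext c
      simpa using (isGroupLikeElem_grp R S c).counit_eq_one)
    (by
      ext c
      simpa using (isGroupLikeElem_grp R S c).comul_eq_tmul_self.symm)

/-- The quotient algebra `𝒟_c = 𝒟 / (c - 1 | c ∈ C)`. -/
abbrev Quot : Type _ :=
  RingQuot fun x y : GenDouble R S => ∃ c ∈ centralSubgroup τ₀ f g, x = grp R S c ∧ y = 1

end GenDouble

end double

end

/-! On `E = F × G` put the symmetric form `β((x, y), (x', y')) = τ₀(x', y) τ₀(x, y')`. It is
non-degenerate because `τ₀` is, and `C` is exactly the orthogonal complement of `P`. Dedekind's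
independence of characters bounds the number of characters `Q → kˣ` of a finite group by `|Q|`.
Since `β` supplies characters, this bound is enough to prove `|C| |P| = |E|`, with no assumption
about roots of unity in `k` (`card_orthogonalSubgroup_mul_card`). So `C` and `E/P` have the same
order, as do `C × P` and `E`, and each of the seven group conditions says that `C ∩ P` is trivial.

The Hopf-theoretic conditions rest on a description of the algebra maps from `𝒟` to a commutative
algebra `A`. The group `E` acts on `v_i` by the character `β(-, (f_i, g_i))` and on `w_i` by its
inverse. If `(f_i, g_i) ≠ 1`, this character is non-trivial, so a map to `A` kills `v_i` and `w_i`.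
The relation `w_i v_i + f_i g_i = 1 + τ₀(f_i, g_i) v_i w_i` then forces `f_i g_i ↦ 1`
(`map_grp_eq_one`). Conversely every homomorphism `E → A` that is trivial on the `(f_i, g_i)`
extends to `𝒟` by `v_i, w_i ↦ 0` (`aug`). As the defining relations of `R` and `S` are arbitrary,
this extension is not checked on a presentation of `𝒟`. Instead, the functional `a ⊗ b` on `B ⊗ H`
is shown to commute with `τ` under convolution (`conv_mul_augTensor`), which makes it multiplicative
for the deformed product.

If `C → E/P` splits, the splitting gives `ρ : E → C` which is trivial on `P` and the identity on
`C`. Its extension is a Hopf retraction `π : 𝒟 → kC`. As `kC` is central, `x ↦ π(x₂) ⊗ x₁` is an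
algebra map `𝒟 → kC ⊗ 𝒟_c`, with inverse `z ⊗ x ↦ z x₁ S(π(x₂))` (`splitEquiv`). Conversely, a Hopf
retraction fixes the elements of `C` and sends those of `P` to `1`, so `C ∩ P = 1`. An abstract
algebra isomorphism in (c) carries no such information, and characters are counted instead: `𝒟` has
at most `|E/P| = |C|` of them, while `kC ⊗ 𝒟_c` has at least `|C| |C ∩ P|`
(`inf_eq_bot_of_algEquiv`). -/

noncomputable section

/-! ### Characters of finite groups over an arbitrary field -/

section characters

/-- Distinct characters are linearly independent in the finite-dimensional space of functions `Q →
k` (Dedekind). -/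
instance finite_monoidHom_units {k Q : Type*} [Field k] [Monoid Q] [Finite Q] :
    Finite (Q →* kˣ) := by
  have := Fintype.ofFinite Q
  have h := (linearIndependent_monoidHom Q k).comp (fun a : Q →* kˣ => (Units.coeHom k).comp a)
    fun a b hab => MonoidHom.ext fun x => Units.ext (DFunLike.congr_fun hab x)
  exact h.finite

theorem card_monoidHom_units_le (k Q : Type*) [Field k] [Monoid Q] [Finite Q] :
    Nat.card (Q →* kˣ) ≤ Nat.card Q := by
  have := Fintype.ofFinite Q
  have h := (linearIndependent_monoidHom Q k).comp (fun a : Q →* kˣ => (Units.coeHom k).comp a)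
    fun a b hab => MonoidHom.ext fun x => Units.ext (DFunLike.congr_fun hab x)
  have := Fintype.ofFinite (Q →* kˣ)
  simpa [Nat.card_eq_fintype_card] using h.fintype_card_le_finrank

variable {k E : Type*} [Field k] [CommGroup E]

/-- The subgroup orthogonal to `Q` with respect to a pairing. -/
def orthogonalSubgroup (β : E →* E →* kˣ) (Q : Subgroup E) : Subgroup E :=
  ((MonoidHom.compHom' Q.subtype).comp β).ker

theorem mem_orthogonalSubgroup {β : E →* E →* kˣ} {Q : Subgroup E} {e : E} :
    e ∈ orthogonalSubgroup β Q ↔ ∀ q ∈ Q, β e q = 1 := by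
  simp [orthogonalSubgroup, MonoidHom.mem_ker, MonoidHom.ext_iff]

/-- Two embeddings give the two inequalities. The complement of `Q` embeds in the characters of
`E/Q`, and the quotient of `E` by that complement embeds in the characters of `Q`; Dedekind's bound
applies to both. Usually such a count needs `k` to contain enough roots of unity, but here the
injectivity of `β` replaces this. -/
theorem card_orthogonalSubgroup_mul_card [Finite E] (β : E →* E →* kˣ)
    (hβ : Function.Injective β) (Q : Subgroup E) :
    Nat.card (orthogonalSubgroup β Q) * Nat.card Q = Nat.card E := by
  refine le_antisymm ?_ ?_
  · have h : Nat.card (orthogonalSubgroup β Q) ≤ Nat.card (E ⧸ Q) := by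
      refine le_trans (Nat.card_le_card_of_injective (fun e : orthogonalSubgroup β Q =>
        QuotientGroup.lift Q (β e) fun q hq => mem_orthogonalSubgroup.1 e.2 q hq)
        fun a b hab => Subtype.ext (hβ (MonoidHom.ext fun x =>
          DFunLike.congr_fun hab (x : E ⧸ Q)))) (card_monoidHom_units_le k _)
    rw [Q.card_eq_card_quotient_mul_card_subgroup]
    exact Nat.mul_le_mul_right _ h
  · rw [← Subgroup.card_mul_index (orthogonalSubgroup β Q)]
    refine Nat.mul_le_mul_left _ ?_
    -- The index of the kernel is the number of characters of `Q` of the form `β e` restricted to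
    -- `Q`.
    rw [orthogonalSubgroup, Subgroup.index_ker]
    exact (Nat.card_le_card_of_injective _ Subtype.val_injective).trans
      (card_monoidHom_units_le k Q)

/-- A subgroup of a group which is paired with itself without degeneracy has as many characters as
elements. -/
theorem card_monoidHom_units_subgroup [Finite E] (β : E →* E →* kˣ)
    (hβ : Function.Injective β) (Q : Subgroup E) : Nat.card (Q →* kˣ) = Nat.card Q := by
  refine le_antisymm (card_monoidHom_units_le k Q) ?_
  have h := card_orthogonalSubgroup_mul_card β hβ Q
  rw [← Subgroup.card_mul_index (orthogonalSubgroup β Q)] at h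
  -- The index of the complement equals `|Q|`, and it counts the characters of `Q` that come from
  -- `β`; so these already number `|Q|`.
  rw [Nat.eq_of_mul_eq_mul_left Nat.card_pos h, orthogonalSubgroup, Subgroup.index_ker]
  exact Nat.card_le_card_of_injective _ Subtype.val_injective

end characters

/-! ### The form on `F × G` and the group-theoretic conditions -/

section groups

variable {k F G I : Type*} [Field k] [CommGroup F] [CommGroup G]
  (τ₀ : F →* G →* kˣ) (f : I → F) (g : I → G)

/-- Non-degeneracy embeds `F` in the characters of `G`. Applied also to `τ₀.flip`, this yields
finiteness of both groups and equality of their orders. -/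
theorem card_le_of_pairing [Finite G] (hleft : ∀ x, (∀ y, τ₀ x y = 1) → x = 1) :
    Finite F ∧ Nat.card F ≤ Nat.card G := by
  have h : Function.Injective τ₀ := (injective_iff_map_eq_one τ₀).2 fun x hx =>
    hleft x fun y => by simp [hx]
  exact ⟨Finite.of_injective _ h, (Nat.card_le_card_of_injective _ h).trans
    (card_monoidHom_units_le k G)⟩

/-- The pairing of `F × G` with itself defined by a pairing of `F` and `G`. -/
def sqPairing : F × G →* F × G →* kˣ :=
  MonoidHom.mk' (fun e => (τ₀.flip e.2).coprod (τ₀ e.1)) fun a b =>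
    MonoidHom.ext fun c => by simp [mul_mul_mul_comm]

@[simp] theorem sqPairing_apply (e e' : F × G) :
    sqPairing τ₀ e e' = τ₀ e'.1 e.2 * τ₀ e.1 e'.2 := rfl

theorem sqPairing_comm (e e' : F × G) : sqPairing τ₀ e e' = sqPairing τ₀ e' e := by
  simp [mul_comm]

/-- Testing against `(1, y)` and `(x, 1)` separates the two components, so the two one-sided
non-degeneracies suffice. -/
theorem sqPairing_injective (hleft : ∀ x, (∀ y, τ₀ x y = 1) → x = 1)
    (hright : ∀ y, (∀ x, τ₀ x y = 1) → y = 1) : Function.Injective (sqPairing τ₀) :=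
  (injective_iff_map_eq_one _).2 fun e he => Prod.ext
    (hleft _ fun y => by simpa using DFunLike.congr_fun he (1, y))
    (hright _ fun x => by simpa using DFunLike.congr_fun he (x, 1))

/-- Orthogonality to `P` need only be tested on the generators `(f_i, g_i)`, where it is the
defining condition of `C`. This turns the counting lemma into `|C| |P| = |F × G|`. -/
theorem orthogonalSubgroup_pairSubgroup :
    orthogonalSubgroup (sqPairing τ₀) (pairSubgroup f g) = centralSubgroup τ₀ f g := by
  ext c
  rw [mem_orthogonalSubgroup]
  have h : (pairSubgroup f g ≤ (sqPairing τ₀ c).ker) ↔ c ∈ centralSubgroup τ₀ f g := by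
    rw [pairSubgroup, Subgroup.closure_le]
    refine Set.range_subset_iff.trans (forall_congr' fun i => ?_)
    change sqPairing τ₀ c (f i, g i) = 1 ↔ _
    rw [sqPairing_apply, mul_comm]
  exact h

theorem natMap_injective_iff : Function.Injective (natMap τ₀ f g) ↔
    ∀ c ∈ centralSubgroup τ₀ f g, c ∈ pairSubgroup f g → c = 1 := by
  rw [injective_iff_map_eq_one]
  constructor
  · intro h c hc hp
    exact congrArg Subtype.val (h ⟨c, hc⟩ ((QuotientGroup.eq_one_iff _).2 hp))
  · intro h c hc
    exact Subtype.ext (h c c.2 ((QuotientGroup.eq_one_iff _).1 hc))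

/-- Both kernels are copies of `C ∩ P`: that of the product map consists of the pairs `(c, c⁻¹)`
with `c ∈ C ∩ P`. -/
theorem prodMap_injective_iff : Function.Injective (prodMap τ₀ f g) ↔
    Function.Injective (natMap τ₀ f g) := by
  rw [natMap_injective_iff, injective_iff_map_eq_one]
  constructor
  · intro h c hc hp
    have := h (⟨c, hc⟩, ⟨c, hp⟩⁻¹) (by simp [prodMap])
    exact congrArg (fun x => (x.1 : F × G)) this
  · rintro h ⟨⟨c, hc⟩, ⟨p, hp⟩⟩ hcp
    have hcp' : c * p = 1 := hcp
    have h1 := h c hc (by rw [mul_eq_one_iff_eq_inv.1 hcp']; exact inv_mem hp)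
    subst h1
    have h2 : p = 1 := by simpa using hcp'
    subst h2
    rfl

variable {τ₀} in
-- By `hcard`, source and target have equal finite order for both maps, so injective, surjective and
-- bijective coincide for each. The inverse of a bijective natural map is a splitting.
theorem group_conditions_tfae [Finite F] [Finite G]
    (hcard : Nat.card (centralSubgroup τ₀ f g) * Nat.card (pairSubgroup f g) =
      Nat.card (F × G)) :
    [∃ r : (F × G) ⧸ pairSubgroup f g →* centralSubgroup τ₀ f g,
        r.comp (natMap τ₀ f g) = MonoidHom.id (centralSubgroup τ₀ f g),
      Function.Injective (natMap τ₀ f g),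
      Function.Surjective (natMap τ₀ f g),
      Function.Bijective (natMap τ₀ f g),
      Function.Injective (prodMap τ₀ f g),
      Function.Surjective (prodMap τ₀ f g),
      Function.Bijective (prodMap τ₀ f g)].TFAE := by
  have h1 : Nat.card (centralSubgroup τ₀ f g) = Nat.card ((F × G) ⧸ pairSubgroup f g) := by
    rw [Subgroup.card_eq_card_quotient_mul_card_subgroup (pairSubgroup f g)] at hcard
    exact Nat.eq_of_mul_eq_mul_right Nat.card_pos hcard
  have h2 : Nat.card (centralSubgroup τ₀ f g × pairSubgroup f g) = Nat.card (F × G) := by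
    rw [Nat.card_prod, hcard]
  tfae_have 1 → 2 := fun ⟨r, hr⟩ =>
    Function.LeftInverse.injective (g := r) fun c => DFunLike.congr_fun hr c
  tfae_have 2 → 4 := fun h => (Nat.bijective_iff_injective_and_card _).2 ⟨h, h1⟩
  tfae_have 4 → 3 := fun h => h.2
  tfae_have 3 → 4 := fun h => (Nat.bijective_iff_surjective_and_card _).2 ⟨h, h1⟩
  tfae_have 4 → 1 := fun h => ⟨(MulEquiv.ofBijective _ h).symm,
    MonoidHom.ext fun c => (MulEquiv.ofBijective _ h).symm_apply_apply c⟩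
  tfae_have 2 ↔ 5 := (prodMap_injective_iff τ₀ f g).symm
  tfae_have 5 → 7 := fun h => (Nat.bijective_iff_injective_and_card _).2 ⟨h, h2⟩
  tfae_have 7 → 6 := fun h => h.2
  tfae_have 6 → 7 := fun h => (Nat.bijective_iff_surjective_and_card _).2 ⟨h, h2⟩
  tfae_have 7 → 5 := fun h => h.1
  tfae_finish

end groups
-- The two factors of the double and the exchange relation
namespace TwoCocycle

open Coalgebra WithConv LinearMap

variable {k A X : Type*} [Field k] [Ring A] [Bialgebra k A] [AddCommGroup X] [Module k X]
  [Coalgebra k X] (σ : TwoCocycle k A)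

/-- The deformed product agrees with the original one along a coalgebra map on which the cocycle
is trivial. -/
theorem mul_eq_of_pull_eq_one (u : X →ₗc[k] A ⊗[k] A) (h : pull u σ.form = 1) (x : X) :
    σ.mul (u x) = LinearMap.mul' k A (u x) := by
  have h' : pull u σ.inv = 1 := by
    have := pull_inv u σ.form_mul_inv
    rwa [h, one_mul] at this
  have e : pull u (scal A σ.form * toConv (LinearMap.mul' k A) * scal A σ.inv) =
      pull u (toConv (LinearMap.mul' k A)) := by
    rw [pull_mul, pull_mul, pull_scal, pull_scal, h, h', scal_one, one_mul, mul_one]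
  exact congrArg (fun Y : WithConv (X →ₗ[k] A) => Y x) e

/-- `(x₁ · y₁) σ(x₂, y₂) = σ(x₁, y₁) x₂ y₂`. -/
theorem mul_mul_form : toConv σ.mul * scal A σ.form =
    scal A σ.form * toConv (LinearMap.mul' k A) := by
  change scal A σ.form * toConv (LinearMap.mul' k A) * scal A σ.inv * scal A σ.form = _
  rw [mul_assoc, ← scal_mul, σ.inv_mul_form, scal_one, mul_one]

end TwoCocycle

namespace SkewPairing

open Coalgebra WithConv LinearMap TwoCocycle

section general

variable {k B H : Type*} [Field k] [Ring B] [HopfAlgebra k B] [Ring H] [HopfAlgebra k H]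
  (τ : SkewPairing k B H)

/-- The coalgebra map `b ↦ b ⊗ 1`. -/
def left (k B H : Type*) [Field k] [Ring B] [HopfAlgebra k B] [Ring H] [HopfAlgebra k H] :
    B →ₗc[k] B ⊗[k] H where
  __ := (TensorProduct.mk k B H).flip 1
  counit_comp := by ext; simp
  map_comp_comul := by
    ext x
    simp [Algebra.TensorProduct.one_def, ← (ℛ k x).eq, TensorProduct.sum_tmul]

/-- The coalgebra map `h ↦ 1 ⊗ h`. -/
def right (k B H : Type*) [Field k] [Ring B] [HopfAlgebra k B] [Ring H] [HopfAlgebra k H] :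
    H →ₗc[k] B ⊗[k] H where
  __ := TensorProduct.mk k B H 1
  counit_comp := by ext; simp
  map_comp_comul := by
    ext x
    simp [Algebra.TensorProduct.one_def, ← (ℛ k x).eq, TensorProduct.tmul_sum]

theorem left_apply (b : B) : left k B H b = b ⊗ₜ 1 := rfl
theorem right_apply (h : H) : right k B H h = 1 ⊗ₜ h := rfl

/-- Since `τ(c, 1) = ε(c)`, the cocycle is trivial on pairs `(b ⊗ 1, c ⊗ l)`, and the product is not
deformed there. The mirror statement follows in the same way from `τ(1, h) = ε(h)`; together they
make `B` and `H` subalgebras with `b · h = b ⊗ h`. -/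
theorem mul_tmul_one_left (b c : B) (l : H) :
    τ.cocycle.mul ((b ⊗ₜ 1) ⊗ₜ (c ⊗ₜ l)) = (b * c) ⊗ₜ l := by
  have h := τ.cocycle.mul_eq_of_pull_eq_one
    (Coalgebra.TensorProduct.map (left k B H) (CoalgHom.id k (B ⊗[k] H))) (by
      ext b c l
      refine (τ.cocycleForm_tmul b c 1 l).trans ?_
      simp [τ.one_right, mul_comm, mul_assoc]) (b ⊗ₜ (c ⊗ₜ l))
  exact h.trans (by simp [left_apply])

theorem mul_one_tmul_right (b : B) (h l : H) :
    τ.cocycle.mul ((b ⊗ₜ h) ⊗ₜ (1 ⊗ₜ l)) = b ⊗ₜ (h * l) := by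
  have h := τ.cocycle.mul_eq_of_pull_eq_one
    (Coalgebra.TensorProduct.map (CoalgHom.id k (B ⊗[k] H)) (right k B H)) (by
      ext b h l
      refine (τ.cocycleForm_tmul b 1 h l).trans ?_
      simp [τ.one_left, mul_comm]) ((b ⊗ₜ h) ⊗ₜ l)
  exact h.trans (by simp [right_apply])

/-- The embedding of `B` in the double. -/
def inl : B →ₐ[k] τ.Double :=
  AlgHom.ofLinearMap ((Deform.of τ.cocycle).toLinearEquiv.toLinearMap ∘ₗ
    (left k B H).toLinearMap) rfl fun b c =>
      (congrArg (Deform.of τ.cocycle) (τ.mul_tmul_one_left b c 1)).symm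

/-- The embedding of `H` in the double. -/
def inr : H →ₐ[k] τ.Double :=
  AlgHom.ofLinearMap ((Deform.of τ.cocycle).toLinearEquiv.toLinearMap ∘ₗ
    (right k B H).toLinearMap) rfl fun h l =>
      (congrArg (Deform.of τ.cocycle) (τ.mul_one_tmul_right 1 h l)).symm

theorem inl_apply (b : B) : τ.inl b = Deform.of τ.cocycle (b ⊗ₜ 1) := rfl
theorem inr_apply (h : H) : τ.inr h = Deform.of τ.cocycle (1 ⊗ₜ h) := rfl

theorem inl_mul_inr (b : B) (h : H) : τ.inl b * τ.inr h = Deform.of τ.cocycle (b ⊗ₜ h) := by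
  rw [inl_apply, inr_apply, Deform.of_mul_of, mul_tmul_one_left, mul_one]

theorem comul_inl (b : B) : comul (R := k) (τ.inl b) =
    TensorProduct.map τ.inl.toLinearMap τ.inl.toLinearMap (comul (R := k) b) := by
  have h := CoalgHomClass.map_comp_comul_apply
    ((Deform.of τ.cocycle).toCoalgHom.comp (left k B H)) b
  exact h.symm

theorem comul_inr (h : H) : comul (R := k) (τ.inr h) =
    TensorProduct.map τ.inr.toLinearMap τ.inr.toLinearMap (comul (R := k) h) := by
  have h := CoalgHomClass.map_comp_comul_apply
    ((Deform.of τ.cocycle).toCoalgHom.comp (right k B H)) h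
  exact h.symm

theorem counit_inl (b : B) : counit (R := k) (τ.inl b) = counit (R := k) b :=
  CoalgHomClass.counit_comp_apply (left k B H) b

theorem counit_inr (h : H) : counit (R := k) (τ.inr h) = counit (R := k) h :=
  CoalgHomClass.counit_comp_apply (right k B H) h

@[elab_as_elim]
theorem double_induction {τ : SkewPairing k B H} {p : τ.Double → Prop}
    (add : ∀ x y, p x → p y → p (x + y)) (mul : ∀ b h, p (τ.inl b * τ.inr h)) (x : τ.Double) :
    p x := by
  obtain ⟨x, rfl⟩ := EquivLike.surjective (Deform.of τ.cocycle) x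
  induction x with
  | zero => simpa using mul 0 0
  | add a b ha hb => simpa only [map_add] using add _ _ ha hb
  | tmul b h => simpa only [inl_mul_inr] using mul b h

variable {τ} in
theorem double_algHom_ext {A : Type*} [Semiring A] [Algebra k A] {φ ψ : τ.Double →ₐ[k] A}
    (h1 : φ.comp τ.inl = ψ.comp τ.inl) (h2 : φ.comp τ.inr = ψ.comp τ.inr) : φ = ψ := by
  refine AlgHom.ext fun x => ?_
  induction x using double_induction with
  | add a b ha hb => simp only [map_add, ha, hb]
  | mul b h =>
    rw [map_mul, map_mul]
    exact congrArg₂ _ (DFunLike.congr_fun h1 b) (DFunLike.congr_fun h2 h)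

theorem double_mem_subalgebra {S : Subalgebra k τ.Double} (h1 : ∀ b, τ.inl b ∈ S)
    (h2 : ∀ h, τ.inr h ∈ S) (x : τ.Double) : x ∈ S := by
  induction x using double_induction with
  | add a b ha hb => exact add_mem ha hb
  | mul b h => exact mul_mem (h1 b) (h2 h)

/-- The coalgebra map `c ⊗ h ↦ (1 ⊗ h) ⊗ (c ⊗ 1)`. -/
def twist (k B H : Type*) [Field k] [Ring B] [HopfAlgebra k B] [Ring H] [HopfAlgebra k H] :
    B ⊗[k] H →ₗc[k] (B ⊗[k] H) ⊗[k] (B ⊗[k] H) :=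
  (Coalgebra.TensorProduct.map (right k B H) (left k B H)).comp
    (Bialgebra.TensorProduct.comm k B H).toCoalgEquiv.toCoalgHom

/-- The pairing as an element of the convolution algebra. -/
def conv : WithConv (B ⊗[k] H →ₗ[k] k) := toConv (TensorProduct.lift τ.form)

/-- The map `c ⊗ h ↦ h · c`. -/
def swapMul : B ⊗[k] H →ₗ[k] τ.Double :=
  (Deform.of τ.cocycle).toLinearEquiv.toLinearMap ∘ₗ τ.cocycle.mul ∘ₗ (twist k B H).toLinearMap

theorem swapMul_tmul (b : B) (h : H) : τ.swapMul (b ⊗ₜ h) = τ.inr h * τ.inl b := rfl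

/-- The exchange relation `(h₁ · c₁) τ(c₂, h₂) = τ(c₁, h₁) c₂ h₂`, viewed through a linear map. -/
theorem swapMul_mul_conv {A : Type*} [Ring A] [Algebra k A] (Y : τ.Double →ₗ[k] A) :
    toConv (Y ∘ₗ τ.swapMul) * scal A τ.conv =
      scal A τ.conv * toConv (Y ∘ₗ (Deform.of τ.cocycle).toLinearEquiv.toLinearMap) := by
  -- Pulled back along `c ⊗ h ↦ (1 ⊗ h) ⊗ (c ⊗ 1)`, the cocycle becomes `τ`, and the undeformed
  -- product becomes the identity of `B ⊗ H` because the two factors commute there.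
  have e := congrArg (pull (twist k B H)) τ.cocycle.mul_mul_form
  rw [pull_mul, pull_mul, pull_scal] at e
  have h1 : pull (twist k B H) τ.cocycle.form = τ.conv := by
    ext b h
    refine (τ.cocycleForm_tmul 1 b h 1).trans ?_
    simp [conv]
  have h2 : pull (twist k B H) (toConv (LinearMap.mul' k (B ⊗[k] H))) = toConv LinearMap.id := by
    ext b h
    change (1 ⊗ₜ[k] h) * (b ⊗ₜ[k] 1) = b ⊗ₜ[k] h
    simp
  rw [h1, h2] at e
  have e' := congrArg (fun Z : WithConv (B ⊗[k] H →ₗ[k] B ⊗[k] H) =>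
    toConv ((Y ∘ₗ (Deform.of τ.cocycle).toLinearEquiv.toLinearMap) ∘ₗ Z.ofConv)) e
  rw [comp_mul_scal, comp_scal_mul] at e'
  exact e'

end general

end SkewPairing

/-! ### Constructing algebra maps from the double to commutative algebras -/

namespace PreNichols

variable {k F I A : Type*} [Field k] [CommGroup F] {V : DiagYD k F I} (N : PreNichols V)
  [CommRing A] [Algebra k A]

/-- The algebra map from the bosonization with `v_i ↦ 0` which extends the map `a` on `F`. -/
def aug (a : F →* A) : N.Boson →ₐ[k] A :=
  N.lift ((Algebra.ofId k A).comp FreeAlgebra.algebraMapInv) a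
    (fun x hx => by simp [N.counit_eq_zero x hx]) (by simp [FreeAlgebra.algebraMapInv])

@[simp] theorem aug_gen (a : F →* A) (i : I) : N.aug a (N.gen i) = 0 := by
  simp [aug, FreeAlgebra.algebraMapInv]

@[simp] theorem aug_grp (a : F →* A) (h : F) : N.aug a (N.grp h) = a h := by
  simp [aug]

end PreNichols

namespace TwoCocycle

open Coalgebra WithConv LinearMap

variable {k C : Type*} [Field k] [AddCommGroup C] [Module k C] [Coalgebra k C]

/-- The map of convolution algebras induced by `k → A`. -/
def scalHom (k C A : Type*) [Field k] [AddCommGroup C] [Module k C] [Coalgebra k C] [Ring A] [Algebra k A] :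
    WithConv (C →ₗ[k] k) →ₐ[k] WithConv (C →ₗ[k] A) :=
  AlgHom.ofLinearMap
    { toFun f := scal A f
      map_add' f g := by ext c; simp [scal]
      map_smul' r f := by
        ext c
        exact (map_mul (algebraMap k A) r (f c)).trans (Algebra.smul_def r _).symm } scal_one scal_mul

/-- Lets the structure map from `A` to its convolution algebra be viewed as a `k`-algebra map, as
needed in `map_mul_aug`. -/
instance isScalarTower_conv (A : Type*) [CommRing A] [Algebra k A] :
    IsScalarTower k A (WithConv (C →ₗ[k] A)) :=
  ⟨fun x y z => WithConv.ext (LinearMap.ext fun c => smul_assoc x y (z c))⟩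

theorem scalHom_apply (A : Type*) [Ring A] [Algebra k A] (f : WithConv (C →ₗ[k] k)) :
    scalHom k C A f = scal A f := rfl

end TwoCocycle

namespace SkewPairing

open Coalgebra WithConv LinearMap TwoCocycle

section aug

variable {k F G I A : Type*} [Field k] [CommGroup F] [CommGroup G] [CommRing A] [Algebra k A]
  {τ₀ : F →* G →* kˣ} {f : I → F} {g : I → G}
  (R : PreNichols (diagV τ₀ f g)) (S : PreNichols (diagW τ₀ f g)) (a : F →* A) (b : G →* A)

/-- The two convolution products are algebra maps from `H` to the commutative algebra `A`. Both kill
`w_i`, and they agree on `G`. -/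
theorem scal_phi_mul_aug (h : F) :
    scal A (phi S h) * toConv (S.aug b).toLinearMap =
      toConv (S.aug b).toLinearMap * scal A (phi S h) := by
  let c : S.Boson →ₐ[k] A := (Algebra.ofId k A).comp (S.charHom (τ₀ h))
  let n1 := (Algebra.TensorProduct.lift c (S.aug b) fun _ _ => Commute.all _ _).comp
    (Bialgebra.comulAlgHom k S.Boson)
  let n2 := (Algebra.TensorProduct.lift (S.aug b) c fun _ _ => Commute.all _ _).comp
    (Bialgebra.comulAlgHom k S.Boson)
  have key : n1 = n2 := by
    refine S.algHom_ext (fun i => ?_) fun y => ?_ <;> simp [n1, n2, c, mul_comm]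
  ext x
  have h3 := DFunLike.congr_fun key x
  rw [(ℛ k x).convMul_apply, (ℛ k x).convMul_apply]
  simpa [n1, n2, ← (ℛ k x).eq, c, scal, phi, Algebra.ofId_apply] using h3

/-- The functional `τ(v_i, -)` is not multiplicative, but it is an entry of the matrix
representation `repW`. Convolving this representation with the scalar map `b` on either side gives
two algebra maps to matrices, which a diagonal matrix intertwines. At `w_i` this intertwining is
precisely the condition `a(f_i) b(g_i) = 1`. -/
theorem scal_psi_mul_aug (i : I) (hi : a (f i) * b (g i) = 1) :
    scal A (psi S i) * toConv (S.aug b).toLinearMap =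
      a (f i) • (toConv (S.aug b).toLinearMap * scal A (psi S i)) := by
  classical
  let c : S.Boson →ₐ[k] Matrix (Fin 2) (Fin 2) A :=
    ((Algebra.ofId A (Matrix (Fin 2) (Fin 2) A)).restrictScalars k).comp (S.aug b)
  let r : S.Boson →ₐ[k] Matrix (Fin 2) (Fin 2) A := (Algebra.ofId k A).mapMatrix.comp (repW S i)
  have hc : ∀ x y, Commute (c x) (r y) := fun x y => Algebra.commutes (S.aug b x) _
  let n1 := (Algebra.TensorProduct.lift r c fun x y => (hc y x).symm).comp
    (Bialgebra.comulAlgHom k S.Boson)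
  let n2 := (Algebra.TensorProduct.lift c r hc).comp (Bialgebra.comulAlgHom k S.Boson)
  -- `D` multiplies the upper right entry by `a(f_i)` from the left and by `1` from the right;
  -- reading that entry of the intertwining relation gives the claim.
  let D : Matrix (Fin 2) (Fin 2) A := !![a (f i), 0; 0, 1]
  have key : ∀ x, n1 x * D = D * n2 x := by
    intro x
    refine S.subalgebra_eq_top (S :=
      { carrier := {x | n1 x * D = D * n2 x}
        mul_mem' := fun {x y} hx hy => ?_
        add_mem' := fun {x y} hx hy => ?_
        algebraMap_mem' := fun r => ?_ }) (fun j => ?_) (fun h => ?_) x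
    · change _ = _ at hx
      change _ = _ at hy
      change _ = _
      rw [map_mul, map_mul, mul_assoc, hy, ← mul_assoc, hx, mul_assoc]
    · change _ = _ at hx
      change _ = _ at hy
      change _ = _
      rw [map_add, map_add, add_mul, mul_add, hx, hy]
    · change _ = _
      rw [AlgHom.commutes, AlgHom.commutes, Algebra.commutes]
    · change _ = _
      simp only [n1, n2, AlgHom.comp_apply, Bialgebra.comulAlgHom_apply, PreNichols.comul_gen,
        map_add, Algebra.TensorProduct.lift_tmul, map_one, c, r, PreNichols.aug_gen,
        PreNichols.aug_grp, map_zero, repW, PreNichols.rep_gen, PreNichols.rep_grp]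
      by_cases hj : j = i
      · subst hj
        ext p q
        fin_cases p <;> fin_cases q <;>
          simp [D, diagW, Matrix.mul_apply, Algebra.ofId_apply, Matrix.algebraMap_matrix_apply, hi]
      · simp [hj]
    · change _ = _
      simp only [n1, n2, AlgHom.comp_apply, Bialgebra.comulAlgHom_apply, PreNichols.comul_grp,
        Algebra.TensorProduct.lift_tmul, c, r, PreNichols.aug_grp, repW, PreNichols.rep_grp]
      ext p q
      fin_cases p <;> fin_cases q <;>
        simp [D, Matrix.mul_apply, Algebra.ofId_apply,
          Matrix.algebraMap_matrix_apply, mul_comm]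
  ext x
  have h1 : n1 x = ∑ j ∈ (ℛ k x).index, r ((ℛ k x).left j) * c ((ℛ k x).right j) := by
    simp [n1, ← (ℛ k x).eq]
  have h2 : n2 x = ∑ j ∈ (ℛ k x).index, c ((ℛ k x).left j) * r ((ℛ k x).right j) := by
    simp [n2, ← (ℛ k x).eq]
  have h3 := congrFun (congrFun (key x) 0) 1
  rw [h1, h2] at h3
  change (scal A (psi S i) * toConv (S.aug b).toLinearMap) x =
    a (f i) • (toConv (S.aug b).toLinearMap * scal A (psi S i)) x
  rw [(ℛ k x).convMul_apply, (ℛ k x).convMul_apply]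
  simpa [D, Matrix.mul_apply, Matrix.sum_apply, scal, psi, c, r, Algebra.ofId_apply,
    Matrix.algebraMap_matrix_apply, Finset.mul_sum] using h3

/-- `τ(c₁, -) a(c₂) * b = b * a(c₁) τ(c₂, -)` in the convolution algebra of `H` and `A`. -/
theorem map_mul_aug (hab : ∀ i, a (f i) * b (g i) = 1) (c : R.Boson) :
    (∑ i ∈ (ℛ k c).index, R.aug a ((ℛ k c).right i) • scal A (map R S ((ℛ k c).left i))) *
        toConv (S.aug b).toLinearMap =
      toConv (S.aug b).toLinearMap * ∑ i ∈ (ℛ k c).index,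
        R.aug a ((ℛ k c).left i) • scal A (map R S ((ℛ k c).right i)) := by
  let T : R.Boson →ₐ[k] WithConv (S.Boson →ₗ[k] A) := (scalHom k S.Boson A).comp (map R S)
  -- The values of `κ` are central, so the two sums are values at `c` of algebra maps `n1` and `n2`.
  -- An identity `n1 x * z = z * n2 x` with `z` fixed is stable under products, and it only remains
  -- to check generators.
  let κ : R.Boson →ₐ[k] WithConv (S.Boson →ₗ[k] A) :=
    ((Algebra.ofId A (WithConv (S.Boson →ₗ[k] A))).restrictScalars k).comp (R.aug a)
  have hκ : ∀ x y, Commute (κ x) (T y) := fun x y => Algebra.commutes (R.aug a x) _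
  let n1 := (Algebra.TensorProduct.lift T κ fun x y => (hκ y x).symm).comp
    (Bialgebra.comulAlgHom k R.Boson)
  let n2 := (Algebra.TensorProduct.lift κ T hκ).comp (Bialgebra.comulAlgHom k R.Boson)
  have key : n1 c * toConv (S.aug b).toLinearMap = toConv (S.aug b).toLinearMap * n2 c := by
    refine R.subalgebra_eq_top (S :=
      { carrier := {x | n1 x * toConv (S.aug b).toLinearMap =
          toConv (S.aug b).toLinearMap * n2 x}
        mul_mem' := fun {x y} hx hy => ?_
        add_mem' := fun {x y} hx hy => ?_
        algebraMap_mem' := fun r => ?_ }) (fun j => ?_) (fun h => ?_) c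
    · change _ = _ at hx
      change _ = _ at hy
      change _ = _
      rw [map_mul, map_mul, mul_assoc, hy, ← mul_assoc, hx, mul_assoc]
    · change _ = _ at hx
      change _ = _ at hy
      change _ = _
      rw [map_add, map_add, add_mul, mul_add, hx, hy]
    · change _ = _
      rw [AlgHom.commutes, AlgHom.commutes, Algebra.commutes]
    · change _ = _
      have e1 : n1 (R.gen j) = scal A (psi S j) := by
        simp [n1, T, κ, map_gen, scalHom_apply]
      have e2 : n2 (R.gen j) = a (f j) • scal A (psi S j) := by
        simp [n2, T, κ, map_gen, scalHom_apply, Algebra.ofId_apply, ← Algebra.smul_def,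
          show (diagV τ₀ f g).deg j = f j from rfl]
      rw [e1, e2, scal_psi_mul_aug S a b j (hab j), mul_smul_comm]
    · change _ = _
      have e1 : n1 (R.grp h) = a h • scal A (phi S h) := by
        simp [n1, T, κ, map_grp, scalHom_apply, Algebra.ofId_apply, ← Algebra.smul_def,
          ← Algebra.commutes]
      have e2 : n2 (R.grp h) = a h • scal A (phi S h) := by
        simp [n2, T, κ, map_grp, scalHom_apply, Algebra.ofId_apply, ← Algebra.smul_def]
      rw [e1, e2, mul_smul_comm, ← scal_phi_mul_aug, smul_mul_assoc]
  have h1 : n1 c = ∑ i ∈ (ℛ k c).index,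
      R.aug a ((ℛ k c).right i) • scal A (map R S ((ℛ k c).left i)) := by
    simp only [n1, AlgHom.comp_apply, Bialgebra.comulAlgHom_apply]
    conv_lhs => rw [← (ℛ k c).eq]
    simp [T, κ, scalHom_apply, Algebra.ofId_apply, ← Algebra.smul_def, ← Algebra.commutes]
  have h2 : n2 c = ∑ i ∈ (ℛ k c).index,
      R.aug a ((ℛ k c).left i) • scal A (map R S ((ℛ k c).right i)) := by
    simp only [n2, AlgHom.comp_apply, Bialgebra.comulAlgHom_apply]
    conv_lhs => rw [← (ℛ k c).eq]
    simp [T, κ, scalHom_apply, Algebra.ofId_apply, ← Algebra.smul_def]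
  rw [← h1, ← h2, key]

/-- The map `c ⊗ h ↦ a(c) b(h)`. -/
def augTensor : R.Boson ⊗[k] S.Boson →ₐ[k] A :=
  Algebra.TensorProduct.lift (R.aug a) (S.aug b) fun _ _ => Commute.all _ _

/-- This is `map_mul_aug` evaluated at `h`, with both coproducts written out: the functional `a ⊗ b`
commutes with `τ` under convolution. -/
theorem conv_mul_augTensor (hab : ∀ i, a (f i) * b (g i) = 1) :
    scal A (tau R S).conv * toConv (augTensor R S a b).toLinearMap =
      toConv (augTensor R S a b).toLinearMap * scal A (tau R S).conv := by
  refine WithConv.ext (TensorProduct.ext' fun c h => ?_)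
  have e := congrArg (fun Z : WithConv (S.Boson →ₗ[k] A) => Z h) (map_mul_aug R S a b hab c)
  have hτ : ∀ x y, scal A (tau R S).conv (x ⊗ₜ y) = scal A (map R S x) y := fun _ _ => rfl
  have haug : ∀ x y, toConv (augTensor R S a b).toLinearMap (x ⊗ₜ y) =
    R.aug a x * toConv (S.aug b).toLinearMap y := fun _ _ => rfl
  have hsmul : ∀ (r : A) (X : WithConv (S.Boson →ₗ[k] A)) y, (r • X) y = r * X y :=
    fun _ _ _ => rfl
  refine Eq.trans ?_ (e.trans ?_)
  · rw [Finset.sum_mul, ((ℛ k c).tmul (ℛ k h)).convMul_apply, Coalgebra.Repr.tmul_index,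
      Finset.sum_product, WithConv.ofConv_sum, LinearMap.sum_apply]
    refine Finset.sum_congr rfl fun i _ => ?_
    rw [smul_mul_assoc, hsmul, (ℛ k h).convMul_apply, Finset.mul_sum]
    refine Finset.sum_congr rfl fun j _ => ?_
    rw [Coalgebra.Repr.tmul_left, Coalgebra.Repr.tmul_right, hτ, haug, mul_left_comm]
  · rw [Finset.mul_sum, ((ℛ k c).tmul (ℛ k h)).convMul_apply, Coalgebra.Repr.tmul_index,
      Finset.sum_product, WithConv.ofConv_sum, LinearMap.sum_apply]
    refine Finset.sum_congr rfl fun i _ => ?_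
    rw [mul_smul_comm, hsmul, (ℛ k h).convMul_apply, Finset.mul_sum]
    refine Finset.sum_congr rfl fun j _ => ?_
    rw [Coalgebra.Repr.tmul_left, Coalgebra.Repr.tmul_right, hτ, haug, mul_assoc]

/-- The linear map `b ⊗ h ↦ a(b) b(h)` on the double. -/
def augLinear : (tau R S).Double →ₗ[k] A :=
  (augTensor R S a b).toLinearMap ∘ₗ
    (TwoCocycle.Deform.of (tau R S).cocycle).toLinearEquiv.symm.toLinearMap

theorem augLinear_inl_mul_inr (x : R.Boson) (y : S.Boson) :
    augLinear R S a b ((tau R S).inl x * (tau R S).inr y) = R.aug a x * S.aug b y := by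
  rw [inl_mul_inr]; rfl

/-- By the exchange relation, the functionals `c ⊗ h ↦ Y(h · c)` and `c ⊗ h ↦ Y(c · h)` are
conjugate under `τ`. For `Y = a ⊗ b` the second commutes with `τ`, so multiplying by the convolution
inverse of `τ` identifies the two. -/
theorem augLinear_inr_mul_inl (hab : ∀ i, a (f i) * b (g i) = 1) (x : R.Boson) (y : S.Boson) :
    augLinear R S a b ((tau R S).inr y * (tau R S).inl x) = R.aug a x * S.aug b y := by
  have h1 := (tau R S).swapMul_mul_conv (augLinear R S a b)
  have h2 : toConv (augLinear R S a b ∘ₗ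
      (TwoCocycle.Deform.of (tau R S).cocycle).toLinearEquiv.toLinearMap) =
      toConv (augTensor R S a b).toLinearMap := rfl
  rw [h2, conv_mul_augTensor R S a b hab] at h1
  have h3 := congrArg (· * scal A (tau R S).invForm) h1
  simp only [mul_assoc, ← scal_mul] at h3
  rw [show (tau R S).conv * (tau R S).invForm = 1 from (tau R S).form_mul_inv, scal_one, mul_one,
    mul_one] at h3
  exact congrArg (fun Z : WithConv (R.Boson ⊗[k] S.Boson →ₗ[k] A) => Z (x ⊗ₜ y)) h3

/-- The algebra map from the double to a commutative algebra with `v_i, w_i ↦ 0` which extends the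
maps `a` on `F` and `b` on `G`. -/
def doubleAug (hab : ∀ i, a (f i) * b (g i) = 1) : (tau R S).Double →ₐ[k] A :=
  AlgHom.ofLinearMap (augLinear R S a b)
    (by
      have h := augLinear_inl_mul_inr R S a b 1 1
      rwa [map_one (tau R S).inl, map_one (tau R S).inr, mul_one, map_one (R.aug a),
        map_one (S.aug b), mul_one] at h)
    (by
      intro x y
      -- The functional respects left multiplication by `B` and right multiplication by `H`.
      -- Multiplicativity on `(p · h)(c · q)` thus reduces to its value on the middle factor `h ·
      -- c`.
      have hm : ∀ (p : R.Boson) (z : (tau R S).Double) (q : S.Boson),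
          augLinear R S a b ((tau R S).inl p * z * (tau R S).inr q) =
            R.aug a p * augLinear R S a b z * S.aug b q := by
        intro p z q
        induction z using double_induction with
        | add z w hz hw => simp only [mul_add, add_mul, map_add, hz, hw]
        | mul c h =>
          rw [← mul_assoc, ← map_mul, mul_assoc, ← map_mul, augLinear_inl_mul_inr,
            augLinear_inl_mul_inr, map_mul, map_mul]
          ring
      induction x using double_induction with
      | add z w hz hw => simp only [add_mul, map_add, hz, hw]
      | mul p h =>
        induction y using double_induction with
        | add z w hz hw => simp only [mul_add, map_add, hz, hw]
        | mul c q =>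
          rw [mul_assoc, ← mul_assoc ((tau R S).inr h), ← mul_assoc, hm,
            augLinear_inr_mul_inl R S a b hab, augLinear_inl_mul_inr, augLinear_inl_mul_inr]
          ring)

@[simp] theorem doubleAug_inl (hab : ∀ i, a (f i) * b (g i) = 1) (x : R.Boson) :
    doubleAug R S a b hab ((tau R S).inl x) = R.aug a x := by
  have h := augLinear_inl_mul_inr R S a b x 1
  rwa [map_one, map_one, mul_one, mul_one] at h

@[simp] theorem doubleAug_inr (hab : ∀ i, a (f i) * b (g i) = 1) (y : S.Boson) :
    doubleAug R S a b hab ((tau R S).inr y) = S.aug b y := by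
  have h := augLinear_inl_mul_inr R S a b 1 y
  rwa [map_one, map_one, one_mul, one_mul] at h

end aug

end SkewPairing
-- Cross relations in `𝒟` and maps to commutative algebras
namespace GenDouble

open Coalgebra WithConv LinearMap TwoCocycle SkewPairing

variable {k F G I : Type*} [Field k] [CommGroup F] [CommGroup G]
  {τ₀ : F →* G →* kˣ} {f : I → F} {g : I → G}
  (R : PreNichols (diagV τ₀ f g)) (S : PreNichols (diagW τ₀ f g))

/-- The generator `v_i` of the double. -/
def genV (i : I) : GenDouble R S := (tau R S).inl (R.gen i)

/-- The generator `w_i` of the double. -/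
def genW (i : I) : GenDouble R S := (tau R S).inr (S.gen i)

theorem grp_eq (c : F × G) :
    grp R S c = (tau R S).inl (R.grp c.1) * (tau R S).inr (S.grp c.2) :=
  ((tau R S).inl_mul_inr _ _).symm

theorem grp_left (x : F) : grp R S (x, 1) = (tau R S).inl (R.grp x) := by
  rw [grp_eq, map_one, map_one, mul_one]

theorem grp_right (y : G) : grp R S (1, y) = (tau R S).inr (S.grp y) := by
  rw [grp_eq, map_one, map_one, one_mul]

/-- The map `c ⊗ h ↦ c h`. -/
def mulTensor : R.Boson ⊗[k] S.Boson →ₗ[k] GenDouble R S :=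
  LinearMap.mul' k _ ∘ₗ TensorProduct.map (tau R S).inl.toLinearMap (tau R S).inr.toLinearMap

theorem mulTensor_tmul (c : R.Boson) (h : S.Boson) :
    mulTensor R S (c ⊗ₜ h) = (tau R S).inl c * (tau R S).inr h := rfl

/-- Expanding both sides with the coproducts of generators yields all the cross relations below. -/
theorem exchange_apply (c : R.Boson) (h : S.Boson) :
    (toConv (tau R S).swapMul * scal (GenDouble R S) (tau R S).conv) (c ⊗ₜ h) =
      (scal (GenDouble R S) (tau R S).conv *
        toConv (mulTensor R S)) (c ⊗ₜ h) := by
  have e : mulTensor R S =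
      (TwoCocycle.Deform.of (tau R S).cocycle).toLinearEquiv.toLinearMap :=
    TensorProduct.ext' fun c h => (tau R S).inl_mul_inr c h
  rw [e]
  exact congrArg (fun Z : WithConv (R.Boson ⊗[k] S.Boson →ₗ[k] GenDouble R S) => Z (c ⊗ₜ h))
    ((tau R S).swapMul_mul_conv LinearMap.id)

theorem scal_conv_tmul (c : R.Boson) (h : S.Boson) :
    (scal (GenDouble R S) (tau R S).conv).ofConv (c ⊗ₜ h) =
      algebraMap k _ ((tau R S).form c h) := rfl

/-- With `Δ(v_i) = v_i ⊗ 1 + f_i ⊗ v_i`, the terms containing `τ(v_i, y) = 0` drop out of the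
exchange relation. One term remains on each side, with coefficients `τ(1, y) = 1` and `τ(f_i, y)`.
-/
theorem inr_grp_mul_genV (y : G) (i : I) :
    (tau R S).inr (S.grp y) * genV R S i =
      (τ₀ (f i) y : k) • (genV R S i * (tau R S).inr (S.grp y)) := by
  have h := exchange_apply R S (R.gen i) (S.grp y)
  simp only [convMul_apply, TensorProduct.comul_tmul, PreNichols.comul_gen, PreNichols.comul_grp,
    TensorProduct.add_tmul, map_add, TensorProduct.AlgebraTensorModule.tensorTensorTensorComm_tmul,
    TensorProduct.map_tmul, LinearMap.mul'_apply, scal_conv_tmul, swapMul_tmul,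
    mulTensor_tmul, tau_gen_grp, (tau R S).one_left, S.counit_grp, tau_grp_grp,
    show (diagV τ₀ f g).deg i = f i from rfl, map_zero, map_one, zero_mul, mul_zero, zero_add,
    add_zero, mul_one, ← Algebra.smul_def] at h
  exact h

theorem genW_mul_inl_grp (x : F) (i : I) :
    genW R S i * (tau R S).inl (R.grp x) =
      (τ₀ x (g i) : k) • ((tau R S).inl (R.grp x) * genW R S i) := by
  have h := exchange_apply R S (R.grp x) (S.gen i)
  simp only [convMul_apply, TensorProduct.comul_tmul, PreNichols.comul_gen, PreNichols.comul_grp,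
    TensorProduct.tmul_add, map_add, TensorProduct.AlgebraTensorModule.tensorTensorTensorComm_tmul,
    TensorProduct.map_tmul, LinearMap.mul'_apply, scal_conv_tmul, swapMul_tmul,
    mulTensor_tmul, tau_grp_gen, (tau R S).one_right, R.counit_grp, tau_grp_grp,
    show (diagW τ₀ f g).deg i = g i from rfl, map_zero, map_one, zero_mul, mul_zero, zero_add,
    add_zero, mul_one, ← Algebra.smul_def] at h
  exact h

/-- The summands `f_i g_i` and `1` are the ones weighted by `τ(v_i, w_i) = 1`. This is the only
relation linking `P` to the generators `v_i, w_i`: in a quotient where these vanish, `f_i g_i`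
becomes `1`. -/
theorem genW_mul_genV (i : I) :
    genW R S i * genV R S i + grp R S (f i, g i) =
      1 + (τ₀ (f i) (g i) : k) • (genV R S i * genW R S i) := by
  classical
  have h := exchange_apply R S (R.gen i) (S.gen i)
  have hc : grp R S (f i, g i) = (tau R S).inr (S.grp (g i)) * (tau R S).inl (R.grp (f i)) := by
    rw [← grp_left, ← grp_right, ← map_mul]; simp
  simp only [convMul_apply, TensorProduct.comul_tmul, PreNichols.comul_gen,
    TensorProduct.tmul_add, TensorProduct.add_tmul, map_add,
    TensorProduct.AlgebraTensorModule.tensorTensorTensorComm_tmul,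
    TensorProduct.map_tmul, LinearMap.mul'_apply, scal_conv_tmul, swapMul_tmul,
    mulTensor_tmul, tau_grp_gen, tau_gen_grp, tau_gen_gen, if_true,
    (tau R S).one_right, (tau R S).one_left, R.counit_gen, S.counit_gen, tau_grp_grp,
    show (diagW τ₀ f g).deg i = g i from rfl, show (diagV τ₀ f g).deg i = f i from rfl,
    Bialgebra.counit_one, map_zero, map_one, zero_mul, mul_zero, zero_add,
    add_zero, mul_one, one_mul, ← Algebra.smul_def, ← hc] at h
  exact h

/-- The group `F × G` acts on `v_i` by the character `(x, y) ↦ τ₀(x, g_i) τ₀(f_i, y)`. -/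
theorem grp_mul_genV (c : F × G) (i : I) : grp R S c * genV R S i =
    ((τ₀ c.1 (g i) * τ₀ (f i) c.2 : kˣ) : k) • (genV R S i * grp R S c) := by
  have h : (tau R S).inl (R.grp c.1) * genV R S i =
      (τ₀ c.1 (g i) : k) • (genV R S i * (tau R S).inl (R.grp c.1)) := by
    rw [genV, ← map_mul, ← map_mul, R.grp_mul_gen, map_smul]; rfl
  rw [grp_eq, mul_assoc, inr_grp_mul_genV, mul_smul_comm, ← mul_assoc, h, smul_mul_assoc,
    smul_smul, mul_assoc, Units.val_mul, mul_comm (τ₀ c.1 (g i) : k)]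

/-- The scalar is that of `grp_mul_genV`, but with the group element on the other side: the weights
of `v_i` and `w_i` are inverse to each other. -/
theorem genW_mul_grp (c : F × G) (i : I) : genW R S i * grp R S c =
    ((τ₀ c.1 (g i) * τ₀ (f i) c.2 : kˣ) : k) • (grp R S c * genW R S i) := by
  have h : genW R S i * (tau R S).inr (S.grp c.2) =
      (τ₀ (f i) c.2 : k) • ((tau R S).inr (S.grp c.2) * genW R S i) := by
    have e : (diagW τ₀ f g).char i c.2 = (τ₀ (f i) c.2)⁻¹ := rfl
    rw [genW, ← map_mul, ← map_mul, S.grp_mul_gen, e, map_smul, smul_smul, Units.mul_inv,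
      one_smul]
  rw [grp_eq, ← mul_assoc, genW_mul_inl_grp, smul_mul_assoc, mul_assoc, h, mul_smul_comm,
    smul_smul, mul_assoc, Units.val_mul]

variable {R S}

theorem algHom_ext {A : Type*} [Ring A] [Algebra k A] {φ ψ : GenDouble R S →ₐ[k] A}
    (hV : ∀ i, φ (genV R S i) = ψ (genV R S i)) (hW : ∀ i, φ (genW R S i) = ψ (genW R S i))
    (h : ∀ c, φ (grp R S c) = ψ (grp R S c)) : φ = ψ := by
  refine double_algHom_ext (R.algHom_ext hV fun x => ?_) (S.algHom_ext hW fun y => ?_)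
  · simpa only [AlgHom.comp_apply, grp_left] using h (x, 1)
  · simpa only [AlgHom.comp_apply, grp_right] using h (1, y)

theorem mem_subalgebra {T : Subalgebra k (GenDouble R S)} (hV : ∀ i, genV R S i ∈ T)
    (hW : ∀ i, genW R S i ∈ T) (h : ∀ c, grp R S c ∈ T) (x : GenDouble R S) : x ∈ T :=
  double_mem_subalgebra _
    (R.subalgebra_eq_top (S := T.comap (tau R S).inl) hV fun x => by
      simpa only [Subalgebra.mem_comap, grp_left] using h (x, 1))
    (S.subalgebra_eq_top (S := T.comap (tau R S).inr) hW fun y => by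
      simpa only [Subalgebra.mem_comap, grp_right] using h (1, y)) x

/-- The definition of `C` says that all the scalars in `grp_mul_genV` and `genW_mul_grp` are `1`, so
the centralizer of `c` contains the generators of `𝒟`. -/
theorem commute_grp {c : F × G} (hc : c ∈ centralSubgroup τ₀ f g) (x : GenDouble R S) :
    Commute (grp R S c) x := by
  have h : x ∈ Subalgebra.centralizer k {grp R S c} := by
    refine mem_subalgebra (fun i => ?_) (fun i => ?_) (fun d => ?_) x <;>
      rw [Subalgebra.mem_centralizer_iff] <;> rintro _ rfl
    · rw [grp_mul_genV, hc i, Units.val_one, one_smul]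
    · rw [genW_mul_grp, hc i, Units.val_one, one_smul]
    · rw [← map_mul, ← map_mul, mul_comm]
  exact Subalgebra.mem_centralizer_iff k |>.1 h _ rfl

theorem comul_genV (i : I) : comul (R := k) (genV R S i) =
    genV R S i ⊗ₜ[k] 1 + grp R S (f i, 1) ⊗ₜ[k] genV R S i := by
  rw [genV, comul_inl, R.comul_gen, grp_left]
  simp [show (diagV τ₀ f g).deg i = f i from rfl]

theorem comul_genW (i : I) : comul (R := k) (genW R S i) =
    genW R S i ⊗ₜ[k] 1 + grp R S (1, g i) ⊗ₜ[k] genW R S i := by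
  rw [genW, comul_inr, S.comul_gen, grp_right]
  simp [show (diagW τ₀ f g).deg i = g i from rfl]

theorem counit_genV (i : I) : counit (R := k) (genV R S i) = 0 := by
  rw [genV, counit_inl, R.counit_gen]

theorem counit_genW (i : I) : counit (R := k) (genW R S i) = 0 := by
  rw [genW, counit_inr, S.counit_gen]

section commutative

variable {A : Type*} [CommRing A] [Algebra k A]

variable (R S) in
/-- The algebra map from the double to a commutative algebra with `v_i, w_i ↦ 0` which extends a
map on `F × G` that is trivial on all `(f_i, g_i)`. -/
def aug (ρ : F × G →* A) (hρ : ∀ i, ρ (f i, g i) = 1) : GenDouble R S →ₐ[k] A :=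
  doubleAug R S (ρ.comp (MonoidHom.inl F G)) (ρ.comp (MonoidHom.inr F G)) fun i => by
    rw [← hρ i]; simp [← map_mul]

@[simp] theorem aug_genV (ρ : F × G →* A) (hρ : ∀ i, ρ (f i, g i) = 1) (i : I) :
    aug R S ρ hρ (genV R S i) = 0 := by simp [aug, genV]

@[simp] theorem aug_genW (ρ : F × G →* A) (hρ : ∀ i, ρ (f i, g i) = 1) (i : I) :
    aug R S ρ hρ (genW R S i) = 0 := by simp [aug, genW]

@[simp] theorem aug_grp (ρ : F × G →* A) (hρ : ∀ i, ρ (f i, g i) = 1) (c : F × G) :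
    aug R S ρ hρ (grp R S c) = ρ c := by
  rw [aug, grp_eq, map_mul, doubleAug_inl, doubleAug_inr, PreNichols.aug_grp,
    PreNichols.aug_grp, MonoidHom.comp_apply, MonoidHom.comp_apply, ← map_mul]
  simp

/-- In a commutative algebra, a relation `u z = r z u` with `u` invertible and `r ≠ 1` forces `z =
0`. Non-degeneracy provides a group element acting on `v_i` by such a scalar `r`, unless `f_i` and
`g_i` are both trivial. -/
theorem map_genV_genW_eq_zero (hleft : ∀ x, (∀ y, τ₀ x y = 1) → x = 1)
    (hright : ∀ y, (∀ x, τ₀ x y = 1) → y = 1) (π : GenDouble R S →ₐ[k] A) (i : I)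
    (hi : f i ≠ 1 ∨ g i ≠ 1) : π (genV R S i) = 0 ∧ π (genW R S i) = 0 := by
  obtain ⟨c, hc⟩ : ∃ c : F × G, τ₀ c.1 (g i) * τ₀ (f i) c.2 ≠ 1 := by
    -- If the weight of `v_i` were trivial, restricting it to `G` would give `f_i = 1` and
    -- restricting it to `F` would give `g_i = 1`.
    by_contra! h
    rcases hi with hi | hi
    · exact hi (hleft _ fun y => by simpa using h (1, y))
    · exact hi (hright _ fun x => by simpa using h (x, 1))
  have key : ∀ (u z : A) (r : k), r ≠ 1 → IsUnit u → u * z = r • (z * u) → z = 0 := by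
    intro u z r hr hu h
    have h1 : (r - 1) • (z * u) = 0 := by
      rw [sub_smul, ← h, one_smul, mul_comm, sub_self]
    rw [smul_eq_zero_iff_right (sub_ne_zero.2 hr)] at h1
    exact (hu.mul_left_eq_zero).1 h1
  have hu : IsUnit (π (grp R S c)) := ((Group.isUnit c).map (grp R S)).map π
  have hc' : ((τ₀ c.1 (g i) * τ₀ (f i) c.2 : kˣ) : k) ≠ 1 := fun h => hc (Units.ext h)
  refine ⟨key _ _ _ hc' hu ?_, key _ _ _ hc' hu ?_⟩
  · rw [← map_mul, ← map_mul, ← map_smul, grp_mul_genV]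
  · have e := congrArg π (genW_mul_grp R S c i)
    rw [map_smul, map_mul, map_mul, mul_comm] at e
    rwa [mul_comm (π (genW R S i))]

/-- Once `v_i` and `w_i` are killed, `genW_mul_genV` reads `f_i g_i ↦ 1`, and these elements
generate `P`. -/
theorem map_grp_eq_one (hleft : ∀ x, (∀ y, τ₀ x y = 1) → x = 1)
    (hright : ∀ y, (∀ x, τ₀ x y = 1) → y = 1) (hfg : ∀ i, f i ≠ 1 ∨ g i ≠ 1)
    (π : GenDouble R S →ₐ[k] A) {p : F × G} (hp : p ∈ pairSubgroup f g) :
    π (grp R S p) = 1 := by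
  have h : pairSubgroup f g ≤ ((π : GenDouble R S →* A).comp (grp R S)).ker := by
    rw [pairSubgroup, Subgroup.closure_le]
    rintro _ ⟨i, rfl⟩
    have e := congrArg π (genW_mul_genV R S i)
    obtain ⟨hV, hW⟩ := map_genV_genW_eq_zero hleft hright π i (hfg i)
    simpa [hV, hW] using e
  exact h hp

end commutative

end GenDouble

/-! ### Splittings: the Hopf retraction onto `kC` and the isomorphism `𝒟 ≃ kC ⊗ 𝒟_c` -/

namespace Bialgebra

variable {k D A : Type*} [Field k] [Ring D] [Bialgebra k D] [Ring A] [Algebra k A]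

/-- The convolution product of two algebra maps with commuting images. -/
def convHom (φ ψ : D →ₐ[k] A) (h : ∀ x y, Commute (φ x) (ψ y)) : D →ₐ[k] A :=
  (Algebra.TensorProduct.lift φ ψ h).comp (comulAlgHom k D)

theorem convHom_of_isGroupLikeElem (φ ψ : D →ₐ[k] A) (h : ∀ x y, Commute (φ x) (ψ y)) {x : D}
    (hx : IsGroupLikeElem k x) : convHom φ ψ h x = φ x * ψ x := by
  simp [convHom, hx.comul_eq_tmul_self]

/-- The term `φ(u) ψ(x)` vanishes. It is applied to `v_i` and `w_i`, with `ψ` factoring through the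
retraction to `kC`. -/
theorem convHom_of_skewPrimitive (φ ψ : D →ₐ[k] A) (h : ∀ x y, Commute (φ x) (ψ y)) {x u : D}
    (hx : Coalgebra.comul (R := k) x = x ⊗ₜ 1 + u ⊗ₜ x) (hψ : ψ x = 0) :
    convHom φ ψ h x = φ x := by
  simp [convHom, hx, hψ]

end Bialgebra

namespace GenDouble

open Coalgebra Bialgebra

variable {k F G I : Type*} [Field k] [CommGroup F] [CommGroup G]
  {τ₀ : F →* G →* kˣ} {f : I → F} {g : I → G}
  (R : PreNichols (diagV τ₀ f g)) (S : PreNichols (diagW τ₀ f g))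

section splitting

variable (ρ : F × G →* centralSubgroup τ₀ f g) (hρ : ∀ i, ρ (f i, g i) = 1)

/-- The algebra map `𝒟 → kC` with `v_i, w_i ↦ 0` which extends a map `F × G → C`. -/
def retractHom : GenDouble R S →ₐ[k] MonoidAlgebra k (centralSubgroup τ₀ f g) :=
  aug R S ((MonoidAlgebra.of k _).comp ρ) fun i => by rw [MonoidHom.comp_apply, hρ, map_one]

@[simp] theorem retractHom_genV (i : I) : retractHom R S ρ hρ (genV R S i) = 0 := by
  simp [retractHom]

@[simp] theorem retractHom_genW (i : I) : retractHom R S ρ hρ (genW R S i) = 0 := by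
  simp [retractHom]

@[simp] theorem retractHom_grp (c : F × G) :
    retractHom R S ρ hρ (grp R S c) = MonoidAlgebra.of k _ (ρ c) := by
  rw [retractHom, aug_grp, MonoidHom.comp_apply]

/-- The map `retractHom` as a map of Hopf algebras. -/
def retract : GenDouble R S →ₐc[k] MonoidAlgebra k (centralSubgroup τ₀ f g) :=
  BialgHom.ofAlgHom (retractHom R S ρ hρ)
    (algHom_ext (fun i => by simp [counit_genV]) (fun i => by simp [counit_genW])
      fun c => by
        rw [AlgHom.comp_apply, retractHom_grp]
        simp [(isGroupLikeElem_grp R S c).counit_eq_one])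
    (algHom_ext (fun i => by simp [comul_genV]) (fun i => by simp [comul_genW])
      fun c => by
        simp only [AlgHom.comp_apply, Bialgebra.comulAlgHom_apply,
          (isGroupLikeElem_grp R S c).comul_eq_tmul_self, Algebra.TensorProduct.map_tmul,
          retractHom_grp]
        simp)

/-- The inclusion `kC → 𝒟` as a map of algebras. -/
def inclHom : MonoidAlgebra k (centralSubgroup τ₀ f g) →ₐ[k] GenDouble R S :=
  MonoidAlgebra.lift k (GenDouble R S) _ ((grp R S).comp (centralSubgroup τ₀ f g).subtype)

theorem incl_apply (z : MonoidAlgebra k (centralSubgroup τ₀ f g)) :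
    incl R S z = inclHom R S z := rfl

theorem inclHom_of (c : centralSubgroup τ₀ f g) :
    inclHom R S (MonoidAlgebra.of k _ c) = grp R S c :=
  MonoidAlgebra.lift_of _ _

theorem commute_inclHom (z : MonoidAlgebra k (centralSubgroup τ₀ f g)) (x : GenDouble R S) :
    Commute (inclHom R S z) x := by
  induction z using MonoidAlgebra.induction_linear with
  | zero => simp
  | add a b ha hb => rw [map_add]; exact ha.add_left hb
  | single c r =>
    have : inclHom R S (MonoidAlgebra.single c r) = r • grp R S c :=
      MonoidAlgebra.lift_single _ _ _
    rw [this]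
    exact (commute_grp c.2 x).smul_left r

theorem retract_comp_incl (hC : ∀ c : centralSubgroup τ₀ f g, ρ c = c) :
    (retract R S ρ hρ).comp (incl R S) = BialgHom.id k _ := by
  have h : (retractHom R S ρ hρ).comp (inclHom R S) = AlgHom.id k _ := by
    refine MonoidAlgebra.algHom_ext (fun c => ?_) (AlgHom.ext fun r => AlgHom.commutes _ r)
    change retractHom R S ρ hρ (inclHom R S (MonoidAlgebra.of k _ c)) = MonoidAlgebra.of k _ c
    rw [inclHom_of, retractHom_grp, hC]
  exact BialgHom.ext fun x => DFunLike.congr_fun h x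

/-- The projection `𝒟 → 𝒟_c`. -/
def toQuot : GenDouble R S →ₐ[k] Quot R S := RingQuot.mkAlgHom k _

theorem toQuot_surjective : Function.Surjective (toQuot R S) := RingQuot.mkAlgHom_surjective k _

theorem toQuot_grp {c : F × G} (hc : c ∈ centralSubgroup τ₀ f g) :
    toQuot R S (grp R S c) = 1 :=
  (RingQuot.mkAlgHom_rel k ⟨c, hc, rfl, rfl⟩).trans (map_one _)

/-- The algebra endomorphism `x ↦ x₁ S(π(x₂))` of the double. -/
def coinvHom : GenDouble R S →ₐ[k] GenDouble R S :=
  convHom (AlgHom.id k _)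
    -- The pointwise inverse `ρ⁻¹` realizes `S ∘ π`. It gives an algebra map because `C` is abelian,
    -- and its convolution with the identity is one because `kC` is central in `𝒟`.
    ((inclHom R S).comp (retractHom R S ρ⁻¹ fun i => by rw [MonoidHom.inv_apply, hρ, inv_one]))
    fun x _ => (commute_inclHom R S _ x).symm

theorem coinvHom_genV (i : I) : coinvHom R S ρ hρ (genV R S i) = genV R S i :=
  convHom_of_skewPrimitive _ _ _ (comul_genV i) (by simp)

theorem coinvHom_genW (i : I) : coinvHom R S ρ hρ (genW R S i) = genW R S i :=
  convHom_of_skewPrimitive _ _ _ (comul_genW i) (by simp)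

theorem coinvHom_grp (c : F × G) :
    coinvHom R S ρ hρ (grp R S c) = grp R S (c * (ρ c : F × G)⁻¹) := by
  refine (convHom_of_isGroupLikeElem _ _ _ (isGroupLikeElem_grp R S c)).trans ?_
  rw [AlgHom.comp_apply, retractHom_grp, inclHom_of, AlgHom.id_apply, ← map_mul]
  rfl

variable (hC : ∀ c : centralSubgroup τ₀ f g, ρ c = c)

/-- The algebra map `𝒟_c → 𝒟`, `x ↦ x₁ S(π(x₂))`. -/
def quotHom : Quot R S →ₐ[k] GenDouble R S :=
  RingQuot.liftAlgHom k ⟨coinvHom R S ρ hρ, by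
    rintro _ _ ⟨c, hc, rfl, rfl⟩
    rw [coinvHom_grp, hC ⟨c, hc⟩, mul_inv_cancel, map_one, map_one]⟩

theorem quotHom_toQuot (x : GenDouble R S) :
    quotHom R S ρ hρ hC (toQuot R S x) = coinvHom R S ρ hρ x :=
  RingQuot.liftAlgHom_mkAlgHom_apply k _ _ _

/-- The algebra map `𝒟 → kC ⊗ 𝒟_c`, `x ↦ π(x₂) ⊗ x₁`. -/
def splitHom : GenDouble R S →ₐ[k] MonoidAlgebra k (centralSubgroup τ₀ f g) ⊗[k] Quot R S :=
  convHom (Algebra.TensorProduct.includeRight.comp (toQuot R S))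
    (Algebra.TensorProduct.includeLeft.comp (retractHom R S ρ hρ))
    fun x y => by simp [commute_iff_eq]

theorem splitHom_genV (i : I) :
    splitHom R S ρ hρ (genV R S i) = 1 ⊗ₜ toQuot R S (genV R S i) :=
  convHom_of_skewPrimitive _ _ _ (comul_genV i) (by simp)

theorem splitHom_genW (i : I) :
    splitHom R S ρ hρ (genW R S i) = 1 ⊗ₜ toQuot R S (genW R S i) :=
  convHom_of_skewPrimitive _ _ _ (comul_genW i) (by simp)

theorem splitHom_grp (c : F × G) : splitHom R S ρ hρ (grp R S c) =
    MonoidAlgebra.of k _ (ρ c) ⊗ₜ toQuot R S (grp R S c) := by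
  refine (convHom_of_isGroupLikeElem _ _ _ (isGroupLikeElem_grp R S c)).trans ?_
  rw [AlgHom.comp_apply, AlgHom.comp_apply, retractHom_grp, Algebra.TensorProduct.includeRight_apply,
    Algebra.TensorProduct.includeLeft_apply, Algebra.TensorProduct.tmul_mul_tmul, one_mul, mul_one]

/-- The algebra map `kC ⊗ 𝒟_c → 𝒟`, `c ⊗ x ↦ c x₁ S(π(x₂))`. -/
def joinHom : MonoidAlgebra k (centralSubgroup τ₀ f g) ⊗[k] Quot R S →ₐ[k] GenDouble R S :=
  Algebra.TensorProduct.lift (inclHom R S) (quotHom R S ρ hρ hC) fun x _ => commute_inclHom R S x _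

theorem joinHom_tmul (z : MonoidAlgebra k (centralSubgroup τ₀ f g)) (x : GenDouble R S) :
    joinHom R S ρ hρ hC (z ⊗ₜ toQuot R S x) = inclHom R S z * coinvHom R S ρ hρ x := by
  rw [joinHom, Algebra.TensorProduct.lift_tmul, quotHom_toQuot]

/-- On generators: `v_i` and `w_i` are fixed, and a group element factors as `c = ρ(c) · c ρ(c)⁻¹`.
-/
theorem joinHom_comp_splitHom :
    (joinHom R S ρ hρ hC).comp (splitHom R S ρ hρ) = AlgHom.id k _ := by
  refine algHom_ext (fun i => ?_) (fun i => ?_) fun c => ?_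
  · rw [AlgHom.comp_apply, splitHom_genV, joinHom_tmul, map_one, one_mul, coinvHom_genV,
      AlgHom.id_apply]
  · rw [AlgHom.comp_apply, splitHom_genW, joinHom_tmul, map_one, one_mul, coinvHom_genW,
      AlgHom.id_apply]
  · rw [AlgHom.comp_apply, splitHom_grp, joinHom_tmul, inclHom_of, coinvHom_grp, ← map_mul,
      mul_comm c, mul_inv_cancel_left, AlgHom.id_apply]

include hC in
theorem splitHom_inclHom (z : MonoidAlgebra k (centralSubgroup τ₀ f g)) :
    splitHom R S ρ hρ (inclHom R S z) = z ⊗ₜ 1 := by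
  have h : (splitHom R S ρ hρ).comp (inclHom R S) = Algebra.TensorProduct.includeLeft := by
    refine MonoidAlgebra.algHom_ext (fun c => ?_)
      (AlgHom.ext fun r => (AlgHom.commutes _ r).trans (AlgHom.commutes _ r).symm)
    change splitHom R S ρ hρ (inclHom R S (MonoidAlgebra.of k _ c)) = MonoidAlgebra.of k _ c ⊗ₜ 1
    rw [inclHom_of, splitHom_grp, hC, toQuot_grp R S c.2]
  rw [← AlgHom.comp_apply, h, Algebra.TensorProduct.includeLeft_apply]

include hC in
-- On a group element `c`, the `kC`-component is `ρ(c ρ(c)⁻¹) = 1`, since `ρ` is the identity on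
-- `C`; in the other component `ρ(c)⁻¹` becomes `1`, since it lies in `C`.
theorem splitHom_coinvHom (x : GenDouble R S) :
    splitHom R S ρ hρ (coinvHom R S ρ hρ x) = 1 ⊗ₜ toQuot R S x := by
  have h : (splitHom R S ρ hρ).comp (coinvHom R S ρ hρ) =
      Algebra.TensorProduct.includeRight.comp (toQuot R S) := by
    refine algHom_ext (fun i => ?_) (fun i => ?_) fun c => ?_
    · rw [AlgHom.comp_apply, coinvHom_genV, splitHom_genV]; rfl
    · rw [AlgHom.comp_apply, coinvHom_genW, splitHom_genW]; rfl
    · rw [AlgHom.comp_apply, coinvHom_grp, splitHom_grp, map_mul ρ, map_inv ρ,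
        hC, mul_inv_cancel, map_one, map_mul, map_mul,
        toQuot_grp R S (inv_mem (ρ c).2), mul_one]
      rfl
  rw [← AlgHom.comp_apply, h, AlgHom.comp_apply, Algebra.TensorProduct.includeRight_apply]

theorem splitHom_comp_joinHom :
    (splitHom R S ρ hρ).comp (joinHom R S ρ hρ hC) = AlgHom.id k _ := by
  refine AlgHom.ext fun z => ?_
  rw [AlgHom.comp_apply, AlgHom.id_apply]
  induction z with
  | zero => rw [map_zero, map_zero]
  | add a b ha hb => rw [map_add, map_add, ha, hb]
  | tmul z x =>
    obtain ⟨y, rfl⟩ := toQuot_surjective R S x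
    rw [joinHom_tmul, map_mul, splitHom_inclHom R S ρ hρ hC, splitHom_coinvHom R S ρ hρ hC,
      Algebra.TensorProduct.tmul_mul_tmul, mul_one, one_mul]

/-- The algebra isomorphism `𝒟 ≃ kC ⊗ 𝒟_c` given by a splitting of the inclusion of `C` which is
trivial on `P`. -/
def splitEquiv :
    GenDouble R S ≃ₐ[k] MonoidAlgebra k (centralSubgroup τ₀ f g) ⊗[k] Quot R S :=
  AlgEquiv.ofAlgHom (splitHom R S ρ hρ) (joinHom R S ρ hρ hC)
    (splitHom_comp_joinHom R S ρ hρ hC) (joinHom_comp_splitHom R S ρ hρ hC)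

end splitting

/-! ### Counting characters of `𝒟` and of `kC ⊗ 𝒟_c` -/

section counting

variable {R S}

/-- The character of `F × G` defined by a character of the double. -/
def charOfAlgHom (χ : GenDouble R S →ₐ[k] k) : F × G →* kˣ :=
  ((χ : GenDouble R S →* k).comp (grp R S)).toHomUnits

/-- A character of `𝒟` kills every `v_i` and `w_i` and is trivial on `P`, so it is determined by a
character of `(F × G)/P`. -/
theorem card_algHom_le [Finite F] [Finite G] (hleft : ∀ x, (∀ y, τ₀ x y = 1) → x = 1)
    (hright : ∀ y, (∀ x, τ₀ x y = 1) → y = 1) (hfg : ∀ i, f i ≠ 1 ∨ g i ≠ 1) :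
    Finite (GenDouble R S →ₐ[k] k) ∧
      Nat.card (GenDouble R S →ₐ[k] k) ≤ Nat.card ((F × G) ⧸ pairSubgroup f g) := by
  let j : (GenDouble R S →ₐ[k] k) → ((F × G) ⧸ pairSubgroup f g →* kˣ) := fun χ =>
    QuotientGroup.lift _ (charOfAlgHom χ) fun p hp =>
      Units.ext (map_grp_eq_one hleft hright hfg χ hp)
  have hj : Function.Injective j := fun χ χ' h => by
    refine algHom_ext (fun i => ?_) (fun i => ?_) fun c => ?_
    · rw [(map_genV_genW_eq_zero hleft hright χ i (hfg i)).1,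
        (map_genV_genW_eq_zero hleft hright χ' i (hfg i)).1]
    · rw [(map_genV_genW_eq_zero hleft hright χ i (hfg i)).2,
        (map_genV_genW_eq_zero hleft hright χ' i (hfg i)).2]
    · exact congrArg Units.val (DFunLike.congr_fun h (c : (F × G) ⧸ pairSubgroup f g))
  exact ⟨Finite.of_injective j hj,
    (Nat.card_le_card_of_injective j hj).trans (card_monoidHom_units_le k _)⟩

variable (R S) in
/-- The character of `𝒟_c` defined by an element of `C ∩ P`. -/
def quotChar (e : (centralSubgroup τ₀ f g ⊓ pairSubgroup f g : Subgroup (F × G))) :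
    Quot R S →ₐ[k] k :=
  -- The two memberships of `e` play different roles: `e ∈ C` makes `β(e, -)` trivial on the `(f_i,
  -- g_i)`, so that it extends to `𝒟`; `e ∈ P` makes it trivial on `C`, the complement of `P`, so
  -- that it descends to `𝒟_c`.
  RingQuot.liftAlgHom k ⟨aug R S ((Units.coeHom k).comp (sqPairing τ₀ e)) fun i => by
      have h := e.2.1 i
      rw [MonoidHom.comp_apply, sqPairing_apply, mul_comm, h, map_one], by
    rintro _ _ ⟨c, hc, rfl, rfl⟩
    rw [← orthogonalSubgroup_pairSubgroup, mem_orthogonalSubgroup] at hc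
    refine (aug_grp _ _ c).trans (Eq.trans ?_ (map_one _).symm)
    rw [MonoidHom.comp_apply, sqPairing_comm, hc e e.2.2, map_one]⟩

theorem quotChar_toQuot_grp
    (e : (centralSubgroup τ₀ f g ⊓ pairSubgroup f g : Subgroup (F × G))) (c : F × G) :
    quotChar R S e (toQuot R S (grp R S c)) = sqPairing τ₀ e c :=
  (RingQuot.liftAlgHom_mkAlgHom_apply k _ _ _).trans (aug_grp _ _ c)

/-- An isomorphism `𝒟 ≃ kC ⊗ 𝒟_c` forces `C ∩ P` to be trivial, since otherwise `kC ⊗ 𝒟_c` has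
more characters than `𝒟`. -/
theorem inf_eq_bot_of_algEquiv [Finite F] [Finite G]
    (hleft : ∀ x, (∀ y, τ₀ x y = 1) → x = 1)
    (hright : ∀ y, (∀ x, τ₀ x y = 1) → y = 1) (hfg : ∀ i, f i ≠ 1 ∨ g i ≠ 1)
    (α : GenDouble R S ≃ₐ[k] MonoidAlgebra k (centralSubgroup τ₀ f g) ⊗[k] Quot R S) :
    centralSubgroup τ₀ f g ⊓ pairSubgroup f g = ⊥ := by
  have hβ := sqPairing_injective τ₀ hleft hright
  obtain ⟨hfin, hle⟩ := card_algHom_le (R := R) (S := S) hleft hright hfg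
  have hC : Nat.card (centralSubgroup τ₀ f g) = Nat.card ((F × G) ⧸ pairSubgroup f g) := by
    have h := card_orthogonalSubgroup_mul_card _ hβ (pairSubgroup f g)
    rw [orthogonalSubgroup_pairSubgroup,
      Subgroup.card_eq_card_quotient_mul_card_subgroup (pairSubgroup f g)] at h
    exact Nat.eq_of_mul_eq_mul_right Nat.card_pos h
  -- A character of `C` and an element of `C ∩ P` define a character of `kC ⊗ 𝒟_c`. The pair can be
  -- recovered from the values on `c ⊗ 1` and, as `β` is non-degenerate, on `1 ⊗ d`.
  let m : (centralSubgroup τ₀ f g →* kˣ) ×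
      (centralSubgroup τ₀ f g ⊓ pairSubgroup f g : Subgroup (F × G)) →
      MonoidAlgebra k (centralSubgroup τ₀ f g) ⊗[k] Quot R S →ₐ[k] k := fun p =>
    Algebra.TensorProduct.lift (MonoidAlgebra.lift k k _ ((Units.coeHom k).comp p.1))
      (quotChar R S p.2) fun _ _ => Commute.all _ _
  have hm : ∀ p c d, m p (MonoidAlgebra.of k _ c ⊗ₜ toQuot R S (grp R S d)) =
      p.1 c * sqPairing τ₀ p.2 d := fun p c d => by
    rw [Algebra.TensorProduct.lift_tmul, MonoidAlgebra.lift_of, quotChar_toQuot_grp]; rfl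
  have hinj : Function.Injective fun p => (m p).comp (α : GenDouble R S →ₐ[k] _) := by
    intro p q h
    have h' : m p = m q := by
      refine AlgHom.ext fun x => ?_
      obtain ⟨x, rfl⟩ := α.surjective x
      exact DFunLike.congr_fun h x
    refine Prod.ext (MonoidHom.ext fun c => Units.ext ?_) (Subtype.ext (hβ (MonoidHom.ext
      fun d => Units.ext ?_)))
    · have := DFunLike.congr_fun h' (MonoidAlgebra.of k _ c ⊗ₜ toQuot R S (grp R S 1))
      rw [hm, hm] at this
      simpa only [map_one, Units.val_one, mul_one] using this
    · have := DFunLike.congr_fun h' (MonoidAlgebra.of k _ 1 ⊗ₜ toQuot R S (grp R S d))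
      rw [hm, hm] at this
      simpa only [map_one, Units.val_one, one_mul] using this
  have hcard := (Nat.card_le_card_of_injective _ hinj).trans hle
  -- As `C` has exactly `|C|` characters over `k`, the inequality becomes `|C| |C ∩ P| ≤ |C|`.
  rw [Nat.card_prod, card_monoidHom_units_subgroup _ hβ, ← hC] at hcard
  refine Subgroup.eq_bot_of_card_le _ ?_
  exact Nat.le_of_mul_le_mul_left (by rwa [mul_one]) (Nat.card_pos (α := centralSubgroup τ₀ f g))

end counting

end GenDouble

end

/-! ### Assembling the equivalences -/

theorem theorem4p2 {k F G I : Type*} [Field k] [CommGroup F] [CommGroup G]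
    (τ₀ : F →* G →* kˣ) (f : I → F) (g : I → G)
    (R : PreNichols (diagV τ₀ f g)) (S : PreNichols (diagW τ₀ f g))
    (hfin : Finite F ∨ Finite G)
    (hleft : ∀ x, (∀ y, τ₀ x y = 1) → x = 1)
    (hright : ∀ y, (∀ x, τ₀ x y = 1) → y = 1) :
    (Finite F ∧ Finite G ∧ Nat.card F = Nat.card G) ∧
    Nat.card (centralSubgroup τ₀ f g) * Nat.card (pairSubgroup f g) =
      Nat.card F * Nat.card G ∧
    [∃ r : (F × G) ⧸ pairSubgroup f g →* centralSubgroup τ₀ f g,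
        r.comp (natMap τ₀ f g) = MonoidHom.id (centralSubgroup τ₀ f g),
      Function.Injective (natMap τ₀ f g),
      Function.Surjective (natMap τ₀ f g),
      Function.Bijective (natMap τ₀ f g),
      Function.Injective (prodMap τ₀ f g),
      Function.Surjective (prodMap τ₀ f g),
      Function.Bijective (prodMap τ₀ f g)].TFAE ∧
    ((∀ i, f i ≠ 1 ∨ g i ≠ 1) →
      [∃ r : (F × G) ⧸ pairSubgroup f g →* centralSubgroup τ₀ f g,
          r.comp (natMap τ₀ f g) = MonoidHom.id (centralSubgroup τ₀ f g),
        Function.Injective (natMap τ₀ f g),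
        Function.Surjective (natMap τ₀ f g),
        Function.Bijective (natMap τ₀ f g),
        Function.Injective (prodMap τ₀ f g),
        Function.Surjective (prodMap τ₀ f g),
        Function.Bijective (prodMap τ₀ f g),
        ∃ π : GenDouble R S →ₐc[k] MonoidAlgebra k (centralSubgroup τ₀ f g),
          π.comp (GenDouble.incl R S) = BialgHom.id k (MonoidAlgebra k (centralSubgroup τ₀ f g)),
        Nonempty (GenDouble R S ≃ₐ[k]
          MonoidAlgebra k (centralSubgroup τ₀ f g) ⊗[k] GenDouble.Quot R S)].TFAE) := by
  have hFG : (Finite F ∧ Finite G) ∧ Nat.card F = Nat.card G := by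
    have h1 : Finite F ∧ Finite G := by
      rcases hfin with h | h
      · exact ⟨h, (card_le_of_pairing τ₀.flip hright).1⟩
      · exact ⟨(card_le_of_pairing τ₀ hleft).1, h⟩
    obtain ⟨_, _⟩ := h1
    exact ⟨⟨‹_›, ‹_›⟩, le_antisymm (card_le_of_pairing τ₀ hleft).2
      (card_le_of_pairing τ₀.flip hright).2⟩
  obtain ⟨⟨_, _⟩, hcard⟩ := hFG
  have hCP := card_orthogonalSubgroup_mul_card _ (sqPairing_injective τ₀ hleft hright)
    (pairSubgroup f g)
  rw [orthogonalSubgroup_pairSubgroup] at hCP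
  have hgroup := group_conditions_tfae f g hCP
  refine ⟨⟨‹_›, ‹_›, hcard⟩, by rw [hCP, Nat.card_prod], hgroup, fun hfg => ?_⟩
  -- Injectivity gives a splitting of `C → (F × G)/P`; composed with the projection from `F × G`, it
  -- becomes the datum `ρ` on which both Hopf-theoretic constructions depend.
  have hsplit : Function.Injective (natMap τ₀ f g) → ∃ ρ : F × G →* centralSubgroup τ₀ f g,
      (∀ i, ρ (f i, g i) = 1) ∧ ∀ c : centralSubgroup τ₀ f g, ρ c = c := fun h => by
    obtain ⟨r, hr⟩ := (hgroup.out 1 0).1 h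
    refine ⟨r.comp (QuotientGroup.mk' _), fun i => ?_, fun c => DFunLike.congr_fun hr c⟩
    have h1 : (QuotientGroup.mk' (pairSubgroup f g)) (f i, g i) = 1 :=
      (QuotientGroup.eq_one_iff _).2 (Subgroup.subset_closure ⟨i, rfl⟩)
    rw [MonoidHom.comp_apply, h1, map_one]
  tfae_have 1 ↔ 2 := hgroup.out 0 1
  tfae_have 2 ↔ 3 := hgroup.out 1 2
  tfae_have 3 ↔ 4 := hgroup.out 2 3
  tfae_have 4 ↔ 5 := hgroup.out 3 4
  tfae_have 5 ↔ 6 := hgroup.out 4 5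
  tfae_have 6 ↔ 7 := hgroup.out 5 6
  tfae_have 2 → 8 := fun h => by
    obtain ⟨ρ, hρ, hC⟩ := hsplit h
    exact ⟨GenDouble.retract R S ρ hρ, GenDouble.retract_comp_incl R S ρ hρ hC⟩
  -- An element of `C ∩ P` is fixed by `π` because it lies in `C`, and is sent to `1` because it
  -- lies in `P` and `kC` is commutative.
  tfae_have 8 → 2 := fun ⟨π, hπ⟩ => by
    rw [natMap_injective_iff]
    intro c hc hp
    have h1 := GenDouble.map_grp_eq_one hleft hright hfg
      (π : GenDouble R S →ₐ[k] MonoidAlgebra k (centralSubgroup τ₀ f g)) hp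
    have h2 : π (GenDouble.incl R S (MonoidAlgebra.of k _ ⟨c, hc⟩)) =
        MonoidAlgebra.of k _ ⟨c, hc⟩ := DFunLike.congr_fun hπ _
    rw [GenDouble.incl_apply, GenDouble.inclHom_of] at h2
    have h3 : MonoidAlgebra.of k _ (⟨c, hc⟩ : centralSubgroup τ₀ f g) =
        MonoidAlgebra.of k _ 1 := h2.symm.trans (h1.trans (map_one _).symm)
    exact congrArg Subtype.val (MonoidAlgebra.of_injective h3)
  tfae_have 2 → 9 := fun h => by
    obtain ⟨ρ, hρ, hC⟩ := hsplit h
    exact ⟨GenDouble.splitEquiv R S ρ hρ hC⟩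
  tfae_have 9 → 2 := fun ⟨α⟩ => by
    rw [natMap_injective_iff]
    intro c hc hp
    have h : c ∈ centralSubgroup τ₀ f g ⊓ pairSubgroup f g := ⟨hc, hp⟩
    rwa [GenDouble.inf_eq_bot_of_algEquiv hleft hright hfg α] at h
  tfae_finish
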